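/- Label eight points by $\{1,\dots,8\}$, and let a \emph{pair} $\mathcal Q=(\mathcal I,\mathcal J)$ consist of a set $\mathcal I$ of $3$-element subsets and a set $\mathcal J$ of $6$-element subsets of $\{1,\dots,8\}$. A configuration $\mathbf p=(p_1,\dots,p_8)$ of eight distinct points of $\mathbb P^2_{\mathbb C}$ \emph{represents} $\mathcal Q$ if the triples of points of $\mathbf p$ that lie on a line are exactly those indexed by $\mathcal I$ and the sextuples of points of $\mathbf p$ that lie on an irreducible conic are exactly those indexed by $\mathcal J$. The pair $(\mathcal I,\mathcal J)$ is \emph{matroidal} if there are a configuration $\mathbf p$ and a set $\mathcal J'$ of sextuples such that $\mathbf p$ represents $(\mathcal I,\mathcal J')$. It satisfies \emph{Bézout's weak criteria} if (1) $|I\cap J|\le 2$ for all $I\in\mathcal I$, $J\in\mathcal J$; (2) whenever $I_1,I_2\in\mathcal I$ and $|I_1\cap I_2|>1$, every $3$-element subset of $I_1\cup I_2$ belongs to $\mathcal I$; (3) whenever $J_1,J_2\in\mathcal J$ and $|J_1\cap J_2|>4$, every $6$-element subset of $J_1\cup J_2$ belongs to $\mathcal J$. A \emph{candidate quatroid} is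 a matroidal pair that satisfies Bézout's weak criteria. The symmetric group $\mathfrak S_8$ acts on pairs by permuting the labels. **Theorem.** There are exactly $780617$ candidate quatroids. The set of candidate quatroids is stable under $\mathfrak S_8$, and it consists of exactly $126$ orbits. The number of orbits of each size is given by the following table, and there are no orbits of any other size: $$\begin{array}{|c||c|c|c|c|c|c|c|c|c|c|} \hline \text{Orbit size} & 1 & 8 & 28 & 35 & 56 & 70 & 105 & 168 & 210 & 280\\ \hline \#\,\text{Orbits} & 3 & 2 & 2 & 1 & 3 & 1 & 1 & 3 & 2 & 3\\ \hline\hline \text{Orbit size} & 420 & 560 & 840 & 1680 & 2520 & 3360 & 5040 & 6720 & 10080 & 20160\\ \hline \#\,\text{Orbits} & 2 & 1 & 13 & 4 & 10 & 13 & 17 & 6 & 22 & 17\\ \hline \end{array}$$ -/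

import Mathlib

open scoped LinearAlgebra.Projectivization Pointwise

/-- A pair `(𝓘, 𝓙)` of collections of subsets of an eight-element set (labelled by `Fin 8`).
The symmetric group `Equiv.Perm (Fin 8)` acts on it through Mathlib's pointwise action on
finite sets, i.e. by relabelling. -/
abbrev Pair : Type := Finset (Finset (Fin 8)) × Finset (Finset (Fin 8))

/-- The first component consists of triples and the second one of sextuples. -/
def Pair.OfTriplesAndSextuples (Q : Pair) : Prop :=
  (∀ I ∈ Q.1, I.card = 3) ∧ (∀ J ∈ Q.2, J.card = 6)

/-- The complex projective plane. -/
abbrev ComplexPlane : Type := ℙ ℂ (Fin 3 → ℂ)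

/-- The points of `p` indexed by `S` lie on a common line `{x | ℓ ⬝ x = 0}`, `ℓ ≠ 0`. -/
def OnLine (p : Fin 8 → ComplexPlane) (S : Finset (Fin 8)) : Prop :=
  ∃ ℓ : ComplexPlane, ∀ i ∈ S, ℓ.orthogonal (p i)

/-- The points of `p` indexed by `S` lie on a common irreducible conic. The vanishing of a form
at a point of the plane does not depend on the homogeneous coordinates `rep` of that point. -/
def OnConic (p : Fin 8 → ComplexPlane) (S : Finset (Fin 8)) : Prop :=
  ∃ q : MvPolynomial (Fin 3) ℂ, q.IsHomogeneous 2 ∧ Irreducible q ∧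
    ∀ i ∈ S, MvPolynomial.eval (p i).rep q = 0

/-- The realization space of a pair: the configurations of eight distinct points of the complex
projective plane whose collinear triples are exactly those in `Q.1` and whose sextuples on an
irreducible conic are exactly those in `Q.2`. -/
def Pair.realizationSpace (Q : Pair) : Set (Fin 8 → ComplexPlane) :=
  {p | Function.Injective p ∧
    (∀ I : Finset (Fin 8), I.card = 3 → (I ∈ Q.1 ↔ OnLine p I)) ∧
    (∀ J : Finset (Fin 8), J.card = 6 → (J ∈ Q.2 ↔ OnConic p J))}

/-- The realization space of the matroid on eight elements whose nonbases of size three are the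
elements of `𝓘`. -/
def matroidRealizationSpace (𝓘 : Finset (Finset (Fin 8))) : Set (Fin 8 → ComplexPlane) :=
  ⋃ 𝓙 : Finset (Finset (Fin 8)), Pair.realizationSpace (𝓘, 𝓙)

/-- A pair is matroidal if its underlying matroid is representable over `ℂ`. -/
def Pair.IsMatroidal (Q : Pair) : Prop :=
  (matroidRealizationSpace Q.1).Nonempty

/-- Bézout's weak criteria. -/
structure Pair.BezoutWeak (Q : Pair) : Prop where
  /-- A line and a conic meet in at most two points. -/
  line_conic : ∀ I ∈ Q.1, ∀ J ∈ Q.2, (I ∩ J).card ≤ 2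
  /-- Two lines meet in at most one point. -/
  line_line : ∀ I₁ ∈ Q.1, ∀ I₂ ∈ Q.1, 1 < (I₁ ∩ I₂).card →
    ∀ I ⊆ I₁ ∪ I₂, I.card = 3 → I ∈ Q.1
  /-- Two conics meet in at most four points. -/
  conic_conic : ∀ J₁ ∈ Q.2, ∀ J₂ ∈ Q.2, 4 < (J₁ ∩ J₂).card →
    ∀ J ⊆ J₁ ∪ J₂, J.card = 6 → J ∈ Q.2

/-- The set of candidate quatroids. -/
def candidateQuatroids : Set Pair :=
  {Q | Q.OfTriplesAndSextuples ∧ Q.IsMatroidal ∧ Q.BezoutWeak}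

/-- The set of orbits of candidate quatroids under the symmetric group on the eight labels. -/
def candidateOrbits : Set (Set Pair) :=
  {O | ∃ Q ∈ candidateQuatroids, O = MulAction.orbit (Equiv.Perm (Fin 8)) Q}

/-- The table of orbit sizes: the number of orbits of a given size. -/
def orbitTally : ℕ → ℕ
  | 1 => 3
  | 8 => 2
  | 28 => 2
  | 35 => 1
  | 56 => 3
  | 70 => 1
  | 105 => 1
  | 168 => 3
  | 210 => 2
  | 280 => 3
  | 420 => 2
  | 560 => 1
  | 840 => 13
  | 1680 => 4
  | 2520 => 10
  | 3360 => 13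
  | 5040 => 17
  | 6720 => 6
  | 10080 => 22
  | 20160 => 17
  | _ => 0

/-! Replacing each sextuple by its complement turns a pair `Q` into a set of triples together with a
graph on the eight labels. In these terms Bézout's weak criteria are local (`Lawful`): of the four
triples in a 4-set either all or at most one are present, of the seven edges at a vertex either all
or at most one are present, and no edge is disjoint from a present triple. The first rule says that
the triples come from a linear space; the second says that the graph is a matching, a star or
complete. Being matroidal concerns the triples alone. So the task is to classify, with orbit sizes,
the linear spaces on eight points that are representable over ℂ, and then the admissible graphs on
each of them.

The classification adds labels in the stages 0, 5, 6, 7, 8 and finally adds the graph. The result of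
a stage is a `Census`: one representative for each orbit, and the size of its orbit. For the next
stage, restriction to the earlier labels is equivariant, so every new structure can be moved until
its restriction is one of the earlier representatives. A backtracking search (`extensions`) lists
all lawful extensions of that representative, and for every extension found a stored permutation
carries it to a listed representative. Hence the orbits of the listed representatives cover
everything.

That these orbits are distinct and have the claimed sizes is not shown by invariants or canonical
forms but by double counting (`Census.of_le`, `Census.of_fibers`). Stored automorphisms bound the
stabilizer of each representative from below, hence its orbit from above by `o j`
(`ncard_orbit_le`). The number of structures is at least the sum, over the earlier representatives,
of the orbit size times the number of extensions found. A numerical check shows that the sum of the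
`o j` does not exceed this number. Then all inequalities are equalities: the covering orbits are
disjoint, and each has exactly `o j` elements. `census_of_certs` combines these arguments.

Representability enters at eight points only. For 67 linear spaces there are coordinates in the
Eisenstein integers (`isMatroidal_of_coordTest`); roots of unity are needed because of the
Möbius–Kantor configuration. The two others contain a Fano plane, which is impossible when 2 is
invertible, because the diagonal points of a quadrangle are then not collinear
(`diagonal_points_not_collinear`).

The searches and certificates are evaluated by the kernel. This is why the tests are written with
recursors and with the arithmetic of binary numerals, and why pairs are encoded by natural numbers.
-/

namespace Quatroid

/-! ### Encoding pairs by natural numbers -/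

/-- The binary digit of `x` at position `p`. -/
def bit (x p : ℕ) : Bool := Nat.beq (Nat.land (Nat.shiftRight x p) 1) 1

/-- `bit` is made of operations that the kernel evaluates on binary numerals; this is the bridge to
the lemmas about `Nat.testBit`. -/
lemma bit_eq_testBit (x p : ℕ) : bit x p = x.testBit p := by
  have h : Nat.land (Nat.shiftRight x p) 1 = (x >>> p) % 2 := Nat.and_one_is_mod _
  rw [bit, h, Nat.testBit_eq_decide_div_mod_eq, Nat.shiftRight_eq_div_pow]
  rcases Nat.mod_two_eq_zero_or_one (x / 2 ^ p) with h | h <;> rw [h] <;> rfl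

/-- The number whose binary digits are the indicator function of `S`. -/
def mask (S : Finset (Fin 8)) : ℕ := ∑ i ∈ S, 2 ^ (i : ℕ)

lemma mask_injective : Function.Injective mask := by
  intro S T h
  have := Finset.geomSum_injective (n := 2) le_rfl
    (a₁ := S.map Fin.valEmbedding) (a₂ := T.map Fin.valEmbedding) (by simpa [mask] using h)
  exact Finset.map_injective _ this

lemma mask_lt_two_pow {S : Finset (Fin 8)} {n : ℕ} (h : ∀ i ∈ S, (i : ℕ) < n) :
    mask S < 2 ^ n := by
  have := Nat.geomSum_lt (m := 2) (n := n) (s := S.map Fin.valEmbedding) le_rfl (by simpa using h)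
  simpa [mask] using this

lemma mask_lt (S : Finset (Fin 8)) : mask S < 256 :=
  mask_lt_two_pow (n := 8) fun i _ => i.isLt

lemma two_pow_le_mask {S : Finset (Fin 8)} {i : Fin 8} (h : i ∈ S) : 2 ^ (i : ℕ) ≤ mask S :=
  Finset.single_le_sum (f := fun i : Fin 8 => 2 ^ (i : ℕ)) (fun _ _ => Nat.zero_le _) h

lemma mask_erase {S : Finset (Fin 8)} {i : Fin 8} (h : i ∈ S) :
    mask (S.erase i) = mask S - 2 ^ (i : ℕ) := by
  have := Finset.add_sum_erase S (fun i : Fin 8 => 2 ^ (i : ℕ)) h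
  simp only [mask] at *
  omega

lemma mask_smul (σ : Equiv.Perm (Fin 8)) (S : Finset (Fin 8)) :
    mask (σ • S) = ∑ i ∈ S, 2 ^ (σ i : ℕ) := by
  have : σ • S = S.image σ := rfl
  rw [mask, this, Finset.sum_image (σ.injective.injOn)]

/-- The pair encoded by a natural number: the triple `S` is recorded at position `mask S`, the
sextuple `S` at position `256 + mask Sᶜ`. -/
def decode (x : ℕ) : Pair :=
  (Finset.univ.filter fun S => S.card = 3 ∧ bit x (mask S) = true,
    Finset.univ.filter fun S => S.card = 6 ∧ bit x (256 + mask Sᶜ) = true)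

lemma mem_decode_fst {x : ℕ} {S : Finset (Fin 8)} :
    S ∈ (decode x).1 ↔ S.card = 3 ∧ bit x (mask S) = true := by simp [decode]

lemma mem_decode_snd {x : ℕ} {S : Finset (Fin 8)} :
    S ∈ (decode x).2 ↔ S.card = 6 ∧ bit x (256 + mask Sᶜ) = true := by simp [decode]

lemma decode_ofTriplesAndSextuples (x : ℕ) : (decode x).OfTriplesAndSextuples :=
  ⟨fun _ h => (mem_decode_fst.1 h).1, fun _ h => (mem_decode_snd.1 h).1⟩

/-! ### Sublists of the list of labels -/

/-- The list of the eight labels. -/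
def labels : List ℕ := [0, 1, 2, 3, 4, 5, 6, 7]

lemma labels_eq : labels = (List.finRange 8).map Fin.val := by decide

/-- The sum of the powers of two with exponents in `m`. -/
noncomputable def pows (m : List ℕ) : ℕ :=
  List.rec (motive := fun _ => ℕ) 0 (fun a _ s => Nat.add (Nat.pow 2 a) s) m

lemma pows_eq (m : List ℕ) : pows m = (m.map (2 ^ ·)).sum := by
  induction m with
  | nil => rfl
  | cons a m ih => rw [List.map_cons, List.sum_cons, ← ih]; rfl

/-- The tests run over sublists of `labels`, the statements over finite sets. Listing a set in
increasing order passes from the latter to the former; `g` allows for tests that run over a filtered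
list of labels. -/
lemma exists_sublist_labels (S : Finset (Fin 8)) (g : ℕ → Bool) (hg : ∀ i ∈ S, g i = true) :
    ∃ m : List (Fin 8), (m.map Fin.val).Sublist (labels.filter g) ∧ m.Nodup ∧ m.toFinset = S := by
  refine ⟨(List.finRange 8).filter (· ∈ S), ?_, (List.nodup_finRange 8).filter _, by ext; simp⟩
  rw [labels_eq, List.filter_map]
  refine List.Sublist.map _ (List.monotone_filter_right _ fun a ha => ?_)
  exact hg a (by simpa using ha)

lemma exists_of_sublist_labels {m : List ℕ} (h : m.Sublist labels) :
    ∃ m' : List (Fin 8), m = m'.map Fin.val ∧ m'.Nodup := by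
  rw [labels_eq] at h
  obtain ⟨m', h', rfl⟩ := List.sublist_map_iff.1 h
  exact ⟨m', rfl, h'.nodup (List.nodup_finRange 8)⟩

lemma pows_eq_mask {m : List (Fin 8)} (h : m.Nodup) : pows (m.map Fin.val) = mask m.toFinset := by
  rw [pows_eq, mask, List.map_map, List.sum_toFinset _ h]
  rfl

/-- Test a predicate on all sublists of `l` of length `k`. -/
noncomputable def allSub : ℕ → List ℕ → (List ℕ → Bool) → Bool
  | 0 => fun _ f => f []
  | k + 1 => fun l => List.rec (motive := fun _ => (List ℕ → Bool) → Bool) (fun _ => true)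
      (fun x t ih f => and (allSub k t fun m => f (x :: m)) (ih f)) l

lemma allSub_iff {k : ℕ} {l : List ℕ} {f : List ℕ → Bool} :
    allSub k l f = true ↔ ∀ m, m.Sublist l → m.length = k → f m = true := by
  induction k generalizing l f with
  | zero =>
    refine ⟨fun h m _ hm => ?_, fun h => h [] (List.nil_sublist _) rfl⟩
    rw [List.length_eq_zero_iff.1 hm]; exact h
  | succ k ih =>
    induction l with
    | nil =>
      refine ⟨fun _ m hm hk => ?_, fun _ => rfl⟩
      rw [List.sublist_nil.1 hm] at hk
      simp at hk
    | cons x t iht =>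
      have : allSub (k + 1) (x :: t) f =
          ((allSub k t fun m => f (x :: m)) && allSub (k + 1) t f) := rfl
      rw [this, Bool.and_eq_true, ih, iht]
      constructor
      · rintro ⟨h₁, h₂⟩ m hm hk
        rcases List.sublist_cons_iff.1 hm with h | ⟨r, rfl, h⟩
        · exact h₂ m h hk
        · exact h₁ r h (by simpa using hk)
      · intro h
        exact ⟨fun m hm hk => h _ (hm.cons_cons x) (by simp [hk]),
          fun m hm hk => h m (hm.cons x) hk⟩

/-! ### Permutations of codes -/

/-- The power `2 ^ b` if `e` has the digit one at position `a`, and zero otherwise. -/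
noncomputable def moveBit (e a b : ℕ) : ℕ :=
  Nat.rec 0 (fun _ _ => Nat.pow 2 b) (Nat.land (Nat.shiftRight e a) 1)

lemma testBit_moveBit (e a b q : ℕ) :
    (moveBit e a b).testBit q = true ↔ bit e a = true ∧ q = b := by
  have h : Nat.land (Nat.shiftRight e a) 1 = (Nat.shiftRight e a) % 2 := Nat.and_one_is_mod _
  rw [moveBit, bit, h]
  rcases Nat.mod_two_eq_zero_or_one (Nat.shiftRight e a) with h | h <;> rw [h]
  · simp
  · change (2 ^ b).testBit q = true ↔ _
    rw [Nat.testBit_two_pow]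
    simp [eq_comm]

/-- Move the digits of `e` at the sums of `k` first components of `l` to the sums of the
corresponding second components. -/
noncomputable def moveSub (e : ℕ) : ℕ → List (ℕ × ℕ) → ℕ → ℕ → ℕ
  | 0 => fun _ a b => moveBit e a b
  | k + 1 => fun l => List.rec (motive := fun _ => ℕ → ℕ → ℕ) (fun _ _ => 0)
      (fun p t ih a b => Nat.lor (moveSub e k t (Nat.add a p.1) (Nat.add b p.2)) (ih a b)) l

/-- The accumulators `a` and `b` hold the partial sums of the source and target positions. With
components `2 ^ i` and `2 ^ σ i` the full sums are the masks of a set and of its image, so this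
operation applies `σ` to all `k`-subsets at once. -/
lemma testBit_moveSub {e k : ℕ} {l : List (ℕ × ℕ)} {a b q : ℕ} :
    (moveSub e k l a b).testBit q = true ↔ ∃ m : List (ℕ × ℕ), m.Sublist l ∧ m.length = k ∧
      bit e (a + (m.map Prod.fst).sum) = true ∧ q = b + (m.map Prod.snd).sum := by
  induction k generalizing l a b with
  | zero =>
    rw [moveSub, testBit_moveBit]
    constructor
    · intro h
      exact ⟨[], List.nil_sublist _, rfl, by simpa using h⟩
    · rintro ⟨m, -, hm, h⟩
      rw [List.length_eq_zero_iff.1 hm] at h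
      simpa using h
  | succ k ih =>
    induction l with
    | nil =>
      refine ⟨fun h => ?_, ?_⟩
      · change Nat.testBit 0 q = true at h
        simp at h
      · rintro ⟨m, hm, hk, -⟩
        rw [List.sublist_nil.1 hm] at hk
        simp at hk
    | cons x t iht =>
      have : moveSub e (k + 1) (x :: t) a b =
          moveSub e k t (a + x.1) (b + x.2) ||| moveSub e (k + 1) t a b := rfl
      rw [this, Nat.testBit_or, Bool.or_eq_true, ih, iht]
      constructor
      · rintro (⟨m, hm, hk, h⟩ | ⟨m, hm, hk, h⟩)
        · exact ⟨x :: m, hm.cons_cons x, by simp [hk], by simpa [add_assoc] using h⟩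
        · exact ⟨m, hm.cons x, hk, h⟩
      · rintro ⟨m, hm, hk, h⟩
        rcases List.sublist_cons_iff.1 hm with hr | ⟨r, rfl, hr⟩
        · exact Or.inr ⟨m, hr, hk, h⟩
        · exact Or.inl ⟨r, hr, by simpa using hk, by simpa [add_assoc] using h⟩

/-- The map of labels encoded by `p`: the octal digit of `p` at position `i` is the bitwise
difference of `i` and its image. -/
def imgLabel (p i : ℕ) : ℕ := Nat.xor i (Nat.land (Nat.shiftRight p (Nat.mul 3 i)) 7)

lemma imgLabel_lt {i : ℕ} (hi : i < 8) (p : ℕ) : imgLabel p i < 8 :=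
  Nat.xor_lt_two_pow (n := 3) hi (Nat.and_lt_two_pow (n := 3) _ (by norm_num))

/-- Octal digits record the bitwise difference of a label and its image, so a fixed label has digit
zero. A bound on the number `p` thus certifies that all labels from `k` on are fixed. -/
lemma imgLabel_eq_self {p k i : ℕ} (hp : p < 8 ^ k) (hi : k ≤ i) : imgLabel p i = i := by
  have h : p >>> (3 * i) = 0 := by
    rw [Nat.shiftRight_eq_div_pow, Nat.div_eq_zero_iff]
    right
    calc p < 8 ^ k := hp
      _ ≤ 8 ^ i := Nat.pow_le_pow_right (by norm_num) hi
      _ = 2 ^ (3 * i) := by rw [pow_mul]; norm_num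
  change i ^^^ (p >>> (3 * i) &&& 7) = i
  simp [h]

/-- The labels and their images under the map encoded by `p`, as powers of two. -/
noncomputable def labelMoves (p : ℕ) : List (ℕ × ℕ) :=
  labels.map fun i => (Nat.pow 2 i, Nat.pow 2 (imgLabel p i))

/-- Test whether the map encoded by `p` is a permutation of the labels. -/
noncomputable def isPerm (p : ℕ) : Bool :=
  Nat.beq (List.rec (motive := fun _ => ℕ) 0 (fun a _ s => Nat.lor a.2 s) (labelMoves p)) 255

lemma exists_of_testBit_lor {l : List (ℕ × ℕ)} {j : ℕ}
    (h : Nat.testBit (List.rec (motive := fun _ => ℕ) 0 (fun a _ s => Nat.lor a.2 s) l) j = true) :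
    ∃ a ∈ l, a.2.testBit j = true := by
  induction l with
  | nil => simp at h
  | cons a l ih =>
    change Nat.testBit (a.2 ||| _) j = true at h
    rw [Nat.testBit_or, Bool.or_eq_true] at h
    rcases h with h | h
    · exact ⟨a, by simp, h⟩
    · obtain ⟨b, hb, hb'⟩ := ih h
      exact ⟨b, by simp [hb], hb'⟩

/-- The bitwise disjunction of the powers `2 ^ imgLabel p i` is 255 only if every label is an image,
and a surjective self-map of a finite set is bijective. -/
lemma exists_perm_of_isPerm {p : ℕ} (h : isPerm p = true) :
    ∃ σ : Equiv.Perm (Fin 8), ∀ i : Fin 8, (σ i : ℕ) = imgLabel p i := by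
  have hs : Function.Surjective fun i : Fin 8 =>
      (⟨imgLabel p i, imgLabel_lt i.isLt p⟩ : Fin 8) := by
    intro j
    have hj : Nat.testBit 255 j = true := by
      have : ∀ j : Fin 8, Nat.testBit 255 j = true := by decide
      exact this j
    rw [← Nat.eq_of_beq_eq_true h] at hj
    obtain ⟨a, ha, ha'⟩ := exists_of_testBit_lor (l := labelMoves p) (j := (j : ℕ)) hj
    rw [labelMoves, labels_eq, List.map_map] at ha
    obtain ⟨i, -, rfl⟩ := List.mem_map.1 ha
    refine ⟨i, Fin.ext ?_⟩
    change Nat.testBit (2 ^ imgLabel p i) j = true at ha'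
    rw [Nat.testBit_two_pow] at ha'
    simpa using ha'
  exact ⟨Equiv.ofBijective _ (Finite.surjective_iff_bijective.1 hs), fun i => rfl⟩

/-- Test whether `p` encodes a permutation that maps the code `e` to the code `c`. -/
noncomputable def carries (p e c : ℕ) : Bool :=
  and (isPerm p) (Nat.beq (Nat.lor (moveSub e 3 (labelMoves p) 0 0)
    (moveSub e 2 (labelMoves p) 256 256)) c)

lemma testBit_moveSub_labelMoves {p e k a b q : ℕ} {σ : Equiv.Perm (Fin 8)}
    (hσ : ∀ i : Fin 8, (σ i : ℕ) = imgLabel p i) :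
    (moveSub e k (labelMoves p) a b).testBit q = true ↔
      ∃ S : Finset (Fin 8), S.card = k ∧ bit e (a + mask S) = true ∧ q = b + mask (σ • S) := by
  have key : ∀ m : List (Fin 8), m.Nodup →
      (((m.map Fin.val).map fun i => (Nat.pow 2 i, Nat.pow 2 (imgLabel p i))).map Prod.fst).sum
        = mask m.toFinset ∧
      (((m.map Fin.val).map fun i => (Nat.pow 2 i, Nat.pow 2 (imgLabel p i))).map Prod.snd).sum
        = mask (σ • m.toFinset) := by
    intro m hm
    rw [mask_smul, mask, List.sum_toFinset _ hm, List.sum_toFinset _ hm]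
    simp only [List.map_map]
    refine ⟨rfl, ?_⟩
    congr 1
    refine List.map_congr_left fun i _ => ?_
    rw [hσ]
    rfl
  rw [testBit_moveSub]
  constructor
  · rintro ⟨m, hm, hk, h₁, h₂⟩
    obtain ⟨m, hl, rfl⟩ := List.sublist_map_iff.1 hm
    obtain ⟨m, rfl, hd⟩ := exists_of_sublist_labels hl
    rw [(key m hd).1] at h₁
    rw [(key m hd).2] at h₂
    exact ⟨m.toFinset, by rw [List.toFinset_card_of_nodup hd]; simpa using hk, h₁, h₂⟩
  · rintro ⟨S, hk, h₁, h₂⟩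
    obtain ⟨m, hm, hd, rfl⟩ := exists_sublist_labels S (fun _ => true) (by simp)
    rw [List.filter_true] at hm
    refine ⟨_, hm.map _, ?_, by rwa [(key m hd).1], by rwa [(key m hd).2]⟩
    rw [List.toFinset_card_of_nodup hd] at hk
    simpa using hk

lemma mem_smul_fst {σ : Equiv.Perm (Fin 8)} {Q : Pair} {S : Finset (Fin 8)} :
    S ∈ (σ • Q).1 ↔ σ⁻¹ • S ∈ Q.1 := by
  rw [Prod.smul_fst, ← Finset.inv_smul_mem_iff]

lemma mem_smul_snd {σ : Equiv.Perm (Fin 8)} {Q : Pair} {S : Finset (Fin 8)} :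
    S ∈ (σ • Q).2 ↔ σ⁻¹ • S ∈ Q.2 := by
  rw [Prod.smul_snd, ← Finset.inv_smul_mem_iff]

lemma smul_compl (σ : Equiv.Perm (Fin 8)) (S : Finset (Fin 8)) : (σ • S)ᶜ = σ • Sᶜ := by
  ext i
  simp only [Finset.mem_compl, ← Finset.inv_smul_mem_iff]

/-- Triples and complements of sextuples are moved separately, with offsets 0 and 256. Since masks
are less than 256 the two ranges of positions do not mix, and since complements commute with
relabelling, moving the complements moves the sextuples. -/
lemma exists_perm_of_carries {p e c : ℕ} (h : carries p e c = true) :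
    ∃ σ : Equiv.Perm (Fin 8), (∀ i : Fin 8, (σ i : ℕ) = imgLabel p i) ∧
      decode c = σ • decode e := by
  rw [carries, Bool.and_eq_true] at h
  obtain ⟨σ, hσ⟩ := exists_perm_of_isPerm h.1
  have hc : moveSub e 3 (labelMoves p) 0 0 ||| moveSub e 2 (labelMoves p) 256 256 = c :=
    Nat.eq_of_beq_eq_true h.2
  refine ⟨σ, hσ, ?_⟩
  have hbit : ∀ q, bit c q = true ↔
      (∃ S : Finset (Fin 8), S.card = 3 ∧ bit e (mask S) = true ∧ q = mask (σ • S)) ∨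
      (∃ S : Finset (Fin 8), S.card = 2 ∧ bit e (256 + mask S) = true ∧
        q = 256 + mask (σ • S)) := by
    intro q
    rw [bit_eq_testBit, ← hc, Nat.testBit_or, Bool.or_eq_true, testBit_moveSub_labelMoves hσ,
      testBit_moveSub_labelMoves hσ]
    simp
  refine Prod.ext (Finset.ext fun S => ?_) (Finset.ext fun S => ?_)
  · rw [mem_smul_fst, mem_decode_fst, mem_decode_fst, hbit, Finset.card_smul_finset]
    refine and_congr_right fun hS => ⟨?_, fun h => Or.inl ⟨σ⁻¹ • S, by simpa using hS, h, by simp⟩⟩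
    rintro (⟨T, -, hT, hST⟩ | ⟨T, -, -, hST⟩)
    · rw [mask_injective hST, inv_smul_smul]; exact hT
    · have := mask_lt S
      omega
  · rw [mem_smul_snd, mem_decode_snd, mem_decode_snd, hbit, Finset.card_smul_finset, smul_compl]
    refine and_congr_right fun hS => ⟨?_, fun h => Or.inr ⟨σ⁻¹ • Sᶜ, ?_, h, by simp⟩⟩
    · rintro (⟨T, -, -, hST⟩ | ⟨T, -, hT, hST⟩)
      · have := mask_lt (σ • T)
        omega
      · rw [mask_injective (Nat.add_left_cancel hST), inv_smul_smul]; exact hT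
    · rw [Finset.card_smul_finset, Finset.card_compl, hS]; simp

/-! ### Counting orbits -/

/-- The points `c i` represent the orbits of `H` on `X`, each orbit once, and the orbit of `c i`
has `o i` elements. -/
structure Census {G α ι : Type*} [Group G] [MulAction G α] (H : Subgroup G) (X : Set α)
    (c : ι → α) (o : ι → ℕ) : Prop where
  orbit_subset : ∀ i, MulAction.orbit H (c i) ⊆ X
  cover : ∀ x ∈ X, ∃ i, x ∈ MulAction.orbit H (c i)
  eq_of_mem : ∀ i j, c j ∈ MulAction.orbit H (c i) → i = j
  ncard_orbit : ∀ i, (MulAction.orbit H (c i)).ncard = o i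

section

variable {G α ι κ : Type*} [Group G] [MulAction G α] [Finite α] [Fintype ι] [Fintype κ]

/-- A stable finite set that is covered by orbits of at most `o i` elements, and that has at least
`∑ i, o i` elements, is the disjoint union of these orbits, each with `o i` elements. -/
theorem Census.of_le {K : Subgroup G} {X : Set α} {c : ι → α} {o : ι → ℕ}
    (hX : ∀ i, MulAction.orbit K (c i) ⊆ X) (hcover : ∀ x ∈ X, ∃ i, x ∈ MulAction.orbit K (c i))
    (hle : ∀ i, (MulAction.orbit K (c i)).ncard ≤ o i) (hsum : ∑ i, o i ≤ X.ncard) :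
    Census K X c o := by
  classical
  -- Covering makes the map from the formal disjoint union of the orbits onto `X`; once the
  -- cardinalities force it to be injective, the orbits are disjoint.
  let f : (Σ i, MulAction.orbit K (c i)) → X := fun z => ⟨z.2, hX z.1 z.2.2⟩
  have hf : Function.Surjective f := fun ⟨x, hx⟩ => by
    obtain ⟨i, hi⟩ := hcover x hx
    exact ⟨⟨i, x, hi⟩, rfl⟩
  have hcard : Nat.card (Σ i, MulAction.orbit K (c i)) =
      ∑ i, (MulAction.orbit K (c i)).ncard := by
    rw [Nat.card_sigma]
    rfl
  have hXs : X.ncard ≤ ∑ i, (MulAction.orbit K (c i)).ncard := by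
    rw [← hcard]
    exact Nat.card_le_card_of_surjective f hf
  -- The circle closes: `∑ o i ≤ |X| ≤ ∑ |orbit i| ≤ ∑ o i`.
  have heq : ∑ i, (MulAction.orbit K (c i)).ncard = ∑ i, o i :=
    le_antisymm (Finset.sum_le_sum fun i _ => hle i) (hsum.trans hXs)
  have hbij : Function.Bijective f := by
    rw [Nat.bijective_iff_surjective_and_card]
    refine ⟨hf, le_antisymm ?_ (Nat.card_le_card_of_surjective f hf)⟩
    rw [hcard, heq]
    exact hsum
  refine ⟨hX, hcover, fun i j hij => ?_, fun i => ?_⟩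
  · exact congrArg Sigma.fst (hbij.1 (a₁ := ⟨i, c j, hij⟩)
      (a₂ := ⟨j, c j, MulAction.mem_orbit_self _⟩) rfl)
  · exact (Finset.sum_eq_sum_iff_of_le fun i _ => hle i).1 heq i (Finset.mem_univ i)

/-- If `H ≤ K`, an equivariant map `π : X → Y` and a census of `Y` under `H` reduce the census of
`X` under `K` to the fibres of `π` over the representatives in `Y`. -/
theorem Census.of_fibers {H K : Subgroup G} (hHK : H ≤ K) {X Y : Set α} {c : ι → α} {o : ι → ℕ}
    (hY : Census H Y c o) {c' : κ → α} {o' : κ → ℕ} {π : α → α}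
    (hπ : ∀ h ∈ H, ∀ x, π (h • x) = h • π x) (hXY : ∀ x ∈ X, π x ∈ Y)
    (hX : ∀ k ∈ K, ∀ x ∈ X, k • x ∈ X) (F : ι → Finset α)
    (hF : ∀ i, ∀ x ∈ X, π x = c i → x ∈ F i)
    (hF' : ∀ i, ∀ x ∈ F i, π x = c i ∧ ∃ j, x ∈ MulAction.orbit K (c' j))
    (hc' : ∀ j, c' j ∈ X) (hle : ∀ j, (MulAction.orbit K (c' j)).ncard ≤ o' j)
    (hsum : ∑ j, o' j ≤ ∑ i, o i * (F i).card) : Census K X c' o' := by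
  classical
  have horb : ∀ j, MulAction.orbit K (c' j) ⊆ X := by
    rintro j _ ⟨k, rfl⟩
    exact hX k k.2 _ (hc' j)
  refine Census.of_le horb (fun x hx => ?_) hle (hsum.trans ?_)
  -- An element of `H` moves `x` into the fibre over a representative; there the orbits of the `c'
  -- j` cover by assumption.
  · obtain ⟨i, ⟨h, hh⟩, hi⟩ := hY.cover _ (hXY x hx)
    change h • c i = π x at hi
    have hx' : h⁻¹ • x ∈ F i := by
      refine hF i _ (hX _ (hHK (inv_mem hh)) x hx) ?_
      rw [hπ _ (inv_mem hh), ← hi, inv_smul_smul]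
    obtain ⟨-, j, ⟨k, hk⟩, hj⟩ := hF' i _ hx'
    refine ⟨j, ⟨h * k, mul_mem (hHK hh) hk⟩, ?_⟩
    change k • c' j = h⁻¹ • x at hj
    change (h * k) • c' j = x
    rw [mul_smul, hj, smul_inv_smul]
  -- For the lower bound on `|X|`, let `g i y` in `H` carry `c i` to `y` and send `(y, e)` to `g i y
  -- • e`. Applying `π` recovers `y`, the census of `Y` then gives `i`, and `e` follows because
  -- group elements act injectively.
  · choose g hg using fun (i : ι) (y : MulAction.orbit H (c i)) => y.2
    let f : (Σ i, MulAction.orbit H (c i) × F i) → X := fun z =>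
      ⟨(g z.1 z.2.1 : G) • (z.2.2 : α), by
        obtain ⟨-, j, hj⟩ := hF' z.1 z.2.2 z.2.2.2
        exact hX _ (hHK (g z.1 z.2.1).2) _ (horb j hj)⟩
    have hfπ : ∀ z, π (f z) = z.2.1 := fun z => by
      change π ((g z.1 z.2.1 : G) • (z.2.2 : α)) = _
      rw [hπ _ (g z.1 z.2.1).2, (hF' z.1 _ z.2.2.2).1]
      exact hg z.1 z.2.1
    have hf : Function.Injective f := by
      rintro ⟨i, y, e⟩ ⟨i', y', e'⟩ h
      have hy : (y : α) = y' := by rw [← hfπ ⟨i, y, e⟩, h, hfπ]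
      obtain rfl : i = i' := by
        refine hY.eq_of_mem _ _ ?_
        have h₁ := MulAction.orbit_eq_iff.2 y.2
        have h₂ := MulAction.orbit_eq_iff.2 y'.2
        rw [← h₁, hy, h₂]
        exact MulAction.mem_orbit_self _
      obtain rfl : y = y' := Subtype.ext hy
      have he : (g i y : G) • (e : α) = (g i y : G) • (e' : α) := congrArg Subtype.val h
      obtain rfl : e = e' := Subtype.ext (MulAction.injective _ he)
      rfl
    have hcard := Nat.card_le_card_of_injective f hf
    rw [Nat.card_sigma] at hcard
    simp only [Nat.card_prod] at hcard
    refine le_trans (le_of_eq (Finset.sum_congr rfl fun i _ => ?_)) hcard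
    rw [← hY.ncard_orbit i, ← Nat.card_coe_set_eq]
    simp

theorem Census.ncard_eq {H : Subgroup G} {X : Set α} {c : ι → α} {o : ι → ℕ}
    (h : Census H X c o) : X.ncard = ∑ i, o i := by
  classical
  have hX : X = ⋃ i, MulAction.orbit H (c i) := by
    ext x
    rw [Set.mem_iUnion]
    exact ⟨h.cover x, fun ⟨i, hi⟩ => h.orbit_subset i hi⟩
  rw [hX, ← finsum_eq_sum_of_fintype, ← finsum_congr h.ncard_orbit]
  refine Set.ncard_iUnion_of_finite (fun i => Set.toFinite _) fun i j hij => ?_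
  rw [Function.onFun, Set.disjoint_left]
  intro x hi hj
  refine hij (h.eq_of_mem i j ?_)
  rw [← MulAction.orbit_eq_iff.2 hi, MulAction.orbit_eq_iff.2 hj]
  exact MulAction.mem_orbit_self _

end

/-! ### Bézout's weak criteria for codes -/

/-- Bézout's weak criteria for the digits of a code. -/
structure Lawful (P : ℕ → Bool) : Prop where
  quad : ∀ A : Finset (Fin 8), A.card = 4 → ∀ a ∈ A, ∀ b ∈ A, ∀ d ∈ A, a ≠ b →
    P (mask (A.erase a)) = true → P (mask (A.erase b)) = true → P (mask (A.erase d)) = true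
  star : ∀ v a b d : Fin 8, a ≠ v → b ≠ v → d ≠ v → a ≠ b →
    P (256 + mask {v, a}) = true → P (256 + mask {v, b}) = true → P (256 + mask {v, d}) = true
  transversal : ∀ E S : Finset (Fin 8), E.card = 2 → S.card = 3 → Disjoint E S →
    P (256 + mask E) = true → P (mask S) = false

/-- `P` is the function of digits of the pair `Q`. -/
structure IsDigits (P : ℕ → Bool) (Q : Pair) : Prop where
  fst : ∀ S : Finset (Fin 8), S.card = 3 → (P (mask S) = true ↔ S ∈ Q.1)
  snd : ∀ E : Finset (Fin 8), E.card = 2 → (P (256 + mask E) = true ↔ Eᶜ ∈ Q.2)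

lemma card_compl_six {J : Finset (Fin 8)} (hJ : J.card = 6) : Jᶜ.card = 2 := by
  rw [Finset.card_compl, hJ]; simp

lemma card_compl_two {E : Finset (Fin 8)} (hE : E.card = 2) : Eᶜ.card = 6 := by
  rw [Finset.card_compl, hE]; simp

lemma isDigits_decode (x : ℕ) : IsDigits (bit x) (decode x) := by
  constructor
  · intro S hS
    simp [mem_decode_fst, hS]
  · intro E hE
    simp [mem_decode_snd, card_compl_two hE]

lemma IsDigits.snd' {P : ℕ → Bool} {Q : Pair} (h : IsDigits P Q) {J : Finset (Fin 8)}
    (hJ : J.card = 6) : P (256 + mask Jᶜ) = true ↔ J ∈ Q.2 := by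
  rw [h.snd _ (card_compl_six hJ), compl_compl]

lemma exists_erase {S A : Finset (Fin 8)} (h : S ⊆ A) (hS : S.card = 3) (hA : A.card = 4) :
    ∃ a ∈ A, S = A.erase a := by
  obtain ⟨a, ha⟩ := Finset.card_eq_one.1 (show (A \ S).card = 1 by
    rw [Finset.card_sdiff_of_subset h]; omega)
  have haA : a ∈ A \ S := ha ▸ Finset.mem_singleton_self a
  refine ⟨a, (Finset.mem_sdiff.1 haA).1, ?_⟩
  rw [← Finset.sdiff_singleton_eq_erase, ← ha, Finset.sdiff_sdiff_eq_self h]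

/-- Two distinct triples that share two labels span a 4-set, and each triple inside it omits one
element. Two distinct sextuples with five common labels have complements that meet in one label `v`,
and the sextuples inside their union are those whose complement contains `v`. A triple lies in a
sextuple exactly if it is disjoint from the complement. -/
theorem bezoutWeak_of_lawful {P : ℕ → Bool} {Q : Pair} (hQ : Q.OfTriplesAndSextuples)
    (hP : IsDigits P Q) (h : Lawful P) : Q.BezoutWeak := by
  constructor
  · intro I hI J hJ
    by_contra hlt
    have hI3 := hQ.1 I hI
    have hJ6 := hQ.2 J hJ
    have hsub : I ∩ J = I :=
      Finset.eq_of_subset_of_card_le Finset.inter_subset_left (by omega)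
    have hd : Disjoint Jᶜ I := by
      rw [Finset.disjoint_left]
      intro i hi hi'
      rw [← hsub] at hi'
      exact (Finset.mem_compl.1 hi) (Finset.mem_inter.1 hi').2
    have := h.transversal _ _ (card_compl_six hJ6) hI3 hd ((hP.snd' hJ6).2 hJ)
    rw [(hP.fst I hI3).2 hI] at this
    exact Bool.noConfusion this
  · intro I₁ h₁ I₂ h₂ hlt I hI hI3
    have c₁ := hQ.1 I₁ h₁
    have c₂ := hQ.1 I₂ h₂
    by_cases heq : I₁ = I₂
    · subst heq
      rw [Finset.union_self] at hI
      rwa [Finset.eq_of_subset_of_card_le hI (by omega)]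
    have hu := Finset.card_union_add_card_inter I₁ I₂
    have hne : (I₁ ∩ I₂).card ≠ 3 := fun h3 => heq <| by
      rw [← Finset.eq_of_subset_of_card_le (Finset.inter_subset_left (s₁ := I₁) (s₂ := I₂))
        (by omega)]
      exact Finset.eq_of_subset_of_card_le Finset.inter_subset_right (by omega)
    have hle := Finset.card_le_card (Finset.inter_subset_left (s₁ := I₁) (s₂ := I₂))
    have hA : (I₁ ∪ I₂).card = 4 := by omega
    obtain ⟨a, ha, ea⟩ := exists_erase Finset.subset_union_left c₁ hA
    obtain ⟨b, hb, eb⟩ := exists_erase Finset.subset_union_right c₂ hA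
    obtain ⟨d, hd, ed⟩ := exists_erase hI hI3 hA
    have hab : a ≠ b := fun hab => heq (ea.trans ((congrArg _ hab).trans eb.symm))
    rw [← hP.fst I hI3, ed]
    exact h.quad _ hA a ha b hb d hd hab (by rw [← ea, hP.fst _ c₁]; exact h₁)
      (by rw [← eb, hP.fst _ c₂]; exact h₂)
  · intro J₁ h₁ J₂ h₂ hlt J hJ hJ6
    have c₁ := hQ.2 J₁ h₁
    have c₂ := hQ.2 J₂ h₂
    by_cases heq : J₁ = J₂
    · subst heq
      rw [Finset.union_self] at hJ
      rwa [Finset.eq_of_subset_of_card_le hJ (by omega)]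
    have hne : J₁ᶜ ≠ J₂ᶜ := fun h => heq (compl_injective h)
    have hu : (J₁ᶜ ∪ J₂ᶜ).card ≤ 3 := by
      rw [← Finset.compl_inter, Finset.card_compl]
      simp only [Fintype.card_fin]
      omega
    have hi := Finset.card_union_add_card_inter J₁ᶜ J₂ᶜ
    rw [card_compl_six c₁, card_compl_six c₂] at hi
    obtain ⟨v, hv⟩ := Finset.card_pos.1 (show 0 < (J₁ᶜ ∩ J₂ᶜ).card by omega)
    rw [Finset.mem_inter] at hv
    have hvJ : v ∈ Jᶜ := by
      rw [Finset.mem_compl]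
      intro hvJ
      have := hJ hvJ
      simp only [Finset.mem_union, Finset.mem_compl] at this hv
      tauto
    have key : ∀ E : Finset (Fin 8), E.card = 2 → v ∈ E → ∃ a, a ≠ v ∧ E = {v, a} := by
      intro E hE hvE
      obtain ⟨a, ha⟩ := Finset.card_eq_one.1 (show (E.erase v).card = 1 by
        rw [Finset.card_erase_of_mem hvE, hE])
      refine ⟨a, Finset.ne_of_mem_erase (ha ▸ Finset.mem_singleton_self a), ?_⟩
      rw [← ha, Finset.insert_erase hvE]
    obtain ⟨a, hav, ea⟩ := key _ (card_compl_six c₁) hv.1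
    obtain ⟨b, hbv, eb⟩ := key _ (card_compl_six c₂) hv.2
    obtain ⟨d, hdv, ed⟩ := key _ (card_compl_six hJ6) hvJ
    rw [← hP.snd' hJ6, ed]
    refine h.star v a b d hav hbv hdv (fun hab => hne (by rw [ea, eb, hab])) ?_ ?_
    · rw [← ea, hP.snd' c₁]; exact h₁
    · rw [← eb, hP.snd' c₂]; exact h₂

theorem lawful_of_bezoutWeak {P : ℕ → Bool} {Q : Pair} (hP : IsDigits P Q) (h : Q.BezoutWeak) :
    Lawful P := by
  constructor
  · intro A hA a ha b hb d hd hab h₁ h₂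
    have hc : ∀ a ∈ A, (A.erase a).card = 3 := fun a ha => by
      rw [Finset.card_erase_of_mem ha, hA]
    rw [hP.fst _ (hc _ ‹_›)] at h₁ h₂ ⊢
    have hu : A.erase a ∪ A.erase b = A := by
      ext i
      simp only [Finset.mem_union, Finset.mem_erase]
      constructor
      · tauto
      · intro hi
        by_cases hia : i = a
        · subst hia; exact Or.inr ⟨hab, hi⟩
        · exact Or.inl ⟨hia, hi⟩
    refine h.line_line _ h₁ _ h₂ ?_ _ ?_ (hc d hd)
    · have := Finset.card_union_add_card_inter (A.erase a) (A.erase b)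
      rw [hu, hA, hc a ha, hc b hb] at this
      omega
    · rw [hu]; exact Finset.erase_subset _ _
  · intro v a b d ha hb hd hab h₁ h₂
    rw [hP.snd _ (Finset.card_pair (Ne.symm ‹_›))] at h₁ h₂ ⊢
    refine h.conic_conic _ h₁ _ h₂ ?_ _ ?_ (card_compl_two (Finset.card_pair hd.symm))
    · rw [← Finset.compl_union, Finset.card_compl]
      have : ({v, a} ∪ {v, b} : Finset (Fin 8)) ⊆ {v, a, b} := by
        intro i; simp only [Finset.mem_union, Finset.mem_insert, Finset.mem_singleton]; tauto
      have := Finset.card_le_card this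
      have := Finset.card_le_three (a := v) (b := a) (c := b)
      simp only [Fintype.card_fin]
      omega
    · intro i
      simp only [Finset.mem_union, Finset.mem_compl, Finset.mem_insert, Finset.mem_singleton]
      intro hi
      by_cases hia : i = a
      · subst hia; tauto
      · tauto
  · intro E S hE hS hd h₁
    by_contra h₂
    rw [Bool.not_eq_false, hP.fst S hS] at h₂
    rw [hP.snd E hE] at h₁
    have := h.line_conic S h₂ _ h₁
    rw [Finset.inter_eq_left.2 (Finset.subset_compl_iff_disjoint_left.2 hd), hS] at this
    omega

/-! ### Checking the criteria -/

/-- Either all or at most one of the digits of `s` at the positions `l` are one. -/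
noncomputable def fits (s : ℕ) (l : List ℕ) : Bool :=
  or (List.rec (motive := fun _ => Bool) true (fun p _ ih => and (bit s p) ih) l)
    (List.rec (motive := fun _ => Bool) true (fun p t ih => cond (bit s p)
      (List.rec (motive := fun _ => Bool) true (fun q _ ih => and (not (bit s q)) ih) t) ih) l)

/-- "All or at most one" means that any two present entries force all the others. Phrased by
`Pairwise`, the rule pulls back along `List.map` from positions to labels without any injectivity of
the position map. -/
lemma fits_iff {s : ℕ} {l : List ℕ} : fits s l = true ↔
    l.Pairwise fun p q => bit s p = true → bit s q = true → ∀ r ∈ l, bit s r = true := by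
  have h₁ : ∀ t : List ℕ,
      (List.rec (motive := fun _ => Bool) true (fun p _ ih => and (bit s p) ih) t = true) ↔
        ∀ r ∈ t, bit s r = true := by
    intro t
    induction t with
    | nil => simp
    | cons p t ih => simp only [Bool.and_eq_true, ih, List.forall_mem_cons]
  have h₂ : ∀ t : List ℕ,
      (List.rec (motive := fun _ => Bool) true (fun q _ ih => and (not (bit s q)) ih) t = true) ↔
        ∀ r ∈ t, bit s r = false := by
    intro t
    induction t with
    | nil => simp
    | cons p t ih => simp only [Bool.and_eq_true, Bool.not_eq_true', ih, List.forall_mem_cons]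
  have h₃ : ∀ t : List ℕ, (List.rec (motive := fun _ => Bool) true (fun p t ih => cond (bit s p)
      (List.rec (motive := fun _ => Bool) true (fun q _ ih => and (not (bit s q)) ih) t) ih) t
        = true) ↔ t.Pairwise fun p q => ¬ (bit s p = true ∧ bit s q = true) := by
    intro t
    induction t with
    | nil => simp
    | cons p t ih =>
      rw [List.pairwise_cons, ← ih]
      simp only
      cases hp : bit s p
      · simp
      · simp only [cond_true, true_and, Bool.not_eq_true]
        rw [h₂, ih]
        refine ⟨fun h => ⟨h, ?_⟩, fun h => h.1⟩
        refine List.pairwise_of_forall_mem_list fun a ha b hb => ?_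
        simp [h a ha]
  rw [fits, Bool.or_eq_true, h₁, h₃]
  constructor
  · rintro (h | h)
    · exact List.pairwise_of_forall fun _ _ _ _ => h
    · exact h.imp fun h hp hq => absurd ⟨hp, hq⟩ h
  · intro h
    by_cases hall : ∀ r ∈ l, bit s r = true
    · exact Or.inl hall
    · refine Or.inr (h.imp ?_)
      rintro p q hpq ⟨hp, hq⟩
      exact hall (hpq hp hq)

lemma fits_map_of {α : Type*} {s : ℕ} {m : List α} (hm : m.Nodup) {f : α → ℕ}
    (h : ∀ a ∈ m, ∀ b ∈ m, ∀ d ∈ m, a ≠ b → bit s (f a) = true → bit s (f b) = true →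
      bit s (f d) = true) : fits s (m.map f) = true := by
  rw [fits_iff, List.pairwise_map]
  refine List.Pairwise.imp_of_mem (fun {a b} ha hb hab h₁ h₂ r hr => ?_) hm
  obtain ⟨d, hd, rfl⟩ := List.mem_map.1 hr
  exact h a ha b hb d hd hab h₁ h₂

lemma of_fits_map {α : Type*} {s : ℕ} {m : List α} {f : α → ℕ} (h : fits s (m.map f) = true)
    {a b d : α} (ha : a ∈ m) (hb : b ∈ m) (hd : d ∈ m) (hab : a ≠ b) (h₁ : bit s (f a) = true)
    (h₂ : bit s (f b) = true) : bit s (f d) = true := by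
  rw [fits_iff, List.pairwise_map] at h
  -- `Pairwise` only compares entries in list order; by symmetry the order of `a` and `b` does not
  -- matter.
  have hsymm : Std.Symm fun a b => bit s (f a) = true → bit s (f b) = true →
      ∀ r ∈ m.map f, bit s r = true := ⟨fun _ _ h h₁ h₂ => h h₂ h₁⟩
  exact h.forall ha hb hab h₁ h₂ _ (List.mem_map_of_mem hd)

/-- The positions of the triples in a set of four labels. -/
noncomputable def quadPositions (m : List ℕ) : List ℕ :=
  m.map fun a => Nat.sub (pows m) (Nat.pow 2 a)

lemma quadPositions_map {m : List (Fin 8)} (hm : m.Nodup) :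
    quadPositions (m.map Fin.val) = m.map fun a => mask (m.toFinset.erase a) := by
  rw [quadPositions, List.map_map]
  refine List.map_congr_left fun a ha => ?_
  rw [mask_erase (List.mem_toFinset.2 ha), ← pows_eq_mask hm]
  rfl

/-- The labels up to `b` other than `v`. -/
noncomputable def othersUpTo (v b : ℕ) : List ℕ :=
  labels.filter fun k => and (Nat.ble k b) (not (Nat.beq k v))

/-- The positions of the pairs that contain `v` and one of the labels in `l`. -/
noncomputable def starPositions (v : ℕ) (l : List ℕ) : List ℕ :=
  l.map fun k => Nat.add 256 (pows [v, k])

/-- The triples disjoint from `{i, j}` are absent from `s`. -/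
noncomputable def noTriple (s i j : ℕ) : Bool :=
  allSub 3 (labels.filter fun k => and (not (Nat.beq k i)) (not (Nat.beq k j)))
    fun m => not (bit s (pows m))

lemma pows_pair {i j : Fin 8} (h : i ≠ j) : pows [(i : ℕ), (j : ℕ)] = mask {i, j} := by
  have := pows_eq_mask (m := [i, j]) (by simpa using h)
  simpa using this

lemma beq_eq_false_iff {i j : ℕ} : Nat.beq i j = false ↔ i ≠ j := by
  rw [← Bool.not_eq_true, Nat.beq_eq]

lemma noTriple_iff {s : ℕ} {i j : Fin 8} : noTriple s i j = true ↔
    ∀ S : Finset (Fin 8), S.card = 3 → Disjoint {i, j} S → bit s (mask S) = false := by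
  rw [noTriple, allSub_iff]
  constructor
  · intro h S hS hd
    obtain ⟨m, hm, hn, rfl⟩ := exists_sublist_labels S
      (fun k => and (not (Nat.beq k i)) (not (Nat.beq k j))) (fun k hk => by
        rw [Finset.disjoint_right] at hd
        have := hd hk
        simp only [Finset.mem_insert, Finset.mem_singleton, not_or, Fin.ext_iff] at this
        simpa [beq_eq_false_iff] using this)
    have := h _ hm (by rw [List.length_map, ← List.toFinset_card_of_nodup hn, hS])
    rwa [pows_eq_mask hn, Bool.not_eq_true'] at this
  · intro h m hm hk
    obtain ⟨m, rfl, hn⟩ := exists_of_sublist_labels (hm.trans List.filter_sublist)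
    rw [pows_eq_mask hn, Bool.not_eq_true']
    refine h _ (by rw [List.toFinset_card_of_nodup hn]; simpa using hk) ?_
    rw [Finset.disjoint_right]
    intro k hk
    have := List.of_mem_filter (hm.subset (List.mem_map_of_mem (List.mem_toFinset.1 hk)))
    simpa [Fin.ext_iff, beq_eq_false_iff] using this

/-- The pairs of labels, ordered by the larger label. -/
def labelPairs : List (ℕ × ℕ) :=
  [(0, 1), (0, 2), (1, 2), (0, 3), (1, 3), (2, 3), (0, 4), (1, 4), (2, 4), (3, 4),
    (0, 5), (1, 5), (2, 5), (3, 5), (4, 5), (0, 6), (1, 6), (2, 6), (3, 6), (4, 6), (5, 6),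
    (0, 7), (1, 7), (2, 7), (3, 7), (4, 7), (5, 7), (6, 7)]

lemma mem_labelPairs {i j : ℕ} : (i, j) ∈ labelPairs ↔ i < j ∧ j < 8 := by
  constructor
  · intro h
    have : ∀ p ∈ labelPairs, p.1 < p.2 ∧ p.2 < 8 := by decide
    exact this _ h
  · rintro ⟨h, hj⟩
    have : ∀ j < 8, ∀ i < j, (i, j) ∈ labelPairs := by decide
    exact this j hj i h

/-- A test for `Lawful (bit s)`. -/
noncomputable def lawfulTest (s : ℕ) : Bool :=
  and (allSub 4 labels fun m => fits s (quadPositions m))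
    (and (labels.all fun v => fits s (starPositions v (othersUpTo v 7)))
      (labelPairs.all fun p => or (not (bit s (Nat.add 256 (pows [p.1, p.2]))))
        (noTriple s p.1 p.2)))

lemma mem_labels {i : ℕ} : i ∈ labels ↔ i < 8 := by
  rw [labels_eq, List.mem_map]
  exact ⟨fun ⟨a, _, h⟩ => h ▸ a.isLt, fun h => ⟨⟨i, h⟩, List.mem_finRange _, rfl⟩⟩

lemma mem_othersUpTo {v b k : ℕ} : k ∈ othersUpTo v b ↔ k < 8 ∧ k ≤ b ∧ k ≠ v := by
  simp [othersUpTo, mem_labels, beq_eq_false_iff]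

/-- This full test is applied to representatives only. The extensions found by the search inherit
the criteria from the representatives to which their certificates carry them. -/
theorem lawful_of_lawfulTest {s : ℕ} (h : lawfulTest s = true) : Lawful (bit s) := by
  rw [lawfulTest, Bool.and_eq_true, Bool.and_eq_true, List.all_eq_true, List.all_eq_true,
    allSub_iff] at h
  obtain ⟨h₁, h₂, h₃⟩ := h
  constructor
  · intro A hA a ha b hb d hd hab
    obtain ⟨m, hm, hn, rfl⟩ := exists_sublist_labels A (fun _ => true) (by simp)
    rw [List.filter_true] at hm
    have := h₁ _ hm (by rw [List.length_map, ← List.toFinset_card_of_nodup hn, hA])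
    rw [quadPositions_map hn] at this
    exact of_fits_map this (List.mem_toFinset.1 ha) (List.mem_toFinset.1 hb)
      (List.mem_toFinset.1 hd) hab
  · intro v a b d ha hb hd hab
    have hmem : ∀ k : Fin 8, k ≠ v → (k : ℕ) ∈ othersUpTo v 7 := fun k hk =>
      mem_othersUpTo.2 ⟨k.isLt, by omega, fun h => hk (Fin.ext h)⟩
    have := of_fits_map (h₂ v (mem_labels.2 v.isLt)) (hmem a ha) (hmem b hb) (hmem d hd)
      (fun h => hab (Fin.ext h))
    rwa [pows_pair ha.symm, pows_pair hb.symm, pows_pair hd.symm] at this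
  · intro E S hE hS hd hE'
    obtain ⟨i, j, hij, rfl⟩ := Finset.card_eq_two.1 hE
    wlog hlt : i < j generalizing i j with H
    · have hc : ({i, j} : Finset (Fin 8)) = {j, i} := Finset.pair_comm i j
      exact H j i hij.symm (hc ▸ hE) (hc ▸ hd) (hc ▸ hE')
        (lt_of_le_of_ne (not_lt.1 hlt) hij.symm)
    have := h₃ (i, j) (mem_labelPairs.2 ⟨hlt, j.isLt⟩)
    rw [Bool.or_eq_true] at this
    rcases this with this | this
    · rw [Bool.not_eq_true'] at this
      change bit s (256 + pows [(i : ℕ), (j : ℕ)]) = false at this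
      rw [pows_pair hij, hE'] at this
      exact Bool.noConfusion this
    · exact noTriple_iff.1 this S hS hd

/-! ### Enumerating the codes that extend a given code -/

/-- `p` is the position of a triple or of the complement of a sextuple. -/
def IsPosition (p : ℕ) : Prop :=
  (∃ S : Finset (Fin 8), S.card = 3 ∧ p = mask S) ∨
    (∃ E : Finset (Fin 8), E.card = 2 ∧ p = 256 + mask E)

/-- A position and a test for partial codes whose digits up to this position have been chosen. -/
abbrev Item := ℕ × (ℕ → Bool)

/-- The test is passed by the partial codes of lawful digits. -/
def Item.Sound (b : Item) : Prop :=
  ∀ P : ℕ → Bool, Lawful P → ∀ s, (∀ p, IsPosition p → p ≤ b.1 → bit s p = P p) → b.2 s = true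

/-- All ways of choosing digits of `s` at the given positions that pass the tests. -/
noncomputable def extensions (l : List Item) : ℕ → List ℕ :=
  List.rec (motive := fun _ => ℕ → List ℕ) (fun s => [s])
    (fun b _ ih s => List.append (cond (b.2 s) (ih s) [])
      (cond (b.2 (Nat.lor s (Nat.pow 2 b.1))) (ih (Nat.lor s (Nat.pow 2 b.1))) [])) l

lemma extensions_cons (b : Item) (l : List Item) (s : ℕ) :
    extensions (b :: l) s = (cond (b.2 s) (extensions l s) []) ++
      (cond (b.2 (s ||| 2 ^ b.1)) (extensions l (s ||| 2 ^ b.1)) []) := rfl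

lemma bit_or_two_pow (s b p : ℕ) : bit (s ||| 2 ^ b) p = (bit s p || decide (b = p)) := by
  rw [bit_eq_testBit, bit_eq_testBit, Nat.testBit_or, Nat.testBit_two_pow]

lemma bit_eq_of_mem_extensions {l : List Item} {s e p : ℕ} (he : e ∈ extensions l s)
    (hp : p ∉ l.map Prod.fst) : bit e p = bit s p := by
  induction l generalizing s with
  | nil => rw [List.mem_singleton.1 he]
  | cons b l ih =>
    rw [List.map_cons, List.mem_cons, not_or] at hp
    rw [extensions_cons, List.mem_append] at he
    rcases he with he | he
    · cases hb : b.2 s <;> rw [hb] at he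
      · simp at he
      · exact ih he hp.2
    · cases hb : b.2 (s ||| 2 ^ b.1) <;> rw [hb] at he
      · simp at he
      · rw [ih he hp.2, bit_or_two_pow]
        simp [Ne.symm hp.1]

/-- Two results separate at the first item where their digits were chosen differently, and later
items never touch that position again. The position is required to satisfy `IsPosition` because
`decode` ignores all other digits; so different results decode to different pairs. -/
lemma pairwise_extensions {l : List Item} {s : ℕ} (hl : l.Pairwise fun b b' => b.1 < b'.1)
    (hpos : ∀ b ∈ l, IsPosition b.1) (hs : ∀ b ∈ l, bit s b.1 = false) :
    (extensions l s).Pairwise fun e e' => ∃ p, IsPosition p ∧ bit e p ≠ bit e' p := by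
  induction l generalizing s with
  | nil => exact List.pairwise_singleton _ _
  | cons b l ih =>
    rw [List.pairwise_cons] at hl
    rw [List.forall_mem_cons] at hpos hs
    have hb : b.1 ∉ l.map Prod.fst := by
      intro h
      obtain ⟨b', hb', h⟩ := List.mem_map.1 h
      exact (hl.1 b' hb').ne' h
    rw [extensions_cons, List.pairwise_append]
    refine ⟨?_, ?_, fun e he e' he' => ⟨b.1, hpos.1, ?_⟩⟩
    · cases b.2 s
      · exact List.Pairwise.nil
      · exact ih hl.2 hpos.2 hs.2
    · cases b.2 (s ||| 2 ^ b.1)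
      · exact List.Pairwise.nil
      · refine ih hl.2 hpos.2 fun b' hb' => ?_
        rw [bit_or_two_pow, hs.2 b' hb']
        simp [(hl.1 b' hb').ne]
    · cases h : b.2 s <;> rw [h] at he
      · simp at he
      cases h' : b.2 (s ||| 2 ^ b.1) <;> rw [h'] at he'
      · simp at he'
      rw [bit_eq_of_mem_extensions he hb, bit_eq_of_mem_extensions he' hb, bit_or_two_pow, hs.1]
      simp

/-- The branch that copies the digits of `P` survives: when the test of an item is applied, the
partial code agrees with `P` up to the position of that item, and a sound test reads no more than
this. The tests need not be complete, since superfluous results would have to be certified anyway.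
-/
lemma exists_mem_extensions {P : ℕ → Bool} (hP : Lawful P) {l : List Item} {s : ℕ}
    (hl : l.Pairwise fun b b' => b.1 < b'.1) (hsound : ∀ b ∈ l, b.Sound)
    (hs : ∀ b ∈ l, bit s b.1 = false)
    (hagree : ∀ p, IsPosition p → p ∉ l.map Prod.fst → bit s p = P p) :
    ∃ e ∈ extensions l s, ∀ p, IsPosition p → bit e p = P p := by
  induction l generalizing s with
  | nil => exact ⟨s, List.mem_singleton.2 rfl, fun p hp => hagree p hp (by simp)⟩
  | cons b l ih =>
    rw [List.pairwise_cons] at hl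
    rw [List.forall_mem_cons] at hsound hs
    have key : ∀ s', bit s' b.1 = P b.1 → (∀ p, p ≠ b.1 → bit s' p = bit s p) →
        b.2 s' = true ∧ ∃ e ∈ extensions l s', ∀ p, IsPosition p → bit e p = P p := by
      intro s' h₁ h₂
      have h₃ : ∀ p, IsPosition p → p ∉ l.map Prod.fst → bit s' p = P p := by
        intro p hp hpl
        by_cases hpb : p = b.1
        · rw [hpb, h₁]
        · rw [h₂ p hpb]
          exact hagree p hp (by simpa [hpb] using hpl)
      constructor
      · refine hsound.1 P hP s' fun p hp hpb => h₃ p hp fun hpl => ?_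
        obtain ⟨b', hb', h⟩ := List.mem_map.1 hpl
        have := hl.1 b' hb'
        omega
      · refine ih hl.2 hsound.2 (fun b' hb' => ?_) h₃
        rw [h₂ _ (hl.1 b' hb').ne', hs.2 b' hb']
    rw [extensions_cons]
    cases hb : P b.1
    · obtain ⟨h₁, e, he, h⟩ := key s (by rw [hs.1, hb]) fun _ _ => rfl
      rw [h₁]
      exact ⟨e, List.mem_append_left _ he, h⟩
    · obtain ⟨h₁, e, he, h⟩ := key (s ||| 2 ^ b.1) (by rw [bit_or_two_pow, hb]; simp)
        fun p hp => by rw [bit_or_two_pow]; simp [hp.symm]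
      rw [h₁]
      exact ⟨e, List.mem_append_right _ he, h⟩

/-! ### Restriction to the first labels, and the digits of a pair -/

lemma mask_lt_two_pow_iff {S : Finset (Fin 8)} {n : ℕ} :
    mask S < 2 ^ n ↔ ∀ i ∈ S, (i : ℕ) < n := by
  refine ⟨fun h i hi => ?_, mask_lt_two_pow⟩
  exact (Nat.pow_lt_pow_iff_right (by norm_num)).1 ((two_pow_le_mask hi).trans_lt h)

/-- The triples of `Q` among the first `n` labels. -/
def restrict (n : ℕ) (Q : Pair) : Pair := (Q.1.filter fun S => ∀ i ∈ S, (i : ℕ) < n, ∅)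

lemma bit_eq_false {s n p : ℕ} (hs : s < 2 ^ n) (hp : n ≤ p) : bit s p = false := by
  rw [bit_eq_testBit]
  exact Nat.testBit_lt_two_pow (hs.trans_le (Nat.pow_le_pow_right (by norm_num) hp))

open Classical in
/-- The digits of a pair. -/
noncomputable def digits (Q : Pair) (p : ℕ) : Bool :=
  decide ((∃ S ∈ Q.1, mask S = p) ∨ ∃ S ∈ Q.2, 256 + mask Sᶜ = p)

lemma digits_mask {Q : Pair} {S : Finset (Fin 8)} : digits Q (mask S) = true ↔ S ∈ Q.1 := by
  rw [digits, decide_eq_true_iff]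
  constructor
  · rintro (⟨T, hT, h⟩ | ⟨T, -, h⟩)
    · rwa [← mask_injective h]
    · have := mask_lt S
      omega
  · exact fun h => Or.inl ⟨S, h, rfl⟩

lemma digits_add_mask {Q : Pair} {E : Finset (Fin 8)} :
    digits Q (256 + mask E) = true ↔ Eᶜ ∈ Q.2 := by
  rw [digits, decide_eq_true_iff]
  constructor
  · rintro (⟨T, -, h⟩ | ⟨T, hT, h⟩)
    · have := mask_lt T
      omega
    · rwa [← mask_injective (Nat.add_left_cancel h), compl_compl]
  · exact fun h => Or.inr ⟨_, h, by rw [compl_compl]⟩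

lemma isDigits_digits (Q : Pair) : IsDigits (digits Q) Q :=
  ⟨fun _ _ => digits_mask, fun _ _ => digits_add_mask⟩

lemma decode_eq_of_digits {Q : Pair} (hQ : Q.OfTriplesAndSextuples) {e : ℕ}
    (h : ∀ p, IsPosition p → bit e p = digits Q p) : decode e = Q := by
  refine Prod.ext (Finset.ext fun S => ?_) (Finset.ext fun S => ?_)
  · rw [mem_decode_fst]
    constructor
    · rintro ⟨h₁, h₂⟩
      rwa [h _ (Or.inl ⟨S, h₁, rfl⟩), digits_mask] at h₂
    · intro hS
      refine ⟨hQ.1 S hS, ?_⟩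
      rwa [h _ (Or.inl ⟨S, hQ.1 S hS, rfl⟩), digits_mask]
  · rw [mem_decode_snd]
    constructor
    · rintro ⟨h₁, h₂⟩
      rwa [h _ (Or.inr ⟨_, card_compl_six h₁, rfl⟩), digits_add_mask, compl_compl] at h₂
    · intro hS
      refine ⟨hQ.2 S hS, ?_⟩
      rwa [h _ (Or.inr ⟨_, card_compl_six (hQ.2 S hS), rfl⟩), digits_add_mask, compl_compl]

/-- The items of `l` are in order, beyond the triples among the first `n` labels, and sound. -/
structure Scheme (n : ℕ) (l : List Item) : Prop where
  le_eight : n ≤ 8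
  pairwise : l.Pairwise fun b b' => b.1 < b'.1
  isPosition : ∀ b ∈ l, IsPosition b.1
  sound : ∀ b ∈ l, b.Sound
  le : ∀ b ∈ l, 2 ^ n ≤ b.1

/-- The triples among the first `n` labels occupy positions below `2 ^ n`, which the search leaves
alone, and `r < 2 ^ 2 ^ n` says that `r` has no digits elsewhere. In particular `r` has no
sextuples, as those start at position `256 ≥ 2 ^ n`. -/
lemma Scheme.restrict_decode {n : ℕ} {l : List Item} (hl : Scheme n l) {r e : ℕ}
    (hr : r < 2 ^ 2 ^ n) (he : e ∈ extensions l r) : restrict n (decode e) = decode r := by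
  have hbit : ∀ p < 2 ^ n, bit e p = bit r p := fun p hp => by
    refine bit_eq_of_mem_extensions he fun h => ?_
    obtain ⟨b, hb, rfl⟩ := List.mem_map.1 h
    exact absurd (hl.le b hb) (not_le.2 hp)
  have h256 : 2 ^ n ≤ 256 := Nat.pow_le_pow_right (n := 2) (by norm_num) hl.le_eight
  refine Prod.ext (Finset.ext fun S => ?_) ?_
  · rw [restrict, Finset.mem_filter, mem_decode_fst, mem_decode_fst, ← mask_lt_two_pow_iff]
    constructor
    · rintro ⟨⟨h₁, h₂⟩, h₃⟩
      exact ⟨h₁, by rwa [← hbit _ h₃]⟩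
    · rintro ⟨h₁, h₂⟩
      have h₃ : mask S < 2 ^ n := by
        by_contra h
        rw [bit_eq_false hr (not_lt.1 h)] at h₂
        exact Bool.noConfusion h₂
      exact ⟨⟨h₁, by rwa [hbit _ h₃]⟩, h₃⟩
  · refine (Finset.eq_empty_of_forall_notMem fun S hS => ?_).symm
    rw [mem_decode_snd, bit_eq_false hr (h256.trans (Nat.le_add_right _ _))] at hS
    exact Bool.noConfusion hS.2

lemma Scheme.nodup_map_decode {n : ℕ} {l : List Item} (hl : Scheme n l) {r : ℕ}
    (hr : r < 2 ^ 2 ^ n) : ((extensions l r).map decode).Nodup := by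
  rw [List.Nodup, List.pairwise_map]
  refine (pairwise_extensions hl.pairwise hl.isPosition
    fun b hb => bit_eq_false hr (hl.le b hb)).imp ?_
  rintro e e' ⟨p, ⟨S, hS, rfl⟩ | ⟨E, hE, rfl⟩, h⟩ heq <;> refine h (Bool.eq_iff_iff.2 ?_)
  · rw [(isDigits_decode e).fst S hS, (isDigits_decode e').fst S hS, heq]
  · rw [(isDigits_decode e).snd E hE, (isDigits_decode e').snd E hE, heq]

/-- Completeness of the search over `r`. Below `2 ^ n` the digits of `Q` are those of `r`; from `2 ^
n` on, `hQl` leaves only the positions of the items free, and these are all tried. -/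
lemma Scheme.exists_decode_eq {n : ℕ} {l : List Item} (hl : Scheme n l) {r : ℕ}
    (hr : r < 2 ^ 2 ^ n) {Q : Pair} (hQ : Q.OfTriplesAndSextuples) (hB : Q.BezoutWeak)
    (hQr : restrict n Q = decode r)
    (hQl : ∀ p, IsPosition p → 2 ^ n ≤ p → p ∉ l.map Prod.fst → digits Q p = false) :
    ∃ e ∈ extensions l r, decode e = Q := by
  obtain ⟨e, he, h⟩ := exists_mem_extensions (lawful_of_bezoutWeak (isDigits_digits Q) hB)
    hl.pairwise hl.sound (fun b hb => bit_eq_false hr (hl.le b hb)) (s := r) fun p hp hpl => by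
      by_cases hpn : 2 ^ n ≤ p
      · rw [bit_eq_false hr hpn, hQl p hp hpn hpl]
      · rcases hp with ⟨S, hS, rfl⟩ | ⟨E, hE, rfl⟩
        · rw [Bool.eq_iff_iff, digits_mask, (isDigits_decode r).fst S hS, ← hQr, restrict,
            Finset.mem_filter, ← mask_lt_two_pow_iff]
          simp [not_le.1 hpn]
        · have : 2 ^ n ≤ 256 := Nat.pow_le_pow_right (n := 2) (by norm_num) hl.le_eight
          omega
  exact ⟨e, he, decode_eq_of_digits hQ h⟩

/-! ### Items for triples and for sextuples -/

/-- Test a predicate on all numbers below `k`. -/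
noncomputable def allBelow (f : ℕ → Bool) (k : ℕ) : Bool :=
  Nat.rec true (fun k ih => and (f k) ih) k

lemma allBelow_iff {f : ℕ → Bool} {k : ℕ} : allBelow f k = true ↔ ∀ i < k, f i = true := by
  induction k with
  | zero => simp [allBelow]
  | succ k ih =>
    have : allBelow f (k + 1) = (f k && allBelow f k) := rfl
    rw [this, Bool.and_eq_true, ih, Nat.forall_lt_succ_right, and_comm]

/-- The item of the triple `{i, j, k}`, to be used if `i < j < k`. -/
noncomputable def tripleItem (i j k : ℕ) : Item :=
  (pows [i, j, k], fun s => allBelow (fun l => fits s (quadPositions [l, i, j, k])) i)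

/-- The item of the complement of the pair `{i, j}`, to be used if `i < j`. -/
noncomputable def pairItem (i j : ℕ) : Item :=
  (Nat.add 256 (pows [i, j]), fun s => and (fits s (starPositions j (othersUpTo j i)))
    (and (fits s (starPositions i (othersUpTo i j)))
      (or (not (bit s (Nat.add 256 (pows [i, j])))) (noTriple s i j))))

lemma pows_triple {i j k : Fin 8} (hij : i ≠ j) (hik : i ≠ k) (hjk : j ≠ k) :
    pows [(i : ℕ), (j : ℕ), (k : ℕ)] = mask {i, j, k} := by
  have := pows_eq_mask (m := [i, j, k]) (by simp [hij, hik, hjk])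
  simpa using this

/-- Of the four triples in `{l, i, j, k}` with `l < i < j < k`, the one omitting the smallest label
has the largest mask. So when `{i, j, k}` is decided, the three other triples have been decided
already, and each 4-set is examined at its last triple. -/
lemma tripleItem_sound {i j k : Fin 8} (hij : i < j) (hjk : j < k) :
    (tripleItem i j k).Sound := by
  intro P hP s hs
  refine allBelow_iff.2 fun l hl => ?_
  obtain ⟨l, rfl⟩ : ∃ l' : Fin 8, (l' : ℕ) = l := ⟨⟨l, hl.trans i.isLt⟩, rfl⟩
  replace hl : l < i := hl
  have hn : [l, i, j, k].Nodup := by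
    simp only [List.nodup_cons, List.mem_cons, List.not_mem_nil, or_false, not_or,
      not_false_eq_true, List.nodup_nil, and_true]
    omega
  have hc : [l, i, j, k].toFinset.card = 4 := List.toFinset_card_of_nodup hn
  have hle : ∀ a ∈ [l, i, j, k], mask ([l, i, j, k].toFinset.erase a) ≤ pows [(i : ℕ), j, k] := by
    intro a ha
    have h₁ : 2 ^ (l : ℕ) ≤ 2 ^ (a : ℕ) := by
      refine Nat.pow_le_pow_right (by norm_num) ?_
      simp only [List.mem_cons, List.not_mem_nil, or_false] at ha
      omega
    have h₂ : pows [(l : ℕ), i, j, k] = 2 ^ (l : ℕ) + pows [(i : ℕ), j, k] := rfl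
    have h₃ : pows [(l : ℕ), i, j, k] = mask [l, i, j, k].toFinset := pows_eq_mask hn
    rw [mask_erase (List.mem_toFinset.2 ha)]
    omega
  have hbit : ∀ a ∈ [l, i, j, k], bit s (mask ([l, i, j, k].toFinset.erase a)) =
      P (mask ([l, i, j, k].toFinset.erase a)) := fun a ha =>
    hs _ (Or.inl ⟨_, by rw [Finset.card_erase_of_mem (List.mem_toFinset.2 ha), hc], rfl⟩)
      (hle a ha)
  have := quadPositions_map hn
  simp only [List.map_cons, List.map_nil] at this
  rw [this]
  refine fits_map_of (m := [l, i, j, k]) (f := fun a => mask ([l, i, j, k].toFinset.erase a)) hn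
    fun a ha b hb d hd hab h₁ h₂ => ?_
  rw [hbit _ ‹_›] at h₁ h₂ ⊢
  exact hP.quad _ hc a (List.mem_toFinset.2 ha) b (List.mem_toFinset.2 hb) d
    (List.mem_toFinset.2 hd) hab h₁ h₂

/-- The rule for the edges at a vertex passes to any part of the star, so it can be tested on the
edges decided so far. -/
lemma fits_starPositions {P : ℕ → Bool} (hP : Lawful P) {s b q : ℕ} {v : Fin 8}
    (hs : ∀ p, IsPosition p → p ≤ q → bit s p = P p)
    (hq : ∀ k : Fin 8, k ≠ v → (k : ℕ) ≤ b → 256 + mask {v, k} ≤ q) :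
    fits s (starPositions v (othersUpTo v b)) = true := by
  have hl : (othersUpTo v b).Nodup := List.Nodup.filter _ (by decide)
  have hbit : ∀ a : Fin 8, a ≠ v → (a : ℕ) ≤ b →
      bit s (256 + mask {v, a}) = P (256 + mask {v, a}) := fun a ha hab =>
    hs _ (Or.inr ⟨_, Finset.card_pair ha.symm, rfl⟩) (hq a ha hab)
  refine fits_map_of hl fun a ha b hb d hd hab h₁ h₂ => ?_
  rw [mem_othersUpTo] at ha hb hd
  lift a to Fin 8 using ha.1
  lift b to Fin 8 using hb.1
  lift d to Fin 8 using hd.1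
  have ha' : a ≠ v := fun h => ha.2.2 (congrArg _ h)
  have hb' : b ≠ v := fun h => hb.2.2 (congrArg _ h)
  have hd' : d ≠ v := fun h => hd.2.2 (congrArg _ h)
  rw [pows_pair ha'.symm] at h₁
  rw [pows_pair hb'.symm] at h₂
  rw [pows_pair hd'.symm]
  change bit s (256 + _) = true at h₁ h₂ ⊢
  rw [hbit _ ‹_› (by tauto)] at h₁ h₂ ⊢
  exact hP.star v a b d ha' hb' hd' (fun h => hab (congrArg _ h)) h₁ h₂

lemma mask_pair {i j : Fin 8} (h : i ≠ j) : mask {i, j} = 2 ^ (i : ℕ) + 2 ^ (j : ℕ) :=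
  Finset.sum_pair h

/-- Edges are ordered by `2 ^ i + 2 ^ j`. Hence at `{i, j}` the edges `{j, k}` with `k ≤ i` and `{i,
k}` with `k ≤ j` are decided, and so are all triples, whose positions lie below 256. -/
lemma pairItem_sound {i j : Fin 8} (hij : i < j) : (pairItem i j).Sound := by
  intro P hP s hs
  have hpos : (pairItem i j).1 = 256 + (2 ^ (i : ℕ) + 2 ^ (j : ℕ)) := by
    change 256 + pows _ = _
    rw [pows_pair hij.ne, mask_pair hij.ne]
  have hbit : bit s (256 + mask {i, j}) = P (256 + mask {i, j}) :=
    hs _ (Or.inr ⟨_, Finset.card_pair hij.ne, rfl⟩) (by rw [hpos, mask_pair hij.ne])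
  change and _ (and _ (or _ _)) = true
  rw [Bool.and_eq_true, Bool.and_eq_true, Bool.or_eq_true]
  refine ⟨fits_starPositions hP hs fun k hk hki => ?_, fits_starPositions hP hs
    fun k hk hkj => ?_, ?_⟩
  · rw [hpos, mask_pair hk.symm]
    have := Nat.pow_le_pow_right (n := 2) (by norm_num) hki
    omega
  · rw [hpos, mask_pair hk.symm]
    have := Nat.pow_le_pow_right (n := 2) (by norm_num) hkj
    omega
  · change (!bit s (256 + pows [(i : ℕ), j])) = true ∨ _
    rw [pows_pair hij.ne, hbit]
    cases h : P (256 + mask {i, j})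
    · simp
    · refine Or.inr (noTriple_iff.2 fun S hS hd => ?_)
      have hlt : mask S ≤ (pairItem i j).1 :=
        (mask_lt S).le.trans (hpos ▸ Nat.le_add_right _ _)
      rw [hs _ (Or.inl ⟨S, hS, rfl⟩) hlt]
      exact hP.transversal _ _ (Finset.card_pair hij.ne) hS hd h

/-- The items of the triples with largest element `k`. -/
noncomputable def triplesBelow (k : ℕ) : List Item :=
  (labelPairs.filter fun p => Nat.ble (Nat.succ p.2) k).map fun p => tripleItem p.1 p.2 k

/-- The items of the sextuples. -/
noncomputable def pairItems : List Item := labelPairs.map fun p => pairItem p.1 p.2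

lemma mem_triplesBelow {k : ℕ} {b : Item} (hk : k < 8) (h : b ∈ triplesBelow k) :
    ∃ i j : Fin 8, i < j ∧ j < ⟨k, hk⟩ ∧ b = tripleItem i j k := by
  obtain ⟨⟨i, j⟩, hp, rfl⟩ := List.mem_map.1 h
  obtain ⟨hp, hjk⟩ := List.mem_filter.1 hp
  obtain ⟨hij, hj⟩ := mem_labelPairs.1 hp
  exact ⟨⟨i, hij.trans hj⟩, ⟨j, hj⟩, hij, Nat.le_of_ble_eq_true hjk, rfl⟩

/-- The numerical order of positions sorts triples by their largest label. This is why adding a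
label amounts to appending one block of items. -/
lemma tripleItem_bounds {i j k : Fin 8} (hij : i < j) (hjk : j < k) :
    2 ^ (k : ℕ) ≤ (tripleItem i j k).1 ∧ (tripleItem i j k).1 < 2 ^ ((k : ℕ) + 1) ∧
      IsPosition (tripleItem i j k).1 := by
  have h : (tripleItem i j k).1 = mask {i, j, k} :=
    pows_triple hij.ne (hij.trans hjk).ne hjk.ne
  rw [h]
  refine ⟨two_pow_le_mask (by simp), mask_lt_two_pow ?_, Or.inl ⟨_, ?_, rfl⟩⟩
  · intro a ha
    simp only [Finset.mem_insert, Finset.mem_singleton] at ha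
    omega
  · exact Finset.card_eq_three.2 ⟨i, j, k, hij.ne, (hij.trans hjk).ne, hjk.ne, rfl⟩

lemma pairwise_triplesBelow (k : ℕ) :
    (triplesBelow k).Pairwise fun b b' => b.1 < b'.1 := by
  have h : ∀ p ∈ labelPairs, ∀ q ∈ labelPairs, 2 ^ p.1 + 2 ^ p.2 < 2 ^ q.1 + 2 ^ q.2 →
      (tripleItem p.1 p.2 k).1 < (tripleItem q.1 q.2 k).1 := by
    intro p _ q _ h
    change 2 ^ p.1 + (2 ^ p.2 + (2 ^ k + 0)) < 2 ^ q.1 + (2 ^ q.2 + (2 ^ k + 0))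
    omega
  rw [triplesBelow, List.pairwise_map]
  have hs : labelPairs.Pairwise fun p q => 2 ^ p.1 + 2 ^ p.2 < 2 ^ q.1 + 2 ^ q.2 := by decide
  refine List.Pairwise.imp_of_mem (fun {p q} hp hq hpq => ?_) (hs.filter _)
  exact h p (List.mem_of_mem_filter hp) q (List.mem_of_mem_filter hq) hpq

/-- The items of the triples whose largest element is in the interval from `n` to `n + d`. -/
noncomputable def tripleItems (n d : ℕ) : List Item :=
  Nat.rec [] (fun d ih => List.append ih (triplesBelow (Nat.add n d))) d

lemma mem_tripleItems {n d : ℕ} {b : Item} :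
    b ∈ tripleItems n d ↔ ∃ k, n ≤ k ∧ k < n + d ∧ b ∈ triplesBelow k := by
  induction d with
  | zero => simp [tripleItems]; omega
  | succ d ih =>
    have : tripleItems n (d + 1) = tripleItems n d ++ triplesBelow (n + d) := rfl
    rw [this, List.mem_append, ih]
    constructor
    · rintro (⟨k, h₁, h₂, h⟩ | h)
      · exact ⟨k, h₁, by omega, h⟩
      · exact ⟨n + d, by omega, by omega, h⟩
    · rintro ⟨k, h₁, h₂, h⟩
      rcases (show k < n + d ∨ k = n + d by omega) with hk | rfl
      · exact Or.inl ⟨k, h₁, hk, h⟩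
      · exact Or.inr h

lemma scheme_tripleItems {n d : ℕ} (h : n + d ≤ 8) : Scheme n (tripleItems n d) := by
  have hmem : ∀ b ∈ tripleItems n d, ∃ i j k : Fin 8, i < j ∧ j < k ∧ n ≤ k ∧
      b = tripleItem i j k := by
    intro b hb
    obtain ⟨k, hk, hkd, hb⟩ := mem_tripleItems.1 hb
    have hk' : k < 8 := by omega
    obtain ⟨i, j, hij, hjk, rfl⟩ := mem_triplesBelow hk' hb
    exact ⟨i, j, ⟨k, hk'⟩, hij, hjk, hk, rfl⟩
  refine ⟨by omega, ?_, fun b hb => ?_, fun b hb => ?_, fun b hb => ?_⟩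
  · clear hmem
    induction d with
    | zero => exact List.Pairwise.nil
    | succ d ih =>
      have : tripleItems n (d + 1) = tripleItems n d ++ triplesBelow (n + d) := rfl
      rw [this, List.pairwise_append]
      refine ⟨ih (by omega), pairwise_triplesBelow _, fun b hb b' hb' => ?_⟩
      obtain ⟨k, hk, hkd, hb⟩ := mem_tripleItems.1 hb
      obtain ⟨i, j, hij, hjk, rfl⟩ := mem_triplesBelow (by omega) hb
      obtain ⟨i', j', hij', hjk', rfl⟩ := mem_triplesBelow (by omega) hb'
      have h₁ := (tripleItem_bounds hij hjk).2.1
      have h₂ := (tripleItem_bounds hij' hjk').1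
      refine h₁.trans_le (le_trans ?_ h₂)
      exact Nat.pow_le_pow_right (by norm_num) hkd
  · obtain ⟨i, j, k, hij, hjk, -, rfl⟩ := hmem b hb
    exact (tripleItem_bounds hij hjk).2.2
  · obtain ⟨i, j, k, hij, hjk, -, rfl⟩ := hmem b hb
    exact tripleItem_sound hij hjk
  · obtain ⟨i, j, k, hij, hjk, hk, rfl⟩ := hmem b hb
    exact le_trans (Nat.pow_le_pow_right (by norm_num) hk) (tripleItem_bounds hij hjk).1

/-- No triple is missed: the items exhaust the triples whose largest label is one of the `d` new
ones. -/
lemma mask_mem_tripleItems {n d : ℕ} {S : Finset (Fin 8)} (hS : S.card = 3)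
    (h₁ : 2 ^ n ≤ mask S) (h₂ : mask S < 2 ^ (n + d)) :
    mask S ∈ (tripleItems n d).map Prod.fst := by
  obtain ⟨m, hm, hn, rfl⟩ := exists_sublist_labels S (fun _ => true) (by simp)
  have hlt : (m.map Fin.val).Pairwise (· < ·) := by
    rw [List.filter_true] at hm
    exact List.Pairwise.sublist hm (by decide)
  rw [List.toFinset_card_of_nodup hn] at hS
  obtain ⟨i, j, k, rfl⟩ := List.length_eq_three.1 hS
  simp only [List.map_cons, List.map_nil, List.pairwise_cons, List.mem_cons, List.not_mem_nil,
    or_false, forall_eq_or_imp, forall_eq] at hlt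
  obtain ⟨⟨hij, -⟩, hjk, -⟩ := hlt
  have hp : mask [i, j, k].toFinset = (tripleItem i j k).1 := (pows_eq_mask hn).symm
  obtain ⟨hb₁, hb₂, -⟩ := tripleItem_bounds hij hjk
  rw [hp] at h₁ h₂ ⊢
  refine List.mem_map_of_mem (mem_tripleItems.2 ⟨k, ?_, ?_, ?_⟩)
  · have := (Nat.pow_lt_pow_iff_right (a := 2) (by norm_num)).1 (h₁.trans_lt hb₂)
    omega
  · exact (Nat.pow_lt_pow_iff_right (by norm_num)).1 (hb₁.trans_lt h₂)
  · refine List.mem_map.2 ⟨(↑i, ↑j), List.mem_filter.2 ⟨mem_labelPairs.2 ⟨hij, j.isLt⟩, ?_⟩, rfl⟩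
    exact Nat.ble_eq_true_of_le hjk

lemma pairItem_pos {i j : Fin 8} (h : i < j) : (pairItem i j).1 = 256 + mask {i, j} := by
  change 256 + pows _ = _
  rw [pows_pair h.ne]

lemma scheme_pairItems : Scheme 8 pairItems := by
  have hmem : ∀ b ∈ pairItems, ∃ i j : Fin 8, i < j ∧ b = pairItem i j := by
    intro b hb
    obtain ⟨⟨i, j⟩, hp, rfl⟩ := List.mem_map.1 hb
    obtain ⟨hij, hj⟩ := mem_labelPairs.1 hp
    exact ⟨⟨i, hij.trans hj⟩, ⟨j, hj⟩, hij, rfl⟩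
  refine ⟨le_rfl, ?_, fun b hb => ?_, fun b hb => ?_, fun b hb => ?_⟩
  · rw [pairItems, List.pairwise_map]
    have hs : labelPairs.Pairwise fun p q => 2 ^ p.1 + 2 ^ p.2 < 2 ^ q.1 + 2 ^ q.2 := by decide
    refine hs.imp fun {p q} h => ?_
    change 256 + (2 ^ p.1 + (2 ^ p.2 + 0)) < 256 + (2 ^ q.1 + (2 ^ q.2 + 0))
    omega
  · obtain ⟨i, j, hij, rfl⟩ := hmem b hb
    exact Or.inr ⟨_, Finset.card_pair hij.ne, pairItem_pos hij⟩
  · obtain ⟨i, j, hij, rfl⟩ := hmem b hb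
    exact pairItem_sound hij
  · obtain ⟨i, j, hij, rfl⟩ := hmem b hb
    rw [pairItem_pos hij]
    norm_num

lemma add_mask_mem_pairItems {E : Finset (Fin 8)} (hE : E.card = 2) :
    256 + mask E ∈ pairItems.map Prod.fst := by
  obtain ⟨i, j, hij, rfl⟩ := Finset.card_eq_two.1 hE
  wlog hlt : i < j generalizing i j with H
  · rw [Finset.pair_comm] at hE ⊢
    exact H j i hij.symm hE (lt_of_le_of_ne (not_lt.1 hlt) hij.symm)
  rw [← pairItem_pos hlt]
  exact List.mem_map_of_mem (List.mem_map.2 ⟨(↑i, ↑j), mem_labelPairs.2 ⟨hlt, j.isLt⟩, rfl⟩)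

/-! ### Bounding orbits by chains of stabilizers -/

/-- The permutations that fix all labels from `n` on. -/
def fixing (n : ℕ) : Subgroup (Equiv.Perm (Fin 8)) where
  carrier := {σ | ∀ i : Fin 8, n ≤ i → σ i = i}
  mul_mem' {σ τ} hσ hτ i hi := by rw [Equiv.Perm.mul_apply, hτ i hi, hσ i hi]
  one_mem' _ _ := rfl
  inv_mem' {σ} hσ i hi := by rw [Equiv.Perm.inv_eq_iff_eq, hσ i hi]

lemma fixing_mono {m n : ℕ} (h : m ≤ n) : fixing m ≤ fixing n :=
  fun _ hσ i hi => hσ i (h.trans hi)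

lemma mem_fixing_eight (σ : Equiv.Perm (Fin 8)) : σ ∈ fixing 8 :=
  fun i hi => absurd i.isLt (not_lt.2 hi)

lemma card_fixing {n : ℕ} (hn : n ≤ 8) : Nat.card (fixing n) = n.factorial := by
  let e : Equiv.Perm {i : Fin 8 // (i : ℕ) < n} ≃ fixing n :=
    (Equiv.Perm.subtypeEquivSubtypePerm fun i : Fin 8 => (i : ℕ) < n).trans
      (Equiv.subtypeEquivRight fun σ =>
        ⟨fun h i hi => h i (not_lt.2 hi), fun h i hi => h i (not_lt.1 hi)⟩)
  rw [← Nat.card_congr e, Nat.card_perm]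
  congr 1
  rw [Nat.card_congr (Fin.castLEquiv hn).symm, Nat.card_eq_fintype_card, Fintype.card_fin]

/-- If `σ i` were at least `n`, it would be fixed by `σ`, and injectivity would give `σ i = i`. -/
lemma lt_of_fixing {n : ℕ} {σ : Equiv.Perm (Fin 8)} (hσ : σ ∈ fixing n) {i : Fin 8}
    (hi : (i : ℕ) < n) : (σ i : ℕ) < n := by
  by_contra h
  have := σ.injective (hσ _ (not_lt.1 h))
  rw [this] at h
  exact h hi

lemma exists_mem_fixing {n p e c : ℕ} (hp : p < 8 ^ n) (h : carries p e c = true) :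
    ∃ σ ∈ fixing n, (∀ i : Fin 8, (σ i : ℕ) = imgLabel p i) ∧ decode c = σ • decode e := by
  obtain ⟨σ, hσ, hc⟩ := exists_perm_of_carries h
  exact ⟨σ, fun i hi => Fin.ext (by rw [hσ, imgLabel_eq_self hp hi]), hσ, hc⟩

/-- The octal digit of `p` at position `k`. -/
def octDigit (p k : ℕ) : ℕ := Nat.land (Nat.shiftRight p (Nat.mul 3 k)) 7

/-- The permutations encoded in `T` fix the labels from `k + 1` on, preserve the code `c`, and move
`k` to distinct labels other than `k`. -/
noncomputable def levelTest (c k : ℕ) (T : List ℕ) : Bool :=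
  and (T.all fun p => and (Nat.ble (Nat.succ p) (Nat.pow 8 (Nat.succ k))) (carries p c c))
    (List.rec (motive := fun _ => ℕ → Bool) (fun _ => true) (fun p _ ih d =>
      and (Nat.ble (Nat.succ d) (octDigit p k)) (ih (octDigit p k))) T 0)

/-- Test a chain of lists of permutations, the last one for the label `1`. -/
noncomputable def chainTest (c : ℕ) (l : List (List ℕ)) : Bool :=
  List.rec (motive := fun _ => Bool) true (fun T t ih => and ih (levelTest c (t.length + 1) T)) l

/-- A lower bound for the order of a group with the given chain. -/
noncomputable def chainCard (l : List (List ℕ)) : ℕ :=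
  List.rec (motive := fun _ => ℕ) 1 (fun T _ ih => Nat.mul (Nat.succ T.length) ih) l

lemma pairwise_of_levelTest {k : ℕ} {T : List ℕ} {d : ℕ}
    (h : List.rec (motive := fun _ => ℕ → Bool) (fun _ => true) (fun p _ ih d =>
      and (Nat.ble (Nat.succ d) (octDigit p k)) (ih (octDigit p k))) T d = true) :
    (d :: T.map fun p => octDigit p k).Pairwise (· < ·) := by
  induction T generalizing d with
  | nil => exact List.pairwise_singleton _ _
  | cons p T ih =>
    rw [Bool.and_eq_true] at h
    have hd : d < octDigit p k := Nat.le_of_ble_eq_true h.1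
    have hp := ih h.2
    rw [List.map_cons]
    refine List.pairwise_cons.2 ⟨fun a ha => ?_, hp⟩
    rcases List.mem_cons.1 ha with rfl | ha
    · exact hd
    · exact hd.trans ((List.pairwise_cons.1 hp).1 a ha)

/-- The identity and the permutations in `T` send `k` to distinct labels `k ^^^ d`: the digits `d`
increase strictly, starting from 0 for the identity. They therefore lie in different cosets of the
subgroup that also fixes `k`. Only a lower bound is claimed, so `T` need not be a complete
transversal. -/
lemma card_le_of_levelTest {c k : ℕ} (hk : k < 8) {T : List ℕ} (h : levelTest c k T = true) :
    (T.length + 1) *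
      Nat.card (fixing k ⊓ MulAction.stabilizer (Equiv.Perm (Fin 8)) (decode c) : Subgroup _) ≤
    Nat.card (fixing (k + 1) ⊓ MulAction.stabilizer (Equiv.Perm (Fin 8)) (decode c) :
      Subgroup _) := by
  rw [levelTest, Bool.and_eq_true, List.all_eq_true] at h
  obtain ⟨hT, hs⟩ := h
  have hs := pairwise_of_levelTest hs
  have hmem : ∀ d ∈ (0 :: T.map fun p => octDigit p k),
      ∃ σ : (fixing (k + 1) ⊓ MulAction.stabilizer (Equiv.Perm (Fin 8)) (decode c) : Subgroup _),
        ((σ : Equiv.Perm (Fin 8)) ⟨k, hk⟩ : ℕ) = k ^^^ d := by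
    intro d hd
    rcases List.mem_cons.1 hd with rfl | hd
    · exact ⟨1, by simp⟩
    · obtain ⟨p, hp, rfl⟩ := List.mem_map.1 hd
      have := hT p hp
      rw [Bool.and_eq_true] at this
      obtain ⟨σ, hσ, hi, hc⟩ := exists_mem_fixing (n := k + 1) (Nat.le_of_ble_eq_true this.1) this.2
      exact ⟨⟨σ, hσ, hc.symm⟩, hi ⟨k, hk⟩⟩
  choose! g hg using hmem
  have hcard : (0 :: T.map fun p => octDigit p k).toFinset.card = T.length + 1 := by
    rw [List.toFinset_card_of_nodup (hs.imp fun h => h.ne)]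
    simp
  have hle : fixing k ⊓ MulAction.stabilizer (Equiv.Perm (Fin 8)) (decode c) ≤
      fixing (k + 1) ⊓ MulAction.stabilizer (Equiv.Perm (Fin 8)) (decode c) :=
    inf_le_inf_right _ (fixing_mono k.le_succ)
  let f : (0 :: T.map fun p => octDigit p k).toFinset ×
      (fixing k ⊓ MulAction.stabilizer (Equiv.Perm (Fin 8)) (decode c) : Subgroup _) →
      (fixing (k + 1) ⊓ MulAction.stabilizer (Equiv.Perm (Fin 8)) (decode c) : Subgroup _) :=
    fun z => g z.1 * Subgroup.inclusion hle z.2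
  have hf : Function.Injective f := by
    rintro ⟨⟨d, hd⟩, σ⟩ ⟨⟨d', hd'⟩, σ'⟩ h
    have happ : ∀ (d : ℕ) (hd : d ∈ (0 :: T.map fun p => octDigit p k).toFinset)
        (σ : (fixing k ⊓ MulAction.stabilizer (Equiv.Perm (Fin 8)) (decode c) : Subgroup _)),
        ((f (⟨d, hd⟩, σ) : Equiv.Perm (Fin 8)) ⟨k, hk⟩ : ℕ) = k ^^^ d := by
      intro d hd σ
      have : (σ : Equiv.Perm (Fin 8)) ⟨k, hk⟩ = ⟨k, hk⟩ := σ.2.1 _ le_rfl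
      rw [← hg d (List.mem_toFinset.1 hd)]
      change ((g d : Equiv.Perm (Fin 8)) ((σ : Equiv.Perm (Fin 8)) ⟨k, hk⟩) : ℕ) = _
      rw [this]
    have hdd : d = d' := by
      have := happ d hd σ
      rw [h, happ d' hd' σ'] at this
      exact (Nat.xor_right_injective this).symm
    subst hdd
    have hσ : Subgroup.inclusion hle σ = Subgroup.inclusion hle σ' := mul_left_cancel h
    rw [Subgroup.inclusion_injective hle hσ]
  have := Nat.card_le_card_of_injective f hf
  rwa [Nat.card_prod, Nat.card_eq_fintype_card, Fintype.card_coe, hcard] at this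

lemma chainCard_le {c : ℕ} {l : List (List ℕ)} (hl : l.length < 8) (h : chainTest c l = true) :
    chainCard l ≤ Nat.card (fixing (l.length + 1) ⊓
      MulAction.stabilizer (Equiv.Perm (Fin 8)) (decode c) : Subgroup _) := by
  induction l with
  -- `fixing 1` is trivial, so the chain may start with label `1` and the bound 1.
  | nil => exact Nat.card_pos
  | cons T t ih =>
    rw [List.length_cons] at hl
    have h' : (chainTest c t && levelTest c (t.length + 1) T) = true := h
    rw [Bool.and_eq_true] at h'
    calc chainCard (T :: t) = (T.length + 1) * chainCard t := rfl
      _ ≤ _ := Nat.mul_le_mul_left _ (ih (by omega) h'.1)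
      _ ≤ _ := card_le_of_levelTest (by omega) h'.2

/-- The orbit and the stabilizer in `fixing n` have sizes with product `n!`, and the chain gives at
least `chainCard l` elements of the stabilizer. The equality of the orbit size with `o` comes later,
from `Census.of_le`. -/
lemma ncard_orbit_le {n c o : ℕ} {l : List (List ℕ)} (hn : n ≤ 8) (hl : l.length + 1 = n)
    (h : chainTest c l = true) (ho : o * chainCard l = n.factorial) :
    (MulAction.orbit (fixing n) (decode c)).ncard ≤ o := by
  subst hl
  have h₁ := chainCard_le (by omega) h
  set A := fixing (l.length + 1) ⊓ MulAction.stabilizer (Equiv.Perm (Fin 8)) (decode c)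
  have h₂ : Nat.card A ≤ Nat.card (MulAction.stabilizer (fixing (l.length + 1)) (decode c)) :=
    Nat.card_le_card_of_injective (fun σ => ⟨⟨σ, σ.2.1⟩, σ.2.2⟩) fun σ τ h =>
      Subtype.ext (congrArg (fun z => ((z : fixing (l.length + 1)) : Equiv.Perm (Fin 8)))
        (congrArg Subtype.val h))
  have h₃ := Subgroup.card_mul_index
    (MulAction.stabilizer (fixing (l.length + 1)) (decode c))
  rw [MulAction.index_stabilizer, card_fixing hn, ← ho, mul_comm] at h₃
  have h₄ : 0 < chainCard l := Nat.pos_of_ne_zero fun h => by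
    rw [h, mul_zero] at ho
    exact (Nat.factorial_pos _).ne ho
  refine Nat.le_of_mul_le_mul_right ?_ h₄
  calc _ ≤ _ := Nat.mul_le_mul_left _ (h₁.trans h₂)
    _ = _ := h₃

/-! ### Certificates for a step of the census -/

/-- The code of a representative, the size of its orbit, and a chain of stabilizers. -/
abbrev Entry := ℕ × ℕ × List (List ℕ)

/-- Test a representative and the bound for its orbit under the permutations of `n` labels. -/
noncomputable def entryTest (n : ℕ) (x : Entry) : Bool :=
  and (lawfulTest x.1) (and (Nat.beq (x.2.2.length + 1) n)
    (and (Nat.beq (Nat.mul x.2.1 (chainCard x.2.2)) n.factorial) (chainTest x.1 x.2.2)))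

/-- Test a relation between the entries of two lists of the same length. -/
noncomputable def all₂ {α β : Type} (f : α → β → Bool) (l : List α) : List β → Bool :=
  List.rec (motive := fun _ => List β → Bool)
    (fun l' => List.rec (motive := fun _ => Bool) true (fun _ _ _ => false) l')
    (fun a _ ih l' =>
      List.rec (motive := fun _ => Bool) false (fun b t _ => and (f a b) (ih t)) l') l

lemma forall₂_of_all₂ {α β : Type} {f : α → β → Bool} {l : List α} {l' : List β}
    (h : all₂ f l l' = true) : List.Forall₂ (fun a b => f a b = true) l l' := by
  induction l generalizing l' with
  | nil =>
    cases l' with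
    | nil => exact List.Forall₂.nil
    | cons b t => exact Bool.noConfusion h
  | cons a l ih =>
    cases l' with
    | nil => exact Bool.noConfusion h
    | cons b t =>
      have h' : (f a b && all₂ f l t) = true := h
      rw [Bool.and_eq_true] at h'
      exact List.Forall₂.cons h'.1 (ih h'.2)

/-- Test the entry of `l` with number `k`. -/
noncomputable def entryAt (f : ℕ → Bool) (l : List ℕ) : ℕ → Bool :=
  List.rec (motive := fun _ => ℕ → Bool) (fun _ => false)
    (fun c _ ih k => Nat.rec (f c) (fun k _ => ih k) k) l

lemma exists_of_entryAt {f : ℕ → Bool} {l : List ℕ} {k : ℕ} (h : entryAt f l k = true) :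
    ∃ hk : k < l.length, f l[k] = true := by
  induction l generalizing k with
  | nil => exact Bool.noConfusion h
  | cons c l ih =>
    cases k with
    | zero => exact ⟨Nat.succ_pos _, h⟩
    | succ k =>
      obtain ⟨hk, h'⟩ := ih (k := k) h
      exact ⟨Nat.succ_lt_succ hk, h'⟩

/-- Test a certificate: the code `e` is mapped to the code with number `w / 2 ^ 24` by the
permutation encoded in `w % 2 ^ 24`. -/
noncomputable def certTest (n : ℕ) (codes : List ℕ) (e w : ℕ) : Bool :=
  -- A permutation code has eight octal digits, that is 24 bits, and `16777215 = 2 ^ 24 - 1`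
  -- extracts them.
  and (Nat.ble (Nat.succ (Nat.land w 16777215)) (Nat.pow 8 n))
    (entryAt (fun c => carries (Nat.land w 16777215) e c) codes (Nat.shiftRight w 24))

/-- The certificate `w` refers to one of the first `k` codes. -/
noncomputable def isBelow (k w : ℕ) : Bool := Nat.ble (Nat.succ (Nat.shiftRight w 24)) k

/-- Test the certificates for all extensions of a list of codes. -/
noncomputable def certsTest (n : ℕ) (items : List Item) (codes : List ℕ) (prev : List Entry)
    (certs : List (List ℕ)) : Bool :=
  all₂ (fun r ws => all₂ (certTest n codes) (extensions items r.1) ws) prev certs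

/-- The number of certified structures that refer to one of the first `k` codes. -/
noncomputable def certsWeight (k : ℕ) (prev : List Entry) (certs : List (List ℕ)) : ℕ :=
  (List.zipWith (fun r ws => Nat.mul r.2.1 (ws.countP (isBelow k))) prev certs).sum

/-- One stage of the census. Certificates refer to the list `next.map Prod.fst ++ bad`: an index
below `next.length` places the extension in the orbit of a representative, a larger one in the orbit
of a code outside `X`. As `X` is stable, the fibre of `X` over an earlier representative consists of
the extensions of the first kind. -/
theorem census_of_certs {n n' : ℕ} (hn' : n' ≤ 8) (hnn : n ≤ n') {items : List Item}
    (hl : Scheme n items) {X Y : Set Pair} {prev : List Entry}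
    (hprev : ∀ r ∈ prev, r.1 < 2 ^ 2 ^ n)
    (hY : Census (fixing n) Y (fun i : Fin prev.length => decode prev[i].1) fun i => prev[i].2.1)
    (hXY : ∀ Q ∈ X, restrict n Q ∈ Y) (hX : ∀ σ ∈ fixing n', ∀ Q ∈ X, σ • Q ∈ X)
    (hX' : ∀ Q ∈ X, Q.OfTriplesAndSextuples ∧ Q.BezoutWeak ∧
      ∀ p, IsPosition p → 2 ^ n ≤ p → p ∉ items.map Prod.fst → digits Q p = false)
    {next : List Entry} (hnext : ∀ x ∈ next, decode x.1 ∈ X)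
    (htest : next.all (entryTest n') = true) {bad : List ℕ} (hbad : ∀ c ∈ bad, decode c ∉ X)
    {certs : List (List ℕ)}
    (hcerts : certsTest n' items (next.map Prod.fst ++ bad) prev certs = true)
    (hsum : (next.map fun x => x.2.1).sum ≤ certsWeight next.length prev certs) :
    Census (fixing n') X (fun j : Fin next.length => decode next[j].1) fun j => next[j].2.1 := by
  have hrows := forall₂_of_all₂ hcerts
  have hlen : prev.length = certs.length := hrows.length_eq
  -- The extensions in the fibre, each kept with its certificate.
  let F' : Fin prev.length → List (ℕ × ℕ) := fun i =>
    ((extensions items prev[i].1).zip certs[i]).filter fun z => isBelow next.length z.2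
  have hrow : ∀ i : Fin prev.length, List.Forall₂
      (fun e w => certTest n' (next.map Prod.fst ++ bad) e w = true)
      (extensions items prev[i].1) certs[i] := fun i =>
    forall₂_of_all₂ ((List.forall₂_iff_get.1 hrows).2 i i.isLt (hlen ▸ i.isLt))
  have hcert : ∀ e w, certTest n' (next.map Prod.fst ++ bad) e w = true →
      ∃ hk : w >>> 24 < (next.map Prod.fst ++ bad).length, ∃ σ ∈ fixing n',
        decode (next.map Prod.fst ++ bad)[w >>> 24] = σ • decode e := by
    intro e w h
    rw [certTest, Bool.and_eq_true] at h
    obtain ⟨hk, h'⟩ := exists_of_entryAt h.2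
    obtain ⟨σ, hσ, -, hc⟩ := exists_mem_fixing (Nat.le_of_ble_eq_true h.1) h'
    exact ⟨hk, σ, hσ, hc⟩
  have hgood : ∀ w (hk : w >>> 24 < (next.map Prod.fst ++ bad).length),
      isBelow next.length w = true → ∃ j : Fin next.length,
        (next.map Prod.fst ++ bad)[w >>> 24] = next[j].1 := by
    intro w hk h
    have hlt : w >>> 24 < next.length := Nat.le_of_ble_eq_true h
    refine ⟨⟨w >>> 24, hlt⟩, ?_⟩
    rw [List.getElem_append_left (by simpa using hlt)]
    simp
  have hr : ∀ i : Fin prev.length, prev[i].1 < 2 ^ 2 ^ n :=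
    fun i => hprev _ (List.getElem_mem _)
  classical
  refine Census.of_fibers (fixing_mono hnn) hY (π := restrict n) ?_ hXY hX
    (fun i => ((F' i).map fun z => decode z.1).toFinset) ?_ ?_ ?_ ?_ ?_
  -- Equivariance of the restriction: `fixing n` preserves the set of the first `n` labels.
  · intro σ hσ Q
    refine Prod.ext (Finset.ext fun S => ?_) rfl
    rw [mem_smul_fst, restrict, restrict, Finset.mem_filter, Finset.mem_filter, mem_smul_fst]
    refine and_congr_right fun _ => ⟨fun h i hi => ?_, fun h i hi => ?_⟩
    · obtain ⟨j, hj, rfl⟩ := Finset.mem_smul_finset.1 hi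
      exact lt_of_fixing (inv_mem hσ) (h j hj)
    · have := h (σ⁻¹ i) (Finset.smul_mem_smul_finset hi)
      by_contra hc
      exact hc (by simpa using lt_of_fixing hσ this)
  · intro i Q hQ hQi
    obtain ⟨hQ₁, hQ₂, hQ₃⟩ := hX' Q hQ
    obtain ⟨e, he, rfl⟩ := hl.exists_decode_eq (hr i) hQ₁ hQ₂ hQi hQ₃
    obtain ⟨k, hk, rfl⟩ := List.mem_iff_getElem.1 he
    have hk' : k < certs[i].length := (hrow i).length_eq ▸ hk
    obtain ⟨hw, σ, hσ, hc⟩ := hcert _ _ ((List.forall₂_iff_get.1 (hrow i)).2 k hk hk')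
    rw [List.mem_toFinset, List.mem_map]
    refine ⟨((extensions items prev[i].1)[k], certs[i][k]), List.mem_filter.2 ⟨?_, ?_⟩, rfl⟩
    · refine List.mem_iff_getElem.2 ⟨k, ?_, ?_⟩
      · rw [List.length_zip]; omega
      · simp
    -- A certificate that refers to a code in `bad` would put that code into the stable set `X`.
    · refine Nat.ble_eq_true_of_le (Nat.lt_of_not_le fun hle => ?_)
      refine hbad _ ?_ (hc ▸ hX σ hσ _ hQ)
      change next.length ≤ certs[i][k] >>> 24 at hle
      change (next.map Prod.fst ++ bad)[certs[i][k] >>> 24] ∈ bad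
      rw [List.getElem_append_right (by simpa using hle)]
      exact List.getElem_mem _
  · intro i Q hQ
    rw [List.mem_toFinset, List.mem_map] at hQ
    obtain ⟨⟨e, w⟩, hz, rfl⟩ := hQ
    obtain ⟨hz, hw⟩ := List.mem_filter.1 hz
    refine ⟨hl.restrict_decode (hr i) (List.of_mem_zip hz).1, ?_⟩
    obtain ⟨k, hk, hz⟩ := List.mem_iff_getElem.1 hz
    rw [List.getElem_zip, Prod.mk.injEq] at hz
    rw [List.length_zip] at hk
    have := (List.forall₂_iff_get.1 (hrow i)).2 k (by omega) (by omega)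
    simp only [List.get_eq_getElem] at this
    rw [hz.1, hz.2] at this
    obtain ⟨hk, σ, hσ, hc⟩ := hcert _ _ this
    obtain ⟨j, hj⟩ := hgood w hk hw
    refine ⟨j, ⟨σ⁻¹, inv_mem hσ⟩, ?_⟩
    change σ⁻¹ • decode next[j].1 = decode e
    rw [← hj, hc, inv_smul_smul]
  · exact fun j => hnext _ (List.getElem_mem _)
  · intro j
    have := List.all_eq_true.1 htest _ (List.getElem_mem j.isLt)
    rw [entryTest, Bool.and_eq_true, Bool.and_eq_true, Bool.and_eq_true] at this
    exact ncard_orbit_le hn' (Nat.eq_of_beq_eq_true this.2.1) this.2.2.2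
      (Nat.eq_of_beq_eq_true this.2.2.1)
  · have h₁ : ∑ j : Fin next.length, next[j].2.1 = (next.map fun x => x.2.1).sum := by
      rw [← Fin.sum_univ_fun_getElem]
      rfl
    -- Distinct extensions decode to distinct pairs, so the size of the fibre is the number of
    -- certificates that refer to `next`.
    have h₂ : ∀ i : Fin prev.length, ((F' i).map fun z => decode z.1).toFinset.card =
        certs[i].countP (isBelow next.length) := by
      intro i
      have hzip : ((extensions items prev[i].1).zip certs[i]).map Prod.fst =
          extensions items prev[i].1 := List.map_fst_zip (hrow i).length_eq.le
      have hzip' : ((extensions items prev[i].1).zip certs[i]).map Prod.snd = certs[i] :=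
        List.map_snd_zip (hrow i).length_eq.ge
      rw [List.toFinset_card_of_nodup, List.length_map]
      · conv_rhs => rw [← hzip', List.countP_map]
        rw [List.countP_eq_length_filter]
        rfl
      · refine (hl.nodup_map_decode (hr i)).sublist ?_
        conv_rhs => rw [← hzip, List.map_map]
        exact List.filter_sublist.map _
    rw [h₁]
    refine hsum.trans (le_of_eq ?_)
    rw [certsWeight]
    have h₃ : List.zipWith (fun r ws => Nat.mul r.2.1 (ws.countP (isBelow next.length))) prev certs
        = List.ofFn fun i : Fin prev.length =>
          prev[i].2.1 * certs[i].countP (isBelow next.length) := by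
      refine List.ext_getElem (by simp [hlen]) fun i _ _ => ?_
      simp
    rw [h₃, List.sum_ofFn]
    exact Finset.sum_congr rfl fun i _ => by rw [h₂]

/-! ### Representability over the complex numbers -/

/-- The determinant of three vectors. -/
noncomputable def det₃ {R : Type*} [CommRing R] (u v w : Fin 3 → R) : R :=
  (Matrix.of ![u, v, w]).det

lemma exists_orthogonal_iff {K : Type*} [Field K] (u v w : Fin 3 → K) :
    (∃ l : Fin 3 → K, l ≠ 0 ∧ l ⬝ᵥ u = 0 ∧ l ⬝ᵥ v = 0 ∧ l ⬝ᵥ w = 0) ↔ det₃ u v w = 0 := by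
  rw [det₃, ← Matrix.exists_mulVec_eq_zero_iff]
  refine exists_congr fun l => and_congr_right fun _ => ?_
  rw [funext_iff, Fin.forall_fin_succ, Fin.forall_fin_two]
  simp only [Matrix.mulVec, dotProduct_comm l]
  rfl

lemma onLine_triple_iff {p : Fin 8 → ComplexPlane} {i j k : Fin 8} :
    OnLine p {i, j, k} ↔ det₃ (p i).rep (p j).rep (p k).rep = 0 := by
  rw [← exists_orthogonal_iff]
  have key : ∀ (l : Fin 3 → ℂ) (hl : l ≠ 0) (i : Fin 8),
      (Projectivization.mk ℂ l hl).orthogonal (p i) ↔ l ⬝ᵥ (p i).rep = 0 := by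
    intro l hl i
    conv_lhs => rw [← (p i).mk_rep]
    exact Projectivization.orthogonal_mk hl _
  constructor
  · rintro ⟨l, hl⟩
    simp only [Finset.mem_insert, Finset.mem_singleton, forall_eq_or_imp, forall_eq] at hl
    rw [← l.mk_rep] at hl
    exact ⟨l.rep, l.rep_nonzero, (key _ _ _).1 hl.1, (key _ _ _).1 hl.2.1, (key _ _ _).1 hl.2.2⟩
  · rintro ⟨l, hl, h⟩
    refine ⟨Projectivization.mk ℂ l hl, ?_⟩
    simp only [Finset.mem_insert, Finset.mem_singleton, forall_eq_or_imp, forall_eq]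
    exact ⟨(key _ _ _).2 h.1, (key _ _ _).2 h.2.1, (key _ _ _).2 h.2.2⟩

/-- The definition leaves the sextuples free, so those that lie on a conic for the given points can
be taken. -/
lemma isMatroidal_iff {Q : Pair} : Q.IsMatroidal ↔ ∃ p : Fin 8 → ComplexPlane,
    Function.Injective p ∧ ∀ I : Finset (Fin 8), I.card = 3 → (I ∈ Q.1 ↔ OnLine p I) := by
  classical
  constructor
  · rintro ⟨p, hp⟩
    obtain ⟨J, hJ⟩ := Set.mem_iUnion.1 hp
    exact ⟨p, hJ.1, hJ.2.1⟩
  · rintro ⟨p, hp, h⟩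
    refine ⟨p, Set.mem_iUnion.2 ⟨Finset.univ.filter (OnConic p), hp, h, fun J _ => ?_⟩⟩
    simp

lemma IsMatroidal.congr {Q Q' : Pair} (hQ : Q.IsMatroidal) (h : Q.1 = Q'.1) :
    Q'.IsMatroidal := by
  rw [isMatroidal_iff] at *
  rwa [← h]

/-! ### Invariance under relabelling -/

lemma onLine_smul {p : Fin 8 → ComplexPlane} {σ : Equiv.Perm (Fin 8)} {S : Finset (Fin 8)} :
    OnLine (p ∘ σ) (σ⁻¹ • S) ↔ OnLine p S := by
  refine exists_congr fun l => ⟨fun h i hi => ?_, fun h i hi => ?_⟩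
  · have := h (σ⁻¹ i) (Finset.smul_mem_smul_finset hi)
    simpa using this
  · refine h (σ i) ?_
    have := Finset.smul_mem_smul_finset (a := σ) hi
    rwa [smul_inv_smul] at this

lemma IsMatroidal.smul {Q : Pair} (hQ : Q.IsMatroidal) (σ : Equiv.Perm (Fin 8)) :
    (σ • Q).IsMatroidal := by
  rw [isMatroidal_iff] at *
  obtain ⟨p, hp, h⟩ := hQ
  refine ⟨p ∘ ⇑(σ⁻¹), hp.comp (σ⁻¹).injective, fun I hI => ?_⟩
  rw [mem_smul_fst, h _ (by rwa [Finset.card_smul_finset]), ← onLine_smul (p := p) (σ := σ⁻¹),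
    inv_smul_smul]

lemma BezoutWeak.smul {Q : Pair} (hQ : Q.BezoutWeak) (σ : Equiv.Perm (Fin 8)) :
    (σ • Q).BezoutWeak := by
  have hcard : ∀ S T : Finset (Fin 8), (σ⁻¹ • S ∩ σ⁻¹ • T).card = (S ∩ T).card := fun S T => by
    rw [← Finset.smul_finset_inter, Finset.card_smul_finset]
  have hsub : ∀ S T U : Finset (Fin 8), S ⊆ T ∪ U → σ⁻¹ • S ⊆ σ⁻¹ • T ∪ σ⁻¹ • U := by
    intro S T U h
    rw [← Finset.smul_finset_union]
    exact Finset.smul_finset_subset_smul_finset h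
  constructor
  · intro I hI J hJ
    rw [← hcard]
    exact hQ.line_conic _ (mem_smul_fst.1 hI) _ (mem_smul_snd.1 hJ)
  · intro I₁ h₁ I₂ h₂ h I hI hc
    rw [← hcard] at h
    exact mem_smul_fst.2 (hQ.line_line _ (mem_smul_fst.1 h₁) _ (mem_smul_fst.1 h₂) h _
      (hsub _ _ _ hI) (by rwa [Finset.card_smul_finset]))
  · intro I₁ h₁ I₂ h₂ h I hI hc
    rw [← hcard] at h
    exact mem_smul_snd.2 (hQ.conic_conic _ (mem_smul_snd.1 h₁) _ (mem_smul_snd.1 h₂) h _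
      (hsub _ _ _ hI) (by rwa [Finset.card_smul_finset]))

lemma OfTriplesAndSextuples.smul {Q : Pair} (hQ : Q.OfTriplesAndSextuples)
    (σ : Equiv.Perm (Fin 8)) : (σ • Q).OfTriplesAndSextuples := by
  constructor
  · intro I hI
    rw [← hQ.1 _ (mem_smul_fst.1 hI), Finset.card_smul_finset]
  · intro I hI
    rw [← hQ.2 _ (mem_smul_snd.1 hI), Finset.card_smul_finset]

/-! #### The Fano plane -/

lemma det₃_mulVec {R : Type*} [CommRing R] (N : Matrix (Fin 3) (Fin 3) R) (u v w : Fin 3 → R) :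
    det₃ (N.mulVec u) (N.mulVec v) (N.mulVec w) = N.det * det₃ u v w := by
  have : Matrix.of ![N.mulVec u, N.mulVec v, N.mulVec w] = Matrix.of ![u, v, w] * N.transpose := by
    ext i j
    fin_cases i <;>
      simp [Matrix.mul_apply, Matrix.mulVec, dotProduct, Matrix.transpose_apply, mul_comm]
  rw [det₃, this, Matrix.det_mul, Matrix.det_transpose, mul_comm, det₃]

lemma det₃_eq {R : Type*} [CommRing R] (u v w : Fin 3 → R) :
    det₃ u v w = u 0 * (v 1 * w 2 - v 2 * w 1) - u 1 * (v 0 * w 2 - v 2 * w 0) +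
      u 2 * (v 0 * w 1 - v 1 * w 0) := by
  rw [det₃, Matrix.det_fin_three]
  simp
  ring

/-- The diagonal points of a complete quadrangle are not collinear. -/
theorem diagonal_points_not_collinear {K : Type*} [Field K] (h2 : (2 : K) ≠ 0)
    {a b c d e f g : Fin 3 → K} (habc : det₃ a b c ≠ 0) (habd : det₃ a b d ≠ 0)
    (hacd : det₃ a c d ≠ 0) (hbcd : det₃ b c d ≠ 0) (he : e ≠ 0) (hf : f ≠ 0) (hg : g ≠ 0)
    (hbce : det₃ b c e = 0) (hade : det₃ a d e = 0) (hacf : det₃ a c f = 0)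
    (hbdf : det₃ b d f = 0) (habg : det₃ a b g = 0) (hcdg : det₃ c d g = 0) :
    det₃ e f g ≠ 0 := by
  -- In the coordinates given by the basis `a, b, c` these points become the unit vectors; all
  -- determinants are multiplied by the nonzero factor `N.det`.
  set M : Matrix (Fin 3) (Fin 3) K := (Matrix.of ![a, b, c]).transpose with hM
  have hdet : IsUnit M.det := by
    rw [hM, Matrix.det_transpose]
    exact isUnit_iff_ne_zero.2 habc
  set N := M⁻¹ with hN
  have hNdet : N.det ≠ 0 := by
    rw [hN, Matrix.det_nonsing_inv]
    simpa using hdet.ne_zero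
  have hNM : N * M = 1 := Matrix.nonsing_inv_mul M hdet
  have hcol : ∀ i, N.mulVec (M.col i) = Pi.single i 1 := by
    intro i
    rw [← Matrix.mulVec_single_one, Matrix.mulVec_mulVec, hNM, Matrix.one_mulVec]
  have ha : N.mulVec a = Pi.single 0 1 := hcol 0
  have hb : N.mulVec b = Pi.single 1 1 := hcol 1
  have hc : N.mulVec c = Pi.single 2 1 := hcol 2
  have hinj : ∀ v, v ≠ 0 → N.mulVec v ≠ 0 := by
    intro v hv h
    have := congrArg M.mulVec h
    rw [Matrix.mulVec_mulVec, Matrix.mul_nonsing_inv M hdet, Matrix.one_mulVec,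
      Matrix.mulVec_zero] at this
    exact hv this
  have hz : ∀ u v w, det₃ (N.mulVec u) (N.mulVec v) (N.mulVec w) = 0 ↔ det₃ u v w = 0 := by
    intro u v w
    rw [det₃_mulVec, mul_eq_zero, or_iff_right hNdet]
  rw [← hz] at hbce hade hacf hbdf habg hcdg
  rw [ne_eq, ← hz] at habd hacd hbcd ⊢
  replace he := hinj e he
  replace hf := hinj f hf
  replace hg := hinj g hg
  simp only [ha, hb, hc] at habd hacd hbcd hbce hade hacf hbdf habg hcdg
  clear ha hb hc hz hinj hcol
  generalize N.mulVec d = d at *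
  generalize N.mulVec e = e at *
  generalize N.mulVec f = f at *
  generalize N.mulVec g = g at *
  simp only [det₃_eq, Pi.single_apply] at habd hacd hbcd hbce hade hacf hbdf habg hcdg ⊢
  simp at habd hacd hbcd hbce hade hacf hbdf habg hcdg
  -- Now `d` has no zero coordinate, and the lines `bc`, `ac`, `ab` give `e 0 = f 1 = g 2 = 0`. If a
  -- further coordinate vanished, the line through `d` would force the whole vector to vanish.
  have he1 : e 1 ≠ 0 := fun h => he <| by
    have h2 : e 2 = 0 := by simpa [h, hacd] using hade
    ext i; fin_cases i <;> simp [hbce, h, h2]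
  have hf2 : f 2 ≠ 0 := fun h => hf <| by
    have h0 : f 0 = 0 := by simpa [h, habd] using hbdf
    ext i; fin_cases i <;> simp [hacf, h, h0]
  have hg0 : g 0 ≠ 0 := fun h => hg <| by
    have h1 : g 1 = 0 := by simpa [h, hbcd] using hcdg
    ext i; fin_cases i <;> simp [habg, h, h1]
  intro h
  rw [hbce, hacf, habg] at h
  have h₁ : d 1 * e 2 = d 2 * e 1 := sub_eq_zero.1 hade
  have h₂ : d 2 * f 0 = d 0 * f 2 := sub_eq_zero.1 hbdf
  have h₃ : d 0 * g 1 = d 1 * g 0 := sub_eq_zero.1 hcdg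
  -- The determinant of `e, f, g` is `e 1 * f 2 * g 0 + e 2 * f 0 * g 1`. By `h₁`, `h₂`, `h₃` its
  -- two terms agree after multiplication by `d 0 * d 1 * d 2`, and this is where 2 appears.
  have : 2 * (d 0 * d 1 * d 2 * (e 1 * f 2 * g 0)) = 0 := by
    have : (d 1 * e 2) * (d 2 * f 0) * (d 0 * g 1) = (d 2 * e 1) * (d 0 * f 2) * (d 1 * g 0) := by
      rw [h₁, h₂, h₃]
    linear_combination (d 0 * d 1 * d 2) * h - this
  simp [h2, hbcd, hacd, habd, he1, hf2, hg0] at this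

/-- The codes in which the triples on the labels `1, …, 7` are those of a Fano plane. -/
noncomputable def fanoTest (s : ℕ) : Bool :=
  and ([[2, 3, 5], [1, 4, 5], [1, 3, 6], [2, 4, 6], [1, 2, 7], [3, 4, 7], [5, 6, 7]].all
      fun m => bit s (pows m))
    ([[1, 2, 3], [1, 2, 4], [1, 3, 4], [2, 3, 4]].all fun m => not (bit s (pows m)))

/-- The labels 1, 2, 3, 4 form a quadrangle with diagonal points 5, 6, 7, which the seventh line of
the Fano plane would make collinear. -/
theorem not_isMatroidal_of_fanoTest {s : ℕ} (h : fanoTest s = true) :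
    ¬ (decode s).IsMatroidal := by
  intro hQ
  obtain ⟨p, -, hp⟩ := isMatroidal_iff.1 hQ
  have key : ∀ i j k : Fin 8, [i, j, k].Nodup →
      (bit s (pows [(i : ℕ), j, k]) = true ↔ det₃ (p i).rep (p j).rep (p k).rep = 0) := by
    intro i j k hn
    have hc : ({i, j, k} : Finset (Fin 8)).card = 3 := by
      simpa using List.toFinset_card_of_nodup hn
    rw [← onLine_triple_iff, ← hp _ hc, mem_decode_fst, and_iff_right hc]
    have := pows_eq_mask hn
    simp only [List.map_cons, List.map_nil] at this
    rw [this]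
    simp
  simp only [fanoTest, Bool.and_eq_true, List.all_cons, List.all_nil, Bool.not_eq_true',
    and_true] at h
  obtain ⟨⟨h₁, h₂, h₃, h₄, h₅, h₆, h₇⟩, h₈, h₉, h₁₀, h₁₁⟩ := h
  have no : ∀ i j k : Fin 8, [i, j, k].Nodup → bit s (pows [(i : ℕ), j, k]) = false →
      det₃ (p i).rep (p j).rep (p k).rep ≠ 0 := fun i j k hn h h' => by
    rw [(key i j k hn).2 h'] at h
    exact Bool.noConfusion h
  exact diagonal_points_not_collinear two_ne_zero (no 1 2 3 (by decide) h₈)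
    (no 1 2 4 (by decide) h₉) (no 1 3 4 (by decide) h₁₀) (no 2 3 4 (by decide) h₁₁)
    (p 5).rep_nonzero (p 6).rep_nonzero (p 7).rep_nonzero
    ((key 2 3 5 (by decide)).1 h₁) ((key 1 4 5 (by decide)).1 h₂)
    ((key 1 3 6 (by decide)).1 h₃) ((key 2 4 6 (by decide)).1 h₄)
    ((key 1 2 7 (by decide)).1 h₅) ((key 3 4 7 (by decide)).1 h₆)
    ((key 5 6 7 (by decide)).1 h₇)

/-! #### Coordinates in the Eisenstein integers -/

/-- The complex number `a + b ω`, where `ω` is a primitive third root of unity. -/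
noncomputable def eisenstein (z : ℤ × ℤ) : ℂ := ⟨z.1 - z.2 / 2, z.2 * (√3 / 2)⟩

/-- The product of Eisenstein integers. -/
def eMul (z w : ℤ × ℤ) : ℤ × ℤ :=
  (Int.sub (Int.mul z.1 w.1) (Int.mul z.2 w.2),
    Int.sub (Int.add (Int.mul z.1 w.2) (Int.mul z.2 w.1)) (Int.mul z.2 w.2))

/-- The difference of Eisenstein integers. -/
def eSub (z w : ℤ × ℤ) : ℤ × ℤ := (Int.sub z.1 w.1, Int.sub z.2 w.2)

/-- The sum of Eisenstein integers. -/
def eAdd (z w : ℤ × ℤ) : ℤ × ℤ := (Int.add z.1 w.1, Int.add z.2 w.2)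

/-- This rests on `ω² = -1 - ω`; in real and imaginary parts it is `√3 * √3 = 3`. -/
lemma eisenstein_mul (z w : ℤ × ℤ) : eisenstein (eMul z w) = eisenstein z * eisenstein w := by
  have h3 : √3 * √3 = (3 : ℝ) := Real.mul_self_sqrt (by norm_num)
  change eisenstein (z.1 * w.1 - z.2 * w.2, z.1 * w.2 + z.2 * w.1 - z.2 * w.2) = _
  apply Complex.ext <;> simp only [eisenstein, Complex.mul_re, Complex.mul_im] <;> push_cast
  · linear_combination (z.2 * w.2 / 4 : ℝ) * h3
  · ring

lemma eisenstein_sub (z w : ℤ × ℤ) : eisenstein (eSub z w) = eisenstein z - eisenstein w := by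
  change eisenstein (z.1 - w.1, z.2 - w.2) = _
  apply Complex.ext <;> simp only [eisenstein, Complex.sub_re, Complex.sub_im] <;> push_cast <;>
    ring

lemma eisenstein_add (z w : ℤ × ℤ) : eisenstein (eAdd z w) = eisenstein z + eisenstein w := by
  change eisenstein (z.1 + w.1, z.2 + w.2) = _
  apply Complex.ext <;> simp only [eisenstein, Complex.add_re, Complex.add_im] <;> push_cast <;>
    ring

/-- `1` and `ω` are linearly independent over the reals, so the vanishing of a complex determinant
becomes a test on two integers. -/
lemma eisenstein_eq_zero {z : ℤ × ℤ} : eisenstein z = 0 ↔ z = (0, 0) := by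
  have h3 : (√3 / 2 : ℝ) ≠ 0 := by positivity
  constructor
  · intro h
    have him := congrArg Complex.im h
    have hre := congrArg Complex.re h
    simp only [eisenstein, Complex.zero_im, Complex.zero_re, mul_eq_zero, h3, or_false,
      Int.cast_eq_zero] at him hre
    rw [him] at hre
    exact Prod.ext (by simpa using hre) him
  · rintro rfl
    apply Complex.ext <;> simp [eisenstein]

/-- Test whether an Eisenstein integer vanishes. -/
noncomputable def eIsZero (z : ℤ × ℤ) : Bool :=
  and (Nat.beq z.1.natAbs 0) (Nat.beq z.2.natAbs 0)

lemma eIsZero_iff {z : ℤ × ℤ} : eIsZero z = true ↔ eisenstein z = 0 := by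
  rw [eisenstein_eq_zero, eIsZero, Bool.and_eq_true, Nat.beq_eq, Nat.beq_eq, Int.natAbs_eq_zero,
    Int.natAbs_eq_zero, Prod.ext_iff]

/-- A vector of Eisenstein integers. -/
abbrev EVector := (ℤ × ℤ) × (ℤ × ℤ) × (ℤ × ℤ)

/-- The vector product of vectors of Eisenstein integers. -/
def eCross (u v : EVector) : EVector :=
  (eSub (eMul u.2.1 v.2.2) (eMul u.2.2 v.2.1), eSub (eMul u.2.2 v.1) (eMul u.1 v.2.2),
    eSub (eMul u.1 v.2.1) (eMul u.2.1 v.1))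

/-- The determinant of three vectors of Eisenstein integers. -/
def eDet (u v w : EVector) : ℤ × ℤ :=
  eAdd (eMul (eCross u v).1 w.1) (eAdd (eMul (eCross u v).2.1 w.2.1) (eMul (eCross u v).2.2 w.2.2))

/-- The complex vector with the given Eisenstein coordinates. -/
noncomputable def eVec (u : EVector) : Fin 3 → ℂ :=
  ![eisenstein u.1, eisenstein u.2.1, eisenstein u.2.2]

lemma det₃_eVec (u v w : EVector) :
    det₃ (eVec u) (eVec v) (eVec w) = eisenstein (eDet u v w) := by
  rw [det₃_eq]
  simp only [eVec, eDet, eCross, eisenstein_add, eisenstein_mul, eisenstein_sub,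
    Matrix.cons_val]
  ring

/-- The vector with digits given by the base `25` digits of `n`. -/
def eDecode (n : ℕ) : EVector :=
  -- Each base 25 digit consists of two base 5 digits, shifted by 2, so the coefficients of `1` and
  -- `ω` range from -2 to 2.
  let c : ℕ → ℤ × ℤ := fun m =>
    (Int.subNatNat (Nat.mod m 5) 2, Int.subNatNat (Nat.mod (Nat.div m 5) 5) 2)
  (c n, c (Nat.div n 25), c (Nat.div n 625))

/-- Apply a predicate to the entries of a list of length two. -/
def onPair (f : ℕ → ℕ → Bool) : List ℕ → Bool
  | [i, j] => f i j
  | _ => false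

/-- Apply a predicate to the entries of a list of length three. -/
def onTriple (f : ℕ → ℕ → ℕ → Bool) : List ℕ → Bool
  | [i, j, k] => f i j k
  | _ => false

/-- The vector with number `i` in a list of encoded vectors. -/
def vecAt (l : List ℕ) (i : ℕ) : EVector := eDecode (l.getD i 0)

/-- Test whether two vectors are linearly independent. -/
noncomputable def distinctTest (u v : EVector) : Bool :=
  not (and (eIsZero (eCross u v).1) (and (eIsZero (eCross u v).2.1) (eIsZero (eCross u v).2.2)))

/-- Test whether the points with the given coordinates are distinct and realize the triples in the
code `s`. -/
noncomputable def coordTest (s : ℕ) (l : List ℕ) : Bool :=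
  and (allSub 2 labels (onPair fun i j => distinctTest (vecAt l i) (vecAt l j)))
    (allSub 3 labels (onTriple fun i j k =>
      cond (bit s (pows [i, j, k])) (eIsZero (eDet (vecAt l i) (vecAt l j) (vecAt l k)))
        (not (eIsZero (eDet (vecAt l i) (vecAt l j) (vecAt l k))))))

/-- If `a • u = b • v`, then both `a` and `b` annihilate the cross product of `u` and `v`, so it
vanishes as soon as one of them is nonzero. -/
lemma smul_ne_smul_of_distinctTest {u v : EVector} (h : distinctTest u v = true) {a b : ℂ}
    (hab : a ≠ 0 ∨ b ≠ 0) : a • eVec u ≠ b • eVec v := by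
  intro hc
  have h0 : a * eisenstein u.1 = b * eisenstein v.1 := congrFun hc 0
  have h1 : a * eisenstein u.2.1 = b * eisenstein v.2.1 := congrFun hc 1
  have h2 : a * eisenstein u.2.2 = b * eisenstein v.2.2 := congrFun hc 2
  have key : ∀ z : ℂ, a * z = 0 → b * z = 0 → z = 0 := by
    intro z ha hb
    rcases hab with h | h
    · exact (mul_eq_zero.1 ha).resolve_left h
    · exact (mul_eq_zero.1 hb).resolve_left h
  refine absurd h ?_
  rw [distinctTest, Bool.not_eq_true', Bool.not_eq_false, Bool.and_eq_true, Bool.and_eq_true,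
    eIsZero_iff, eIsZero_iff, eIsZero_iff]
  simp only [eCross, eisenstein_sub, eisenstein_mul]
  refine ⟨key _ ?_ ?_, key _ ?_ ?_, key _ ?_ ?_⟩
  · linear_combination eisenstein v.2.2 * h1 - eisenstein v.2.1 * h2
  · linear_combination eisenstein u.2.2 * h1 - eisenstein u.2.1 * h2
  · linear_combination eisenstein v.1 * h2 - eisenstein v.2.2 * h0
  · linear_combination eisenstein u.1 * h2 - eisenstein u.2.2 * h0
  · linear_combination eisenstein v.2.1 * h0 - eisenstein v.1 * h1
  · linear_combination eisenstein u.2.1 * h0 - eisenstein u.1 * h1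

theorem isMatroidal_of_coordTest {s : ℕ} {l : List ℕ} (h : coordTest s l = true) :
    (decode s).IsMatroidal := by
  rw [coordTest, Bool.and_eq_true, allSub_iff, allSub_iff] at h
  obtain ⟨h₁, h₂⟩ := h
  set v : Fin 8 → Fin 3 → ℂ := fun i => eVec (vecAt l i) with hv
  have hne : ∀ i j : Fin 8, i ≠ j → ∀ a b : ℂ, a ≠ 0 → a • v i ≠ b • v j := by
    have hsub : ∀ i j : Fin 8, i < j → [(i : ℕ), j].Sublist labels := by decide
    intro i j hij a b ha
    rcases lt_or_gt_of_ne hij with hlt | hlt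
    · exact smul_ne_smul_of_distinctTest (h₁ [(i : ℕ), j] (hsub i j hlt) rfl) (Or.inl ha)
    · exact (smul_ne_smul_of_distinctTest (h₁ [(j : ℕ), i] (hsub j i hlt) rfl) (Or.inr ha)).symm
  -- A zero vector would be a multiple of its neighbour `v (i + 1)`, with `i + 1` taken modulo 8; so
  -- the test of distinctness also excludes zero vectors.
  have hv0 : ∀ i, v i ≠ 0 := by
    intro i hi
    have hs : ∀ i : Fin 8, i ≠ i + 1 := by decide
    exact hne i (i + 1) (hs i) 1 0 one_ne_zero (by rw [hi, smul_zero, zero_smul])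
  refine isMatroidal_iff.2 ⟨fun i => Projectivization.mk ℂ (v i) (hv0 i), fun i j hij => ?_,
    fun S hS => ?_⟩
  · by_contra h
    obtain ⟨a, ha⟩ := (Projectivization.mk_eq_mk_iff' ℂ _ _ (hv0 i) (hv0 j)).1 hij
    exact hne i j h 1 a one_ne_zero (by rw [one_smul, ha])
  · obtain ⟨m, hm, hn, rfl⟩ := exists_sublist_labels S (fun _ => true) (by simp)
    rw [List.toFinset_card_of_nodup hn] at hS
    obtain ⟨i, j, k, rfl⟩ := List.length_eq_three.1 hS
    rw [List.filter_true] at hm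
    have := h₂ _ hm rfl
    have hmask := pows_eq_mask hn
    simp only [List.map_cons, List.map_nil, onTriple] at this hmask
    have hset : [i, j, k].toFinset = {i, j, k} := by simp
    -- The representative chosen by `rep` is a nonzero multiple of `v i`, which does not affect the
    -- vanishing of determinants.
    have hscale : ∀ i, ∃ a : ℂ, a ≠ 0 ∧
        (Projectivization.mk ℂ (v i) (hv0 i)).rep = a • v i := by
      intro i
      obtain ⟨a, ha⟩ := Projectivization.exists_smul_eq_mk_rep ℂ (v i) (hv0 i)
      exact ⟨a, a.ne_zero, ha.symm⟩
    obtain ⟨a, ha, hai⟩ := hscale i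
    obtain ⟨b, hb, hbj⟩ := hscale j
    obtain ⟨c, hc, hck⟩ := hscale k
    have hdet : det₃ (a • v i) (b • v j) (c • v k) = a * b * c * det₃ (v i) (v j) (v k) := by
      simp only [det₃_eq, Pi.smul_apply, smul_eq_mul]
      ring
    rw [mem_decode_fst, List.toFinset_card_of_nodup hn, and_iff_right hS, ← hmask, hset,
      onLine_triple_iff, hai, hbj, hck, hdet, mul_eq_zero,
      or_iff_right (mul_ne_zero (mul_ne_zero ha hb) hc), hv, det₃_eVec, ← eIsZero_iff]
    cases hbit : bit s (pows [(i : ℕ), j, k]) <;> rw [hbit] at this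
    · simpa using this
    · simpa using this

/-! ### Data -/

/-- The lines, the numbers of labellings and the chains of stabilizers of the linear spaces on
five points. -/
def fiveData : List (List ℕ × ℕ × List (List ℕ)) :=
  [([], 1, [[16388, 20492, 24708, 29316], [576, 1035, 1539], [130, 202], [9]]), ([28], 10,
  [[24960, 29568], [576], [], [9]]), ([22, 25], 15, [[], [585, 1098, 1539], [216], []]), ([30], 5,
  [[20520, 24808, 29416], [576, 1040], [216], []]), ([31], 1, [[16388, 20492, 24708, 29316], [576,
  1035, 1539], [130, 202], [9]])]

/-- The certificates for the linear spaces on five points. -/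
def fiveCerts : List (List ℕ) :=
  [[0, 16777216, 16777369, 16777346, 16778256, 33554432, 16778251, 33554441, 16778386, 33554562,
  16793641, 33574403, 50331648, 33571715, 33571563, 16793604, 33574417, 33571729, 50331657,
  33571540, 16793820, 33574466, 33571433, 33571396, 50331778, 16794644, 33571202, 33570857,
  33570820, 50333187, 50348036, 67108864]]

/-- The lines, the numbers of labellings and the chains of stabilizers of the linear spaces on
six points. -/
def sixData : List (List ℕ × ℕ × List (List ℕ)) :=
  [([], 1, [[36864, 131085, 163845, 197253, 229509], [16388, 20492, 24708, 29316], [576, 1035,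
  1539], [130, 202], [9]]), ([56], 20, [[36864, 199680], [32256], [], [130, 202], [9]]), ([44,
  50], 90, [[], [20520, 26000, 30104], [576], [], []]), ([60], 15, [[36864, 197568, 229824],
  [24960, 29568], [576], [], [9]]), ([28, 42, 49], 120, [[37080, 199810], [32265], [], [], []]),
  ([28, 35], 10, [[38034, 131085, 163845, 201884, 234644], [24960, 29568], [576], [], [9]]), ([35,
  60], 60, [[], [24960, 29568], [576], [], [9]]), ([22, 25, 37, 42], 30, [[36873, 147492, 184365,
  222372, 259245], [], [585, 1170, 1755], [], []]), ([62], 6, [[36864, 131104, 197344, 229600],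
  [20520, 24808, 29416], [576, 1040], [216], []]), ([63], 1, [[36864, 131085, 163845, 197253,
  229509], [16388, 20492, 24708, 29316], [576, 1035, 1539], [130, 202], [9]])]

/-- The certificates for the linear spaces on six points. -/
def sixCerts : List (List ℕ) :=
  [[0, 16777216, 16777792, 16777873, 16777859, 16793986, 33554432, 33554441, 16793641, 33554648,
  33554585, 16793604, 33554634, 33554562, 16794217, 33555472, 33555985, 33571050, 16794180,
  33555467, 33555971, 33571036, 16794324, 33555602, 33556178, 33570820], [16908746, 33591296,
  33591305, 50331648, 33614912, 67108864, 33614921, 67108873, 33612224, 67109440, 67133833,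
  33612233, 67109449, 67133824, 83886080, 100663296], [33722602, 67240394, 67240098, 100700290,
  100701200, 67240907, 117440512, 67240611, 117440728], [50462752, 100798504, 100797456,
  134217728, 100794840, 100794400], [134381573, 150994944]]

/-- The lines, the numbers of labellings and the chains of stabilizers of the linear spaces on
seven points. -/
def sevenData : List (List ℕ × ℕ × List (List ℕ)) :=
  [([], 1, [[532480, 827392, 1048710, 1311366, 1572870, 1835022], [36864, 131085, 163845, 197253,
  229509], [16388, 20492, 24708, 29316], [576, 1035, 1539], [130, 202], [9]]), ([112], 35,
  [[532480, 827392], [36864], [], [576, 1035, 1539], [130, 202], [9]]), ([88, 100], 315, [[],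
  [37440, 201600, 229824], [32256], [], [], [9]]), ([76, 82, 97], 105, [[], [36873, 135180,
  163845, 198594, 231363], [20520, 26000, 30104], [576], [], []]), ([120], 35, [[532480, 827392,
  1313280], [36864, 199680], [32256], [], [130, 202], [9]]), ([56, 84, 98], 840, [[533520,
  828112], [37080], [], [], [], []]), ([56, 76, 82, 97], 840, [[], [36873, 199810], [32472], [],
  [], []]), ([56, 70], 70, [[643680, 905832, 1048824, 1430432, 1835064], [36864, 199680], [32256],
  [], [216], []]), ([56, 70, 97], 630, [[905832], [], [32256], [], [216], []]), ([70, 120], 420,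
  [[], [36864, 199680], [32256], [], [216], []]), ([50, 81, 108], 1260, [[884745], [], [], [576],
  [], []]), ([44, 50, 74, 84], 210, [[727768, 884952, 1179936, 1350144, 2064888], [], [21096,
  26000, 32472], [], [], []]), ([44, 50, 74, 84, 97], 630, [[884952], [], [21096, 26000, 32472],
  [], [], []]), ([44, 50, 74, 81], 1260, [[732160, 917122, 1350274], [], [], [], [], []]), ([124],
  21, [[532480, 827392, 1048832, 1311488], [36864, 197568, 229824], [24960, 29568], [576], [],
  [9]]), ([60, 67], 35, [[1572870, 1835022], [36864, 197568, 229824], [24960, 29568], [576], [],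
  [9]]), ([67, 124], 105, [[], [36864, 197568, 229824], [24960, 29568], [576], [], [9]]), ([28,
  42, 49, 73, 82, 100], 210, [[532610, 827545, 1313496], [37080, 199810], [32265], [], [], []]),
  ([28, 42, 70, 113], 840, [[533520, 828112], [37080], [], [], [], []]), ([28, 42, 49, 70, 73],
  420, [[643530, 909705, 1065220, 1728934, 1884445], [37080], [], [], [], []]), ([92, 99], 70,
  [[], [38034, 131085, 163845, 201884, 234644], [24960, 29568], [576], [], [9]]), ([22, 25, 37,
  42, 67, 76, 112], 30, [[532610, 827594, 1065220, 1331980, 1597830, 1864590], [36873, 147492,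
  184365, 222372, 259245], [], [585, 1170, 1755], [], []]), ([126], 7, [[532480, 827392, 1048824,
  1311480, 1835064], [36864, 131104, 197344, 229600], [20520, 24808, 29416], [576, 1040], [216],
  []]), ([127], 1, [[532480, 827392, 1048710, 1311366, 1572870, 1835022], [36864, 131085, 163845,
  197253, 229509], [16388, 20492, 24708, 29316], [576, 1035, 1539], [130, 202], [9]])]

/-- The certificates for the linear spaces on seven points. -/
def sevenCerts : List (List ℕ) :=
  [[0, 16777216, 16797187, 16793986, 16793641, 16793604, 16911371, 33554432, 33554585, 33554562,
  16908746, 33555008, 33555544, 33555530, 16908320, 33555089, 33555472, 33555602, 16908301,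
  33555075, 33555467, 33555611, 16928146, 33579392, 33571225, 33571202, 33686480, 50331648,
  33686475, 50331657, 16927787, 33579177, 33570857, 33571050, 33686112, 50331864, 33686179,
  50331801, 16927764, 33579140, 33570820, 33571036, 33686093, 50331850, 33686165, 50331778,
  16925090, 33580136, 33571433, 33571946, 33685536, 50332688, 33687075, 50333201, 33701924,
  50348266, 16925085, 33580108, 33571396, 33571932, 33685517, 50332683, 33687061, 50333187,
  33701933, 50348252, 16924708, 33580180, 33571540, 33571860, 33685661, 50332818, 33687133,
  50333394, 33702301, 50348036], [17828416, 34181696, 34181777, 34181763, 67108864, 34087488,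
  83886080, 83886089, 34087569, 83886296, 83886233, 34087555, 83886282, 83886210, 34105920,
  83918336, 83918345, 84085976, 100663296, 84085962, 100663305, 34106001, 83918552, 83918489,
  84085760, 100663512, 84085890, 100663449, 34105987, 83918538, 83918466, 84085769, 100663498,
  84085913, 100663426, 117440512, 134217728, 150994944, 134254592, 134282240, 117440521,
  134217737, 150994953, 134254601, 134282249, 117440642, 134217858, 150995074, 134254722,
  134282370], [35226577, 50958345, 84937424, 101289993, 84935952, 101290569, 151622352, 134845131,
  151638488, 167772160, 84958840, 101302305, 184549376, 201326592, 218103808, 134864027,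
  218136280, 167800528, 84955576, 101302881, 184549952, 201327168, 218104384, 218132176,
  134862811, 218133912, 167798160, 218129808, 134857443, 218124328, 218124904, 167792680],
  [68157696, 152142272, 152142281, 152052096, 168304649, 152052105, 168304640, 234881024,
  152046144, 168323657, 168499721, 152046153, 168323648, 168499712, 152043776, 168321289,
  168497929, 168520640, 152043785, 168321280, 168497920, 168520649, 251658240, 268435456],
  [85461507, 101813321, 101723856, 201859288, 168832643, 168860233, 168823441, 101714635,
  201882314, 202054274, 285212672, 219194464, 301989888, 318767104, 219208269, 318799369,
  302022153, 219286165, 318966914, 302189698], [119022292, 135799508, 135813652, 135811860,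
  135832291, 219950738, 219948946, 135832277, 219950747, 219948955, 252284928, 135846435,
  219941522, 219958162, 220106812, 320086760, 135846421, 219941531, 219958171, 220106798,
  320086732, 135844643, 219940626, 219959058, 220107388, 320087080, 220127726, 320099084,
  135844629, 219940635, 219959067, 220107374, 320087052, 220127740, 320099112, 252191890,
  335544320], [152666562, 169353257, 169353220, 269062144, 169372265, 303041155, 169372228,
  303041169, 169369897, 303040259, 303057809, 169369860, 303040273, 303057795, 336172178],
  [186130841, 202908057, 202963929, 286269824, 303589993, 303696477, 303694114, 303587588,
  202961661, 286270612, 286409126, 352321536], [236453945, 270106657, 270016553, 270010897,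
  369098752, 270008601, 270008377], [370671622, 385875968]]

/-- The lines, the numbers of labellings and the chains of stabilizers of the linear spaces on
eight points that do not contain a Fano plane. -/
def eightData : List (List ℕ × ℕ × List (List ℕ)) :=
  [([], 1, [[2359296, 4239360, 6303744, 8389255, 10485895, 12582927, 14680071], [532480, 827392,
  1048710, 1311366, 1572870, 1835022], [36864, 131085, 163845, 197253, 229509], [16388, 20492,
  24708, 29316], [576, 1035, 1539], [130, 202], [9]]), ([224], 56, [[2359296, 4259840], [884736],
  [], [16388, 20492, 24708, 29316], [576, 1035, 1539], [130, 202], [9]]), ([176, 200], 840, [[],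
  [654336, 916992, 1313280], [36864], [], [], [130, 202], [9]]), ([152, 164, 194], 840, [[],
  [533520, 828504, 1090656, 1319976, 1835064], [37440, 201600, 229824], [32256], [], [], []]),
  ([240], 70, [[2359296, 4239360, 6303744], [532480, 827392], [36864], [], [576, 1035, 1539],
  [130, 202], [9]]), ([112, 168, 196], 3360, [[2391552, 4284800], [885312], [], [], [], [], [9]]),
  ([112, 152, 164, 194], 6720, [[], [533520, 828504], [37440], [], [], [], []]), ([112, 140], 280,
  [[2583936, 4680576, 6777792, 8389440, 10486080], [532480, 827392], [36864], [], [576], [],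
  [9]]), ([112, 140, 194], 5040, [[2583936], [], [36864], [], [576], [], []]), ([140, 240], 1680,
  [[], [532480, 827392], [36864], [], [576], [], [9]]), ([112, 140, 162, 193], 10080, [[],
  [884745], [], [], [576], [], []]), ([112, 134, 137], 840, [[], [532480, 827392], [36864], [],
  [585, 1098, 1539], [216], []]), ([134, 137, 240], 840, [[], [532480, 827392], [36864], [], [585,
  1098, 1539], [216], []]), ([100, 162, 216], 10080, [[2359512], [], [], [32256], [], [], []]),
  ([88, 100, 148, 168], 840, [[2359872, 4792320, 7152192, 9439488, 11799360], [], [37440, 224640,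
  262080], [], [], [], [9]]), ([88, 100, 148, 168, 194], 5040, [[2359872], [], [37440, 224640,
  262080], [], [], [], []]), ([88, 100, 148, 162], 10080, [[2397200, 4792320, 7189520], [], [],
  [], [], [], []]), ([88, 100, 148, 162, 193], 20160, [[2397200], [], [], [], [], [], []]), ([88,
  100, 146, 161], 5040, [[2360466, 4792536, 7152273], [], [37449], [], [], [], []]), ([88, 100,
  140, 146, 161], 20160, [[], [], [37449], [], [], [], []]), ([88, 100, 138, 145], 10080, [[], [],
  [229824], [32265], [], [], []]), ([88, 138, 145, 228], 10080, [[], [], [229824], [32265], [],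
  [], []]), ([88, 131, 228], 2520, [[2376724], [], [229824], [32256], [], [], [9]]), ([88, 100,
  131, 148, 168], 5040, [[], [], [37440, 224640, 262080], [], [], [], [9]]), ([82, 97, 145, 162,
  204], 2520, [[2359305], [], [36873, 147492, 184365], [], [576], [], []]), ([76, 82, 97, 138,
  145, 164], 3360, [[2391682], [], [64665, 148068, 189845, 204490, 251883], [], [], [], []]),
  ([248], 56, [[2359296, 4239360, 6303744, 8390656], [532480, 827392, 1313280], [36864, 199680],
  [32256], [], [130, 202], [9]]), ([120, 148, 162, 193], 6720, [[], [532610, 827545], [37080], [],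
  [], [], []]), ([120, 134], 280, [[10486000, 12582960], [532480, 827392, 1313280], [36864,
  199680], [32256], [], [216], []]), ([120, 134, 193], 3360, [[], [], [36864, 199680], [32256],
  [], [216], []]), ([134, 248], 840, [[], [532480, 827392, 1313280], [36864, 199680], [32256], [],
  [216], []]), ([56, 84, 98, 146, 164, 200], 1680, [[2359512, 4240472, 6304320], [533520, 828112],
  [37080], [], [], [], []]), ([56, 84, 98, 146, 164, 193], 5040, [[2359512, 4793859, 7153371], [],
  [37080], [], [], [], []]), ([56, 84, 140, 226], 6720, [[2391552, 4284800], [885312], [], [], [],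
  [], []]), ([56, 84, 98, 140, 146], 3360, [[2559192, 4688592, 8521760, 11405432, 13831472],
  [885312], [], [], [], [], []]), ([56, 84, 98, 140, 146, 193], 20160, [[2559192], [], [], [], [],
  [], []]), ([56, 84, 98, 140, 145], 20160, [[], [885312], [], [], [], [], []]), ([56, 84, 140,
  145, 226], 20160, [[], [885312], [], [], [], [], []]), ([56, 84, 137, 226], 20160, [[2391682],
  [], [], [], [], [], []]), ([56, 84, 98, 137, 146, 164], 20160, [[], [], [37080], [], [], [],
  []]), ([56, 84, 98, 134, 137], 10080, [[8546720], [], [37080], [], [], [], []]), ([56, 82, 97,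
  145, 162, 204], 10080, [[2359305], [], [36873], [], [], [], []]), ([56, 76, 82, 97, 138, 145,
  164], 6720, [[2391682], [], [64665, 204490], [], [], [], []]), ([56, 76, 82, 134, 225], 10080,
  [[4280936], [], [], [32472], [], [], []]), ([76, 82, 97, 134, 184], 20160, [[], [], [], [32472],
  [], [], []]), ([56, 76, 82, 97, 134, 145], 20160, [[11020099], [], [], [], [], [], []]), ([184,
  198], 560, [[], [643680, 905832, 1048824, 1430432, 1835064], [36864, 199680], [32256], [],
  [216], []]), ([97, 184, 198], 5040, [[], [905832], [], [32256], [], [216], []]), ([56, 97, 145,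
  198], 10080, [[2396160], [], [], [], [], [216], []]), ([70, 133, 248], 3360, [[2359305], [],
  [36864, 199680], [32256], [], [], []]), ([50, 81, 108, 138, 148, 161], 20160, [[7617033], [],
  [], [], [], [], []]), ([50, 108, 138, 209], 10080, [[4292226, 6503424, 8427650], [], [], [], [],
  [], []]), ([50, 81, 108, 134, 137], 5040, [[7552265, 12799028, 15719028], [885321], [], [], [],
  [], []]), ([50, 81, 108, 131, 152], 6720, [[12782640, 15665713], [884745], [], [], [], [], []]),
  ([50, 81, 131, 236], 3360, [[2379816, 4276228], [884745], [], [], [576], [], []]), ([44, 50, 74,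
  84, 134, 152, 193], 5040, [[2359872], [], [], [21096, 26000, 32472], [], [], []]), ([44, 50, 74,
  84, 97, 134, 145], 10080, [[15860007], [884952], [], [], [], [], []]), ([252], 28, [[2359296,
  4239360, 6303744, 8389440, 10486080], [532480, 827392, 1048832, 1311488], [36864, 197568,
  229824], [24960, 29568], [576], [], [9]]), ([124, 131], 56, [[12582927, 14680071], [532480,
  827392, 1048832, 1311488], [36864, 197568, 229824], [24960, 29568], [576], [], [9]]), ([131,
  252], 168, [[], [532480, 827392, 1048832, 1311488], [36864, 197568, 229824], [24960, 29568],
  [576], [], [9]]), ([60, 195], 35, [[2359296, 4793490, 7152786, 8987805, 11084949, 12582927,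
  14680071], [1572870, 1835022], [36864, 197568, 229824], [24960, 29568], [576], [], [9]]), ([188,
  195], 280, [[], [1572870, 1835022], [36864, 197568, 229824], [24960, 29568], [576], [], [9]]),
  ([28, 42, 73, 82, 100, 134, 177], 5040, [[15729943], [1313496], [37080], [], [], [], []]), ([28,
  42, 113, 137, 198], 3360, [[4284809, 6377930, 10502468, 12632413, 14836135], [], [37080], [],
  [], [], []]), ([28, 42, 49, 70, 73, 133, 146, 224], 840, [[2391561, 4260425, 6716061, 8554717,
  10620055, 12814323, 14878050], [663714, 909705, 1216764, 1823214, 1884445], [], [], [], [],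
  []]), ([254], 8, [[2359296, 4239360, 6303744, 8389360, 10486000, 12582960], [532480, 827392,
  1048824, 1311480, 1835064], [36864, 131104, 197344, 229600], [20520, 24808, 29416], [576, 1040],
  [216], []]), ([255], 1, [[2359296, 4239360, 6303744, 8389255, 10485895, 12582927, 14680071],
  [532480, 827392, 1048710, 1311366, 1572870, 1835022], [36864, 131085, 163845, 197253, 229509],
  [16388, 20492, 24708, 29316], [576, 1035, 1539], [130, 202], [9]])]

/-- The certificates for the linear spaces on eight points. -/
def eightCerts : List (List ℕ) :=
  [[0, 16777216, 16814080, 16829443, 16826818, 16826401, 16826373, 17309696, 33554432, 33555008,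
  33555089, 33555075, 17320451, 33586688, 33574466, 33574417, 33574403, 17318146, 33584000,
  33571202, 33571729, 33571715, 17317945, 33583785, 33570857, 33571433, 33571563, 17317894,
  33583748, 33570820, 33571396, 33571540, 17439243, 33754112, 33688650, 33688592, 33688587,
  34611584, 50331648, 50331657, 34611369, 50331864, 50331801, 34611332, 50331850, 50331778,
  17436938, 33752000, 33685962, 33686480, 33686475, 34614848, 50332224, 50332233, 34612328,
  50332760, 50333273, 34612300, 50332746, 50333250, 17436728, 33751713, 33685536, 33686112,
  33686179, 34614929, 50332368, 50332305, 34612624, 50332688, 50333201, 34612372, 50332818,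
  50333394, 17436686, 33751685, 33685517, 33686093, 33686165, 34614915, 50332363, 50332291,
  34612619, 50332683, 50333187, 34612395, 50332827, 50333403, 17451986, 33770882, 33717642,
  33705362, 33705371, 34603264, 50356608, 50356617, 34619689, 50352536, 50348441, 34619652,
  50352522, 50348418, 34734368, 50463696, 50496465, 51905810, 34734349, 50463691, 50496451,
  51905819, 17451555, 33770537, 33717288, 33705066, 33705003, 34603193, 50356456, 50356393,
  34619833, 50352168, 50348073, 34619644, 50352298, 50348266, 34734584, 50463328, 50496097,
  51905658, 34734269, 50463395, 50496227, 51905595, 17451541, 33770500, 33717260, 33705052,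
  33704980, 34603142, 50356428, 50356356, 34619782, 50352140, 50348036, 34619630, 50352284,
  50348252, 34734542, 50463309, 50496069, 51905630, 34734246, 50463381, 50496213, 51905558,
  17449250, 33768353, 33715104, 33702306, 33702819, 34604152, 50357352, 50357865, 34623097,
  50352744, 50348649, 34620540, 50353770, 50349162, 34737272, 50462752, 50495521, 51904762,
  34735741, 50464291, 50496547, 51905275, 34750886, 50479140, 50516004, 51929340, 17449245,
  33768325, 33715085, 33702301, 33702805, 34604110, 50357324, 50357828, 34623046, 50352716,
  50348612, 34620526, 50353756, 50349148, 34737230, 50462733, 50495493, 51904734, 34735718,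
  50464277, 50496533, 51905238, 34750909, 50479149, 50516013, 51929326, 17448998, 33768164,
  33714852, 33701924, 33702500, 34604182, 50357396, 50357972, 34623190, 50352788, 50348756,
  34620822, 50353684, 50349076, 34737302, 50462877, 50495709, 51904518, 34736086, 50464349,
  50496605, 51905094, 34750756, 50479517, 50516381, 51929478], [23080960, 35913728, 35914304,
  35914385, 35914371, 67108864, 36245504, 83886080, 83886233, 83886210, 36246080, 83886656,
  83887192, 83887178, 36246161, 83886737, 83887120, 83887250, 36246147, 83886723, 83887115,
  83887259, 36188160, 83922944, 83923097, 83923074, 84419136, 100663296, 100663305, 84419217,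
  100663512, 100663449, 84419203, 100663498, 100663426, 36188736, 83923520, 83924056, 83924042,
  84418560, 100663872, 100663881, 84419600, 100664408, 100664921, 84419595, 100664394, 100664898,
  36188817, 83923601, 83923984, 83924114, 84418713, 100664016, 100663953, 84419672, 100664336,
  100664849, 84419739, 100664466, 100665042, 36188803, 83923587, 83923979, 83924123, 84418690,
  100664011, 100663939, 84419658, 100664331, 100664835, 84419730, 100664475, 100665051, 117440512,
  134217728, 134217737, 150994944, 134844416, 167772160, 134844425, 167772169, 134750208,
  167809024, 168304649, 134750217, 167809033, 168304640, 117440665, 134217944, 134217881,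
  150995097, 134844632, 167772376, 134844569, 167772313, 134750424, 167809240, 168304793,
  134750361, 167809177, 168304856, 117440642, 134217930, 134217858, 150995074, 134844618,
  167772362, 134844546, 167772290, 134750410, 167809226, 168304770, 134750338, 167809154,
  168304842, 117441552, 134218768, 134219281, 150995984, 134845456, 167773200, 134845969,
  167773713, 134751248, 167810064, 168306193, 134751761, 167810577, 168305680, 184549376,
  201326592, 117441547, 134218763, 134219267, 150995979, 134845451, 167773195, 134845955,
  167773699, 134751243, 167810059, 168306179, 134751747, 167810563, 168305675, 184549385,
  201326601, 117441682, 134218898, 134219474, 150996114, 134845586, 167773330, 134846162,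
  167773906, 134751378, 167810194, 168306386, 134751954, 167810770, 168305810, 184549506,
  201326722], [44310912, 52690944, 52690953, 90448448, 103022592, 103022601, 90466880, 103054848,
  103054857, 153379200, 138797288, 170156264, 138797260, 170156236, 153553920, 218103808,
  218103817, 90645440, 103224192, 103224201, 234881024, 251658240, 251658249, 268435456,
  285212672, 268435465, 285212681, 138880040, 170333224, 268472896, 285250112, 218141248,
  301989888, 138880012, 170333196, 268472905, 285250121, 218141257, 301989897, 90663872,
  103247232, 103247241, 234913280, 251690496, 251690505, 268467712, 285244928, 268467721,
  285244937, 268637056, 285414272, 318767104, 268637065, 285414281, 318767113, 138893864,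
  170351656, 268495936, 285273152, 218164288, 302022144, 268660096, 285437312, 318799360,
  335544320, 352321536, 138893836, 170351628, 268495945, 285273161, 218164297, 302022153,
  268660105, 285437321, 318799369, 335544329, 352321545, 138830120, 170287592, 268665280,
  285442496, 268697536, 285474752, 335581760, 218333632, 352358976, 302191488, 318968704,
  302214528, 318991744, 138830092, 170287564, 268665289, 285442505, 268697545, 285474761,
  335581769, 218333641, 352358985, 302191497, 318968713, 302214537, 318991753, 187056164,
  337966237, 337957021, 369098752, 369136192, 338036317, 385875968, 338054749, 385908224],
  [65275154, 174333961, 174353041, 174352145, 174342201, 203702996, 174529154, 321126400,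
  321158872, 354681034, 174528258, 321126976, 321156504, 354681930, 203817122, 354717912,
  354718808, 174465037, 321330890, 321328522, 388236443, 203836818, 354743232, 354735056,
  354812875, 402653184, 174542074, 321154768, 321146920, 354697450, 388369496, 402852994,
  321289372, 419430400, 174484117, 321326210, 388255235, 321346730, 321261580, 419462872,
  354819739, 402681552, 174540282, 321152400, 321147496, 354698346, 388366808, 402851778,
  321288156, 419430976, 321273892, 419458768, 174483221, 321324994, 388252547, 321345514,
  321262156, 419460504, 354817947, 402679184, 321274468, 419456400, 174473277, 388261035,
  321343202, 321340834, 321285268, 419450920, 321284052, 419451496, 354829291, 402673704],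
  [75499520, 159648256, 159648409, 159648386, 159452160, 222363864, 222363850, 159452313,
  222363648, 222363778, 159452290, 222363657, 222363801, 436207616, 159399424, 222343384,
  222343370, 222896128, 452984832, 222896137, 452984841, 159399577, 222343168, 222343298,
  222896344, 452985048, 222896281, 452984985, 159399554, 222343177, 222343321, 222896330,
  452985034, 222896258, 452984962, 159385600, 222361816, 222361802, 222919168, 453017088,
  222919177, 453017097, 223029464, 453184728, 454298265, 223029450, 453184714, 454298242,
  159385753, 222361600, 222361730, 222919384, 453017304, 222919321, 453017241, 223029248,
  453184512, 454298121, 223029378, 453184642, 454298314, 159385730, 222361609, 222361753,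
  222919370, 453017290, 222919298, 453017218, 223029257, 453184521, 454298112, 223029401,
  453184665, 454298328, 469762048, 486539264, 487165952, 503316480, 487071744, 487094784,
  469762057, 486539273, 487165961, 503316489, 487071753, 487094793, 469762178, 486539394,
  487166082, 503316610, 487071874, 487094914], [96481320, 109326040, 176434818, 109122432,
  255918656, 289767433, 224465936, 176231818, 289473097, 225255424, 455344128, 224408664,
  455677016, 109064936, 255898320, 289710233, 256451672, 520093696, 536870912, 290006617,
  537498712, 176174250, 289452689, 290043409, 537404432, 455619600, 277113728, 323287552,
  553648128, 323580672, 570425344, 587202560, 588087872, 603979776, 620756992, 277322472,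
  323422936, 570462424, 587239640, 604016856, 553685208, 620794072, 323695352, 588030672,
  340064970, 606403593, 637534208, 637571288, 606538905, 654311424, 277886392, 570958864,
  604513296, 324338968, 587830360, 554181648, 621290512, 324318264, 587736080, 671088640,
  340358410, 606696393, 638419520, 638162008, 607455193, 654939224, 671716440, 340473018,
  606810785, 607434273, 654844944, 638067728, 638362320, 671622160], [115608274, 293966720,
  293989608, 356876490, 461638297, 293872521, 591757888, 623116297, 356819160, 623153152,
  294104268, 591700553, 656670850, 356841984, 623181016, 623316170, 687865856, 293890729,
  591785680, 623148697, 656870400, 688065666, 591891075, 704643072, 294099588, 656703178,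
  591719057, 591900363, 704675544, 623320706, 687898328, 617177592, 721420288, 738197504,
  754974720, 755007192, 617296653, 755011593, 738234377, 721457161, 755179210, 617310397,
  755039385, 738262169, 755174530, 721484953], [130113952, 146891168, 147010464, 147024288,
  193202688, 147415328, 278992272, 279010704, 342200896, 147415544, 278991976, 279010408,
  342201040, 193024928, 341931040, 341921824, 472121344, 488898560, 147534624, 278934928,
  279068048, 342106688, 280245688, 576811968, 610542608, 342717720, 610366400, 147534840,
  278934632, 279067752, 342106832, 280245544, 576811744, 610542680, 342717496, 610366176,
  193082272, 342045728, 341979168, 342832408, 610481088, 342832184, 610480864, 147548448,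
  278944144, 279058832, 342125120, 280254904, 576807360, 610556432, 342708504, 610361792,
  280369592, 576958912, 610671120, 612196856, 342765848, 610513344, 612315936, 147548664,
  278943848, 279058536, 342125264, 280254760, 576807136, 610556504, 342708280, 610361568,
  280369448, 576958688, 610671192, 612196640, 342765624, 610513120, 612316152, 193096096,
  342054944, 341997600, 342841624, 610494912, 342841400, 610494688, 342784280, 610531776,
  612329760, 342784056, 610531552, 612329976, 472470112, 489247328, 771751936, 489304672,
  489318496, 193989440, 343249728, 343155520, 343173952, 343774032, 611329360, 611343184,
  489685312, 343679824, 611423568, 611457872, 343698256, 611442000, 611462480, 193989360,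
  343249648, 343155440, 343173872, 343773808, 611329136, 611342960, 489685232, 343679600,
  611423344, 611457648, 343698032, 611441776, 611462256], [148988321, 180723216, 180718608,
  180445672, 295769488, 295787920, 180445600, 295769192, 295787624, 373376106, 491094016,
  310649728, 327426944, 328008984, 593589184, 641824665, 310649576, 327426792, 328008760,
  593588960, 641824297, 348173859, 390373506, 612415426, 658809417, 612415202, 658809489,
  310668160, 327445376, 328032024, 593584576, 641810841, 673647832, 723779584, 675786313,
  757370880, 310668008, 327445224, 328031800, 593584352, 641810473, 673647616, 723779800,
  675786385, 757371096, 348178467, 390396546, 612420034, 658827849, 612419810, 658827921,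
  675777097, 757398528, 675777169, 757398744, 490820200, 788529152, 805306368, 805338624,
  348754763, 612996426, 613014858, 390677778, 659126041, 659112217, 806212496, 676427561,
  757687760, 676413737, 757683152, 348754611, 612996274, 613014706, 390677626, 659125817,
  659111993, 806212200, 676427705, 757687392, 676413881, 757682784], [163842576, 209979904,
  228950464, 358978112, 228950240, 358978256, 375755395, 505675776, 228893120, 358883904,
  560210960, 627319824, 644191306, 228892896, 358884048, 560211032, 627319896, 644191378,
  375661187, 644097098, 644097170, 228916160, 358902336, 560224784, 627333648, 644209738,
  560339472, 627448336, 740556800, 644230218, 740593664, 228915936, 358902480, 560224856,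
  627333720, 644209810, 560339544, 627448408, 740557016, 644230290, 740593880, 375679619,
  644110922, 644110994, 644225610, 740621312, 644225682, 740621528, 774111232, 790888448,
  790925312, 790952960, 497025353, 809882507, 822083584, 809902987, 809921419, 497025201,
  809882283, 822083800, 809902763, 809921195], [232853890, 365265872, 364970955, 406913033,
  463486528, 629509336, 629214410, 692125705, 463483264, 629507544, 629212618, 692126281,
  794890960, 795185867, 826368393, 648313576, 728099985, 749512768, 838860800, 855638016,
  648903372, 727805059, 749217865, 839745545, 856522761, 648312104, 728098769, 749510976,
  838861376, 855638592, 872415232, 648901900, 727803843, 749216073, 839746121, 856523337,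
  872415808, 813777645, 889192448, 889193024, 905969664], [247532632, 264309848, 398822416,
  398527576, 264775768, 528550912, 663063768, 662768640, 566432616, 742752832, 566825592,
  742458064, 398998032, 663239384, 566848784, 742478232, 743483456, 566429728, 742772776,
  743155920, 398993496, 663234560, 743160384, 743488208, 264790392, 528569320, 663081888,
  662787048, 529665328, 1124073472, 922746880, 923631832, 663895016, 923479040, 663890336,
  923474648, 399008120, 663245688, 663887736, 923493664, 743503152, 743166256, 399012656,
  663250224, 663883056, 923489272, 743175544, 743494008], [266407001, 411110602, 545328128,
  696323274, 633639696, 633934456, 669530843, 633957648, 841220096, 633662584, 841810136,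
  669526019, 841842176, 841252568, 545346536, 696337898, 927007760, 1140850688, 939524096,
  939556568, 669537147, 939550096, 841246096, 841831312, 669541683, 939545192, 841835624,
  841241192], [283184347, 299961563, 331714968, 331447452, 423722626, 300427483, 547404864,
  597962304, 598542979, 708935298, 332348312, 597736512, 759530048, 650715298, 744559312,
  815840329, 816421067, 857997312, 650315938, 744877201, 745515216, 843120856, 332671132,
  598317187, 759262851, 424360448, 709573120, 745552529, 843447961, 618861417, 665089320,
  763746282, 666254632, 929280448, 941883968, 892171434, 765377514, 942390336, 686429051,
  767620962, 769044322, 946050384, 874804632, 875384988, 619739887, 665669806, 763446317,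
  666835118, 930216069, 942501507, 765077549, 942708867, 891572264], [446693696, 514064640,
  514064649, 513868224, 832635337, 513868233, 832635328, 513814912, 832582025, 833167808,
  513814921, 832582016, 833167817, 956301312, 513804352, 832571465, 833165888, 833103945,
  513804361, 832571456, 833165897, 833103936, 513802560, 832569673, 833163520, 833102153,
  833124608, 513802569, 832569664, 833163529, 833102144, 833124617, 973078528, 989855744],
  [484704514, 501580226, 501490050, 501484098, 501481730, 502366705, 820622051, 820631587,
  820630371, 502366663, 820622037, 820631573, 820630357, 502276529, 820585187, 820652067,
  820650851, 821371620, 895754249, 895754825, 502276487, 820585173, 820652053, 820650837,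
  821371629, 895754240, 895754816, 975437824, 502270577, 820599331, 820656675, 820669283,
  821385764, 895777289, 895773257, 821438509, 895949321, 895982153, 502270535, 820599317,
  820656661, 820669269, 821385773, 895777280, 895773248, 821438500, 895949312, 895982144,
  502268209, 820597539, 820654883, 820668707, 821383972, 895775497, 895770889, 821437293,
  895947529, 895979785, 821455140, 895970240, 896007104, 502268167, 820597525, 820654869,
  820668693, 821383981, 895775488, 895770880, 821437284, 895947520, 895979776, 821455149,
  895970249, 896007113, 1006632960, 1023410176], [518258946, 835027416, 835027402, 834937240,
  912531465, 834937226, 912531456, 992215040, 834931288, 912550473, 912726537, 834931274,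
  912550464, 912726528, 834928920, 912548105, 912724745, 912747456, 834928906, 912548096,
  912724736, 912747465, 1025769472], [534776027, 698420288, 698367633, 698952835, 698886208,
  698948241, 698353795, 938173821, 1040187392, 1040841944, 938169190, 1040814282, 1040219657,
  938107391, 1040720002, 1040387202], [568340521, 635710993, 635507097, 700547018, 635449385,
  700661410, 701835242, 1147155152, 914371754, 866430016, 866487504, 753203717, 851470731,
  851679403, 1042546688, 866169952, 1056964608, 753496837, 852356939, 852596587, 1042879576,
  1057592408, 753611517, 852471475, 852502451, 1042822160, 1057498128], [585203650, 601980866,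
  602095330, 602763011, 715227081, 602914555, 715341473, 948186624, 899952259, 736869329,
  849652800, 736717409, 849710288, 736426501, 849436043, 849493163, 1044774400, 899768272,
  1059323904, 602955606, 716005131, 948002762, 716865535, 1073741824, 851140031, 1044475465,
  603070070, 948059810, 716062395, 716922663, 1073778904, 851082543, 1044627089], [786703060,
  803480276, 803494420, 803492628, 803513059, 868236946, 868235154, 803513045, 868236955,
  868235163, 1027964928, 803527203, 868223122, 868239762, 868388916, 1065366248, 803527189,
  868223131, 868239771, 868388911, 1065366220, 803525411, 868222802, 868241234, 868389492,
  1065366568, 868409839, 1065374540, 803525397, 868222811, 868241243, 868389487, 1065366540,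
  868409844, 1065374568, 1027908754], [1138766044, 1155543260, 1155590609, 1156077690, 1156192350,
  1156190586, 1156075870, 1155588341], [968884272, 1002700856, 1002504224, 1002450984, 1002440720,
  1090519040, 1002439000, 1002438704], [1105199111, 1107296256]]

/-- The linear spaces, the complements of the sextuples, the numbers of labellings and the chains of
stabilizers of the candidate quatroids. -/
def pairData : List (ℕ × List ℕ × ℕ × List (List ℕ)) :=
  [(0, [], 1, [[2359296, 4239360, 6303744, 8389255, 10485895, 12582927, 14680071], [532480,
  827392, 1048710, 1311366, 1572870, 1835022], [36864, 131085, 163845, 197253, 229509], [16388,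
  20492, 24708, 29316], [576, 1035, 1539], [130, 202], [9]]), (0, [192], 28, [[2359296], [],
  [36864, 131085, 163845, 197253, 229509], [16388, 20492, 24708, 29316], [576, 1035, 1539], [130,
  202], [9]]), (0, [129, 130, 132, 136, 144, 160, 192], 8, [[], [532480, 827392, 1048710, 1311366,
  1572870, 1835022], [36864, 131085, 163845, 197253, 229509], [16388, 20492, 24708, 29316], [576,
  1035, 1539], [130, 202], [9]]), (0, [144, 96], 210, [[2396160, 4497408, 6303744], [884736], [],
  [], [576, 1035, 1539], [130, 202], [9]]), (0, [132, 72, 48], 420, [[2359872, 4284800, 6382016,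
  8651520, 10486080], [654336, 916992, 1313280], [36864], [], [], [], [9]]), (0, [129, 66, 36,
  24], 105, [[2359305, 4240962, 6305283, 8402436, 10532421, 12845070, 14680071], [533520, 828504,
  1090656, 1319976, 1835064], [37440, 201600, 229824], [32256], [], [], []]), (0, [3, 5, 9, 17,
  33, 65, 129, 6, 10, 18, 34, 66, 130, 12, 20, 36, 68, 132, 24, 40, 72, 136, 48, 80, 144, 96, 160,
  192], 1, [[2359296, 4239360, 6303744, 8389255, 10485895, 12582927, 14680071], [532480, 827392,
  1048710, 1311366, 1572870, 1835022], [36864, 131085, 163845, 197253, 229509], [16388, 20492,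
  24708, 29316], [576, 1035, 1539], [130, 202], [9]]), (1, [], 56, [[2359296, 4259840], [884736],
  [], [16388, 20492, 24708, 29316], [576, 1035, 1539], [130, 202], [9]]), (1, [192], 168,
  [[2359296], [], [], [16388, 20492, 24708, 29316], [576, 1035, 1539], [130, 202], [9]]), (1,
  [144], 840, [[], [884736], [], [], [576, 1035, 1539], [130, 202], [9]]), (1, [129, 130, 132,
  136, 144, 160, 192], 168, [[], [884736], [], [16388, 20492, 24708, 29316], [576, 1035, 1539],
  [130, 202], [9]]), (1, [144, 96], 840, [[], [884736], [], [], [576, 1035, 1539], [130, 202],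
  [9]]), (1, [136, 80], 3360, [[2391552], [], [], [], [], [130, 202], [9]]), (1, [132, 72, 48],
  3360, [[2359872, 4284800], [916992], [], [], [], [], [9]]), (2, [], 840, [[], [654336, 916992,
  1313280], [36864], [], [], [130, 202], [9]]), (2, [192], 3360, [[], [], [36864], [], [], [130,
  202], [9]]), (2, [132], 2520, [[], [654336, 916992, 1313280], [36864], [], [], [], [9]]), (2,
  [129, 130, 132, 136, 144, 160, 192], 840, [[], [654336, 916992, 1313280], [36864], [], [], [130,
  202], [9]]), (2, [96], 3360, [[], [916992], [], [], [], [130, 202], [9]]), (2, [144, 96], 6720,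
  [[], [], [], [], [], [130, 202], [9]]), (2, [132, 96], 10080, [[], [916992], [], [], [], [],
  [9]]), (2, [40, 80], 1680, [[], [732160, 916992, 1350144], [], [], [], [130, 202], [9]]), (2,
  [132, 40, 80], 5040, [[], [732160, 916992, 1350144], [], [], [], [], [9]]), (3, [], 840, [[],
  [533520, 828504, 1090656, 1319976, 1835064], [37440, 201600, 229824], [32256], [], [], []]), (3,
  [192], 5040, [[], [], [37440, 201600, 229824], [32256], [], [], []]), (3, [129], 840, [[],
  [533520, 828504, 1090656, 1319976, 1835064], [37440, 201600, 229824], [32256], [], [], []]), (3,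
  [129, 130, 132, 136, 144, 160, 192], 840, [[], [533520, 828504, 1090656, 1319976, 1835064],
  [37440, 201600, 229824], [32256], [], [], []]), (4, [], 70, [[2359296, 4239360, 6303744],
  [532480, 827392], [36864], [], [576, 1035, 1539], [130, 202], [9]]), (4, [192], 420, [[2359296],
  [], [36864], [], [576, 1035, 1539], [130, 202], [9]]), (4, [144, 96], 210, [[2396160, 4497408,
  6303744], [884736], [], [], [576, 1035, 1539], [130, 202], [9]]), (5, [], 3360, [[2391552,
  4284800], [885312], [], [], [], [], [9]]), (5, [192], 10080, [[2391552], [], [], [], [], [],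
  [9]]), (5, [144], 10080, [[], [885312], [], [], [], [], [9]]), (5, [144, 96], 10080, [[],
  [885312], [], [], [], [], [9]]), (5, [72, 144], 10080, [[2391552], [], [], [], [], [], [9]]),
  (5, [36, 72, 144], 3360, [[2391552, 4284800], [885312], [], [], [], [], [9]]), (6, [], 6720,
  [[], [533520, 828504], [37440], [], [], [], []]), (6, [192], 20160, [[], [], [37440], [], [],
  [], []]), (7, [], 280, [[2583936, 4680576, 6777792, 8389440, 10486080], [532480, 827392],
  [36864], [], [576], [], [9]]), (7, [192], 2520, [[2583936], [], [36864], [], [576], [], [9]]),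
  (7, [72, 160], 5040, [[2583936, 5598080, 9275392], [], [], [], [], [], [9]]), (7, [68, 40, 144],
  1680, [[2583936, 4717440, 7552256, 8427520, 11018560], [885312], [], [], [], [], [9]]), (8, [],
  5040, [[2583936], [], [36864], [], [576], [], []]), (8, [192], 5040, [[2583936], [], [36864],
  [], [576], [], []]), (8, [160], 20160, [[], [], [], [], [576], [], []]), (8, [72, 160], 20160,
  [[2583936], [], [], [], [], [], []]), (9, [], 1680, [[], [532480, 827392], [36864], [], [576],
  [], [9]]), (9, [192], 5040, [[], [], [36864], [], [576], [], [9]]), (10, [], 10080, [[],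
  [884745], [], [], [576], [], []]), (10, [192], 20160, [[], [], [], [], [576], [], []]), (10,
  [144], 10080, [[], [884745], [], [], [576], [], []]), (11, [], 840, [[], [532480, 827392],
  [36864], [], [585, 1098, 1539], [216], []]), (11, [192], 2520, [[], [], [36864], [], [585, 1098,
  1539], [216], []]), (12, [], 840, [[], [532480, 827392], [36864], [], [585, 1098, 1539], [216],
  []]), (12, [192], 2520, [[], [], [36864], [], [585, 1098, 1539], [216], []]), (13, [], 10080,
  [[2359512], [], [], [32256], [], [], []]), (13, [192], 10080, [[2359512], [], [], [32256], [],
  [], []]), (14, [], 840, [[2359872, 4792320, 7152192, 9439488, 11799360], [], [37440, 224640,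
  262080], [], [], [], [9]]), (14, [192], 2520, [[2359872], [], [37440, 224640, 262080], [], [],
  [], [9]]), (14, [48, 192], 2520, [[2359872, 4792320, 7152192], [], [37440], [], [], [], [9]]),
  (14, [12, 48, 192], 840, [[2359872, 4792320, 7152192, 9439488, 11799360], [], [37440, 224640,
  262080], [], [], [], [9]]), (15, [], 5040, [[2359872], [], [37440, 224640, 262080], [], [], [],
  []]), (15, [192], 5040, [[2359872], [], [37440, 224640, 262080], [], [], [], []]), (16, [],
  10080, [[2397200, 4792320, 7189520], [], [], [], [], [], []]), (16, [192], 20160, [[2397200],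
  [], [], [], [], [], []]), (16, [48, 192], 10080, [[2397200, 4792320, 7189520], [], [], [], [],
  [], []]), (17, [], 20160, [[2397200], [], [], [], [], [], []]), (17, [192], 20160, [[2397200],
  [], [], [], [], [], []]), (18, [], 5040, [[2360466, 4792536, 7152273], [], [37449], [], [], [],
  []]), (18, [192], 10080, [[2360466], [], [37449], [], [], [], []]), (18, [48, 192], 5040,
  [[2360466, 4792536, 7152273], [], [37449], [], [], [], []]), (19, [], 20160, [[], [], [37449],
  [], [], [], []]), (19, [192], 20160, [[], [], [37449], [], [], [], []]), (20, [], 10080, [[],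
  [], [229824], [32265], [], [], []]), (20, [192], 10080, [[], [], [229824], [32265], [], [],
  []]), (21, [], 10080, [[], [], [229824], [32265], [], [], []]), (21, [192], 10080, [[], [],
  [229824], [32265], [], [], []]), (22, [], 2520, [[2376724], [], [229824], [32256], [], [],
  [9]]), (22, [192], 2520, [[2376724], [], [229824], [32256], [], [], [9]]), (23, [], 5040, [[],
  [], [37440, 224640, 262080], [], [], [], [9]]), (23, [192], 5040, [[], [], [37440, 224640,
  262080], [], [], [], [9]]), (24, [], 2520, [[2359305], [], [36873, 147492, 184365], [], [576],
  [], []]), (24, [192], 2520, [[2359305], [], [36873, 147492, 184365], [], [576], [], []]), (25,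
  [], 3360, [[2391682], [], [64665, 148068, 189845, 204490, 251883], [], [], [], []]), (25, [192],
  3360, [[2391682], [], [64665, 148068, 189845, 204490, 251883], [], [], [], []]), (26, [], 56,
  [[2359296, 4239360, 6303744, 8390656], [532480, 827392, 1313280], [36864, 199680], [32256], [],
  [130, 202], [9]]), (27, [], 6720, [[], [532610, 827545], [37080], [], [], [], []]), (28, [],
  280, [[10486000, 12582960], [532480, 827392, 1313280], [36864, 199680], [32256], [], [216],
  []]), (29, [], 3360, [[], [], [36864, 199680], [32256], [], [216], []]), (30, [], 840, [[],
  [532480, 827392, 1313280], [36864, 199680], [32256], [], [216], []]), (31, [], 1680, [[2359512,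
  4240472, 6304320], [533520, 828112], [37080], [], [], [], []]), (32, [], 5040, [[2359512,
  4793859, 7153371], [], [37080], [], [], [], []]), (33, [], 6720, [[2391552, 4284800], [885312],
  [], [], [], [], []]), (34, [], 3360, [[2559192, 4688592, 8521760, 11405432, 13831472], [885312],
  [], [], [], [], []]), (35, [], 20160, [[2559192], [], [], [], [], [], []]), (36, [], 20160, [[],
  [885312], [], [], [], [], []]), (37, [], 20160, [[], [885312], [], [], [], [], []]), (38, [],
  20160, [[2391682], [], [], [], [], [], []]), (39, [], 20160, [[], [], [37080], [], [], [], []]),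
  (40, [], 10080, [[8546720], [], [37080], [], [], [], []]), (41, [], 10080, [[2359305], [],
  [36873], [], [], [], []]), (42, [], 6720, [[2391682], [], [64665, 204490], [], [], [], []]),
  (43, [], 10080, [[4280936], [], [], [32472], [], [], []]), (44, [], 20160, [[], [], [], [32472],
  [], [], []]), (45, [], 20160, [[11020099], [], [], [], [], [], []]), (46, [], 560, [[], [643680,
  905832, 1048824, 1430432, 1835064], [36864, 199680], [32256], [], [216], []]), (47, [], 5040,
  [[], [905832], [], [32256], [], [216], []]), (48, [], 10080, [[2396160], [], [], [], [], [216],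
  []]), (49, [], 3360, [[2359305], [], [36864, 199680], [32256], [], [], []]), (50, [], 20160,
  [[7617033], [], [], [], [], [], []]), (51, [], 10080, [[4292226, 6503424, 8427650], [], [], [],
  [], [], []]), (52, [], 5040, [[7552265, 12799028, 15719028], [885321], [], [], [], [], []]),
  (53, [], 6720, [[12782640, 15665713], [884745], [], [], [], [], []]), (54, [], 3360, [[2379816,
  4276228], [884745], [], [], [576], [], []]), (55, [], 5040, [[2359872], [], [], [21096, 26000,
  32472], [], [], []]), (56, [], 10080, [[15860007], [884952], [], [], [], [], []]), (57, [], 28,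
  [[2359296, 4239360, 6303744, 8389440, 10486080], [532480, 827392, 1048832, 1311488], [36864,
  197568, 229824], [24960, 29568], [576], [], [9]]), (58, [], 56, [[12582927, 14680071], [532480,
  827392, 1048832, 1311488], [36864, 197568, 229824], [24960, 29568], [576], [], [9]]), (59, [],
  168, [[], [532480, 827392, 1048832, 1311488], [36864, 197568, 229824], [24960, 29568], [576],
  [], [9]]), (60, [], 35, [[2359296, 4793490, 7152786, 8987805, 11084949, 12582927, 14680071],
  [1572870, 1835022], [36864, 197568, 229824], [24960, 29568], [576], [], [9]]), (61, [], 280,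
  [[], [1572870, 1835022], [36864, 197568, 229824], [24960, 29568], [576], [], [9]]), (62, [],
  5040, [[15729943], [1313496], [37080], [], [], [], []]), (63, [], 3360, [[4284809, 6377930,
  10502468, 12632413, 14836135], [], [37080], [], [], [], []]), (64, [], 840, [[2391561, 4260425,
  6716061, 8554717, 10620055, 12814323, 14878050], [663714, 909705, 1216764, 1823214, 1884445],
  [], [], [], [], []]), (65, [], 8, [[2359296, 4239360, 6303744, 8389360, 10486000, 12582960],
  [532480, 827392, 1048824, 1311480, 1835064], [36864, 131104, 197344, 229600], [20520, 24808,
  29416], [576, 1040], [216], []]), (66, [], 1, [[2359296, 4239360, 6303744, 8389255, 10485895,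
  12582927, 14680071], [532480, 827392, 1048710, 1311366, 1572870, 1835022], [36864, 131085,
  163845, 197253, 229509], [16388, 20492, 24708, 29316], [576, 1035, 1539], [130, 202], [9]])]

/-- The certificates for the candidate quatroids. -/
def pairCerts : List (List ℕ) :=
  [[0, 16777216, 17403904, 17309696, 17320451, 17318146, 17317945, 17317894, 33554432, 21037056,
  50331648, 50351619, 50348418, 50348073, 50348036, 21016576, 50368512, 50470411, 50467210,
  50466856, 50466828, 21022723, 50383875, 50465803, 50482578, 50482219, 50482196, 21020994,
  50381250, 50463178, 50483154, 50479594, 50479580, 21020721, 50380833, 50462752, 50482723,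
  50479522, 50479140, 21020679, 50380805, 50462733, 50482709, 50479517, 50479149, 35913728,
  21569536, 50864128, 51392064, 51388800, 51388585, 51388548, 58768384, 67108864, 67109017,
  67108994, 58766272, 67109440, 67109976, 67109962, 58765985, 67109521, 67109904, 67110034,
  58765957, 67109507, 67109899, 67110043, 21580291, 50874883, 51382848, 51399555, 51399273,
  51399236, 58759168, 67141120, 67141273, 67141250, 58771906, 67137088, 67128921, 67128898,
  58771489, 67137169, 67128849, 67129042, 58771461, 67137155, 67128835, 67129051, 21577986,
  50872578, 51380480, 51400451, 51396905, 51396868, 58757952, 67138432, 67138968, 67138954,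
  58772802, 67133824, 67125657, 67125634, 58770273, 67134864, 67126161, 67126674, 58770245,
  67134859, 67126147, 67126683, 21577785, 50872377, 51380409, 51400313, 51397049, 51396860,
  58757809, 67138217, 67138600, 67138730, 58772529, 67133609, 67125289, 67125482, 58770417,
  67134568, 67125865, 67126378, 58770165, 67134635, 67125995, 67126315, 21577734, 50872326,
  51380358, 51400262, 51396998, 51396846, 58757767, 67138180, 67138572, 67138716, 58772487,
  67133572, 67125252, 67125468, 58770375, 67134540, 67125828, 67126364, 58770151, 67134612,
  67125972, 67126292, 36245504, 21637131, 50993675, 51419712, 51518347, 51518056, 51518028,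
  58722304, 67308544, 67308697, 67308674, 58853834, 67341376, 67243096, 67243082, 58853408,
  67341457, 67243024, 67243154, 58853389, 67341443, 67243019, 67243163, 59771136, 68166016,
  68690329, 68690306, 79704976, 83886080, 79704971, 83886089, 59771065, 68165801, 68689961,
  68690154, 79704680, 83886296, 79704747, 83886233, 59771014, 68165764, 68689924, 68690140,
  79704652, 83886282, 79704724, 83886210, 21635402, 50991370, 51417344, 51519243, 51515688,
  51515660, 58721088, 67306432, 67306968, 67306954, 58854730, 67338688, 67240408, 67240394,
  58852192, 67339728, 67240912, 67241938, 58852173, 67339723, 67240907, 67241947, 59771712,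
  68169280, 68693593, 68693570, 79707664, 83886656, 79707659, 83886665, 59770232, 68166760,
  68690537, 68691050, 79704104, 83887192, 79705643, 83887705, 59770190, 68166732, 68690500,
  68691036, 79704076, 83887178, 79705620, 83887682, 21635120, 50991160, 51417273, 51519096,
  51515832, 51515580, 58720945, 67306145, 67306528, 67306658, 58854448, 67338401, 67239968,
  67240098, 58852336, 67339360, 67240544, 67241570, 58852021, 67339427, 67240611, 67241507,
  59771569, 68169361, 68693521, 68693714, 79707736, 83886800, 79707803, 83886737, 59770160,
  68167056, 68690833, 68691346, 79704472, 83887120, 79706011, 83887633, 59770038, 68166804,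
  68690644, 68690964, 79704220, 83887250, 79705692, 83887826, 21635087, 50991118, 51417222,
  51519054, 51515790, 51515566, 58720903, 67306117, 67306509, 67306653, 58854415, 67338373,
  67239949, 67240093, 58852303, 67339341, 67240525, 67241565, 58852007, 67339413, 67240597,
  67241493, 59771527, 68169347, 68693507, 68693723, 79707722, 83886795, 79707794, 83886723,
  59770127, 68167051, 68690819, 68691355, 79704458, 83887115, 79706002, 83887619, 59770047,
  68166827, 68690667, 68690987, 79704234, 83887259, 79705706, 83887835, 36188160, 21645586,
  51006418, 51432387, 51514315, 51530731, 51530708, 58739074, 67333504, 67325337, 67325314,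
  58857866, 67370368, 67272088, 67272074, 58870178, 67358097, 67267984, 67259794, 58870173,
  67358083, 67267979, 67259803, 59779456, 68157696, 68682009, 68681986, 79692624, 83911040,
  79692619, 83911049, 59787705, 68174121, 68706601, 68702506, 79721320, 83906968, 79709035,
  83902873, 59787654, 68174084, 68706564, 68702492, 79721292, 83906954, 79709012, 83902850,
  59902960, 68288800, 68911393, 68813090, 79889248, 84018128, 79856483, 84050897, 81273684,
  85460242, 59902927, 68288781, 68911365, 68813085, 79889229, 84018123, 79856469, 84050883,
  81273707, 85460251, 21645371, 51005987, 51432033, 51513952, 51530659, 51530340, 58738729,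
  67333289, 67324969, 67325162, 58857512, 67370153, 67271720, 67271850, 58870250, 67357801,
  67267688, 67259498, 58869805, 67357931, 67267755, 67259435, 59779241, 68157625, 68681785,
  68681978, 79692400, 83910888, 79692467, 83910825, 59787561, 68174265, 68706745, 68702650,
  79721392, 83906600, 79709107, 83902505, 59787502, 68174076, 68706556, 68702268, 79721140,
  83906730, 79708788, 83902698, 59902816, 68289016, 68911609, 68813306, 79889392, 84017760,
  79856627, 84050529, 81273460, 85460090, 59902631, 68288701, 68911357, 68812861, 79889077,
  84017827, 79856245, 84050659, 81273779, 85460027, 21645334, 51005973, 51432005, 51513933,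
  51530645, 51530349, 58738692, 67333252, 67324932, 67325148, 58857484, 67370116, 67271692,
  67271836, 58870236, 67357764, 67267660, 67259484, 58869796, 67357908, 67267732, 67259412,
  59779204, 68157574, 68681734, 68681950, 79692367, 83910860, 79692439, 83910788, 59787524,
  68174214, 68706694, 68702622, 79721359, 83906572, 79709079, 83902468, 59787516, 68174062,
  68706542, 68702254, 79721135, 83906716, 79708783, 83902684, 59902797, 68288974, 68911558,
  68813278, 79889359, 84017741, 79856599, 84050501, 81273455, 85460062, 59902645, 68288678,
  68911334, 68812838, 79889063, 84017813, 79856231, 84050645, 81273751, 85459990, 36194307,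
  21643570, 51003682, 51429665, 51511584, 51531555, 51527972, 58737513, 67331488, 67322785,
  67323298, 58856296, 67368352, 67269536, 67270562, 58871146, 67355041, 67264928, 67256738,
  58868589, 67356067, 67266467, 67257251, 59778408, 68158584, 68682361, 68682874, 79691824,
  83911784, 79693363, 83912297, 59788137, 68177529, 68710009, 68705914, 79724080, 83907176,
  79711795, 83903081, 59786606, 68174972, 68707452, 68702844, 79722036, 83908202, 79708212,
  83903594, 59902240, 68291704, 68914297, 68815994, 79891504, 84017184, 79858739, 84049953,
  81272884, 85459194, 59901735, 68290173, 68912253, 68813437, 79889973, 84018723, 79855669,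
  84050979, 81276467, 85459707, 59918628, 68305318, 68932006, 68837798, 79905703, 84033572,
  79885223, 84070436, 81264694, 85483772, 21643551, 51003677, 51429637, 51511565, 51531541,
  51527981, 58737476, 67331469, 67322757, 67323293, 58856268, 67368333, 67269517, 67270557,
  58871132, 67355013, 67264909, 67256733, 58868580, 67356053, 67266453, 67257237, 59778380,
  68158542, 68682310, 68682846, 79691791, 83911756, 79693335, 83912260, 59788100, 68177478,
  68709958, 68705886, 79724047, 83907148, 79711767, 83903044, 59786620, 68174958, 68707438,
  68702830, 79722031, 83908188, 79708207, 83903580, 59902221, 68291662, 68914246, 68815966,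
  79891471, 84017165, 79858711, 84049925, 81272879, 85459166, 59901749, 68290150, 68912230,
  68813414, 79889959, 84018709, 79855655, 84050965, 81276439, 85459670, 59918637, 68305341,
  68932029, 68837821, 79905717, 84033581, 79885237, 84070445, 81264703, 85483758, 36192578,
  21643318, 51003430, 51429606, 51511462, 51531366, 51528102, 58737391, 67331236, 67322596,
  67322916, 58856111, 67368100, 67269284, 67270180, 58870831, 67354852, 67264676, 67256356,
  58868719, 67355748, 67266148, 67256932, 59778223, 68158614, 68682454, 68682774, 79691935,
  83911828, 79693407, 83912404, 59788015, 68177622, 68710102, 68705814, 79724191, 83907220,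
  79711839, 83903188, 59786543, 68175254, 68707734, 68703126, 79722399, 83908116, 79708575,
  83903508, 59902118, 68291734, 68914390, 68815894, 79891615, 84017309, 79858783, 84050141,
  81273247, 85458950, 59901798, 68290518, 68912598, 68813782, 79890399, 84018781, 79856095,
  84051037, 81276511, 85459526, 59918758, 68305188, 68931876, 68837668, 79905636, 84033949,
  79885156, 84070813, 81264927, 85483910, 36192305, 36192263, 100663296], [117440512, 134217728,
  135102464, 150994944, 151014915, 151011714, 151011369, 151011332, 167772160, 138477568,
  184549376, 184569347, 184566146, 184565801, 184565764, 153354240, 186908672, 201326592,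
  201327168, 201327249, 201327235, 153374211, 186928643, 201358848, 201346626, 201346577,
  201346563, 153371010, 186925442, 201356160, 201343362, 201343889, 201343875, 153370665,
  186925097, 201355945, 201343017, 201343593, 201343723, 153370628, 186925060, 201355908,
  201342980, 201343556, 201343700, 170131456, 153944064, 187498496, 202211328, 202211904,
  202211985, 202211971, 205618688, 218103808, 218103961, 218103938, 205616000, 218104384,
  218104920, 218104906, 205615785, 218104465, 218104848, 218104978, 205615748, 218104451,
  218104843, 218104987, 153964035, 187518467, 202243584, 202231362, 202231313, 202231299,
  205586432, 218136064, 218136217, 218136194, 205603202, 218132032, 218123865, 218123842,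
  205602857, 218132113, 218123793, 218123986, 205602820, 218132099, 218123779, 218123995,
  153960834, 187515266, 202240896, 202228098, 202228625, 202228611, 205587008, 218133376,
  218133912, 218133898, 205606466, 218128768, 218120601, 218120578, 205603433, 218129808,
  218121105, 218121618, 205603396, 218129803, 218121091, 218121627, 153960489, 187514921,
  202240681, 202227753, 202228329, 202228459, 205587089, 218133161, 218133544, 218133674,
  205606417, 218128553, 218120233, 218120426, 205603729, 218129512, 218120809, 218121322,
  205603540, 218129579, 218120939, 218121259, 153960452, 187514884, 202240644, 202227716,
  202228292, 202228436, 205587075, 218133124, 218133516, 218133660, 205606403, 218128516,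
  218120196, 218120412, 205603715, 218129484, 218120772, 218121308, 205603563, 218129556,
  218120916, 218121236, 170721280], [234881024, 251658240, 252312576, 252390400, 252971520,
  268435456, 268435609, 268435586, 285212672, 301989888, 318767104, 319684096, 335544320,
  335544473, 335544450, 302026752, 318803968, 319761920, 335581184, 335581337, 335581314,
  302644224, 319421440, 320080384, 336198656, 336198809, 336198786, 352321536, 369098752,
  369098905, 369098882, 302722048, 319499264, 320117248, 336276480, 336276633, 336276610,
  352358400, 369135616, 369135769, 369135746], [385875968, 402653184, 403280592, 403186704,
  403200528, 403313424, 404488248, 419430400, 436207616], [452984832, 469762048, 470388736,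
  470294528, 474021888, 486539264, 474001408, 486576128, 474554368, 487071744], [503316480,
  520093696, 520979008, 536870912, 524378496, 553648128, 539262464, 556039680, 570425344,
  539849600, 556626816, 571310656, 574710144, 587202560], [603979776, 620756992, 621384400,
  621290512], [637534208, 654311424, 654938112, 654843904, 658992000, 671088640, 671125504,
  658992896, 671089216, 671126080, 659651456, 671973376, 671715328, 677866432, 687865856,
  659652352, 671973952, 671715904, 677866752, 687866432, 659766144, 671916032, 671621120,
  677903296, 687902720, 678525888, 688398912, 659767040, 671916608, 671621696, 677903616,
  687903296, 678526208, 688398336], [704643072, 721420288, 738197504, 738234368, 740781440,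
  754974720, 755011584, 740782016, 754975296, 755012160], [771751936, 788529152, 789155840,
  789061632], [805306368, 822083584, 822968329, 838860800], [855638016, 872415232, 873041920,
  872947712], [889192448, 905969664, 906596352, 906502144], [922746880, 939524096], [956301312,
  973078528, 977870848, 989855744, 978020608, 990080384, 999295232, 1006632960], [1023410176,
  1040187392], [1056964608, 1073741824, 1078534144, 1090519040], [1107296256, 1124073472],
  [1140850688, 1157627904, 1162420440, 1174405120], [1191182336, 1207959552], [1224736768,
  1241513984], [1258291200, 1275068416], [1291845632, 1308622848], [1325400064, 1342177280],
  [1358954496, 1375731712], [1392508928, 1409286144], [1426063360], [1442840576], [1459617792],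
  [1476395008], [1493172224], [1509949440], [1526726656], [1543503872], [1560281088],
  [1577058304], [1593835520], [1610612736], [1627389952], [1644167168], [1660944384],
  [1677721600], [1694498816], [1711276032], [1728053248], [1744830464], [1761607680],
  [1778384896], [1795162112], [1811939328], [1828716544], [1845493760], [1862270976],
  [1879048192], [1895825408], [1912602624], [1929379840], [1946157056], [1962934272],
  [1979711488], [1996488704], [2013265920], [2030043136], [2046820352], [2063597568],
  [2080374784], [2097152000]]

/-- Coordinates of points that realize the linear spaces on eight points. -/
def coordData : List (List ℕ) :=
  [[8411, 9038, 8389, 6535, 9085, 7137, 7239, 6561], [7135, 7861, 9035, 7211, 8414, 9111, 7163,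
  7164], [7161, 9037, 8487, 7188, 6536, 6561, 8389, 9013], [9035, 6586, 7861, 7187, 8436, 7162,
  6536, 9063], [8412, 7785, 6561, 7211, 7787, 7138, 8436, 8461], [8388, 7239, 7837, 8462, 7163,
  6538, 7788, 7838], [6587, 8485, 9085, 9063, 7811, 7837, 7861, 8436], [7210, 7213, 8463, 7237,
  9086, 7787, 9111, 6586], [7139, 7212, 7162, 7786, 6561, 9111, 7788, 8436], [7235, 6513, 9037,
  7185, 7213, 7212, 7811, 7214], [8460, 7239, 8438, 6561, 8462, 7135, 6539, 8437], [7786, 6589,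
  7811, 7213, 9111, 7189, 8488, 9036], [7789, 7187, 7213, 7836, 6587, 6561, 6613, 7786], [8436,
  7135, 7238, 7839, 7788, 7237, 7813, 7761], [7789, 8385, 7213, 8462, 7212, 8438, 6587, 7210],
  [6539, 7136, 7161, 7863, 8411, 7813, 7162, 7838], [6539, 8439, 7861, 8462, 8437, 7863, 7787,
  7236], [7187, 7863, 7161, 7162, 7788, 8388, 8438, 8439], [8387, 6513, 9085, 8413, 7811, 7787,
  8411, 7162], [7161, 8461, 7838, 7788, 7188, 7186, 8412, 7787], [6561, 8388, 7785, 8488, 8436,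
  7135, 8462, 7186], [7788, 7188, 8463, 7213, 8413, 8462, 7813, 7163], [6537, 6511, 8463, 6587,
  8438, 8385, 8411, 7786], [9038, 7160, 8439, 7836, 9039, 8436, 6561, 8412], [8436, 7838, 8413,
  7213, 7788, 8438, 7811, 8412], [7163, 8438, 8412, 8436, 7162, 7211, 7836, 7813], [6539, 8464,
  8487, 7837, 8463, 7136, 8438, 7236], [7213, 9089, 9111, 8438, 7811, 8439, 9061, 8462], [6513,
  7188, 7163, 6536, 6586, 6561, 9013, 7213], [8411, 7236, 7788, 6538, 8488, 7786, 7214, 8412],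
  [7785, 7163, 7238, 7210, 8438, 7162, 7788, 7138], [6563, 7161, 8414, 6513, 8486, 8437, 9088,
  7789], [7214, 9039, 7837, 6561, 8439, 7187, 7210, 8412], [9039, 8412, 8389, 7788, 7811, 7837,
  8387, 7187], [7188, 8412, 8489, 7838, 7185, 8387, 7787, 7239], [8412, 8461, 7161, 7838, 7837,
  7788, 8413, 7213], [7137, 7160, 8435, 8385, 8462, 9035, 7785, 7787], [8389, 7813, 9087, 8438,
  7212, 7838, 7837, 7789], [8388, 7139, 8410, 8386, 6613, 7187, 8413, 7235], [8386, 7837, 7161,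
  9011, 7786, 6561, 6536, 7863], [8413, 8411, 7135, 7787, 8462, 9037, 7839, 7161], [8438, 8412,
  7163, 7788, 7837, 7813, 7187, 7211], [8438, 8461, 7212, 7213, 8463, 7187, 7811, 7837], [7188,
  8413, 8463, 7838, 7836, 7811, 8437, 8438], [7186, 8462, 7163, 8411, 7786, 8437, 8436, 7161],
  [7213, 8438, 7838, 7836, 7211, 7163, 7787, 7212], [6535, 7188, 7162, 7212, 7813, 8411, 8488,
  7214], [6539, 6588, 6613, 9063, 7811, 7188, 7787, 6563], [7838, 8461, 7213, 7186, 8462, 7788,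
  7787, 7188], [8387, 7789, 7786, 7187, 8438, 6561, 7813, 8439], [7162, 7786, 8413, 7186, 7813,
  7787, 7161, 8412], [7211, 8462, 8436, 7163, 7212, 7837, 7213, 7813], [6585, 8412, 7187, 7811,
  7836, 8436, 6561, 6587], [7788, 8412, 7161, 7811, 7187, 7162, 7163, 7188], [6587, 7187, 8410,
  7188, 6613, 7136, 7838, 8462], [8463, 7786, 7188, 7836, 7186, 7212, 7813, 8462], [7838, 7836,
  8413, 8435, 8412, 9036, 8411, 9038], [8435, 7837, 7135, 7838, 7161, 7213, 9088, 7187], [8410,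
  8461, 8438, 8462, 7836, 7138, 7210, 7863], [8385, 7213, 7863, 7861, 7813, 7787, 7788, 7786],
  [8387, 7763, 9088, 7836, 8438, 7162, 7139, 8436], [7213, 8413, 6587, 9061, 9085, 7788, 8414,
  6611], [8436, 8413, 7787, 8412, 7187, 7813, 7788, 8438], [7213, 7787, 8438, 7212, 7786, 8437,
  8463, 7211], [11412, 7067, 4531, 11712, 7657, 10967, 7662, 4707], [8486, 8438, 7837, 9089, 7236,
  8463, 7136, 9039], [7787, 8411, 9035, 7163, 6539, 8386, 7138, 8436]]

/-- The lines of the linear spaces on eight points that contain a Fano plane. -/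
def fanoData : List (List ℕ) :=
  [[44, 50, 74, 84, 134, 152, 224], [44, 50, 74, 84, 134, 152, 225]]

/-! ### Evaluation of the certificates -/

/-- The code of the triples contained in the lines with the given masks. -/
noncomputable def linesCode (ls : List ℕ) : ℕ :=
  List.rec (motive := fun _ => ℕ) 0 (fun l _ s =>
    -- All source positions are 0, and the code `1` has the digit one there; hence every triple of
    -- labels in the line is recorded.
    Nat.lor (moveSub 1 3 ((labels.filter (bit l)).map fun i => (0, Nat.pow 2 i)) 0 0) s) ls

/-- Add the sextuples whose complements have the given masks to a code. -/
noncomputable def pairCode (c : ℕ) (es : List ℕ) : ℕ :=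
  List.rec (motive := fun _ => ℕ) c (fun m _ s => Nat.lor s (Nat.pow 2 (Nat.add 256 m))) es

/-- The digits of sextuples lie above those of triples. So a candidate quatroid inherits
representability from its linear space. -/
lemma decode_pairCode_fst (c : ℕ) (es : List ℕ) : (decode (pairCode c es)).1 = (decode c).1 := by
  induction es with
  | nil => rfl
  | cons m es ih =>
    rw [← ih]
    ext S
    have h : pairCode c (m :: es) = pairCode c es ||| 2 ^ (256 + m) := rfl
    have hS : ¬ 256 + m = mask S := by have := mask_lt S; omega
    rw [mem_decode_fst, mem_decode_fst, h, bit_or_two_pow, decide_eq_false hS, Bool.or_false]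

/-- The entries of the census for the given linear spaces. -/
noncomputable def linesEntries (l : List (List ℕ × ℕ × List (List ℕ))) : List Entry :=
  l.map fun x => (linesCode x.1, x.2)

/-- The entries of the census for the candidate quatroids. -/
noncomputable def pairEntries : List Entry :=
  pairData.map fun x => (pairCode (((linesEntries eightData).map Prod.fst).getD x.1 0) x.2.1, x.2.2)

/-- The codes in the entries are less than `2 ^ 2 ^ n`, so that they only involve triples among the
first `n` labels. -/
noncomputable def boundTest (n : ℕ) (l : List Entry) : Bool :=
  l.all fun x => Nat.ble (Nat.succ x.1) (Nat.pow 2 (Nat.pow 2 n))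

lemma lt_of_boundTest {n : ℕ} {l : List Entry} (h : boundTest n l = true) :
    ∀ x ∈ l, x.1 < 2 ^ 2 ^ n :=
  fun x hx => Nat.le_of_ble_eq_true (List.all_eq_true.1 h x hx)

section

set_option maxRecDepth 100000

lemma entryTest_five : (linesEntries fiveData).all (entryTest 5) = true := by decide +kernel

lemma entryTest_six : (linesEntries sixData).all (entryTest 6) = true := by decide +kernel

lemma entryTest_seven : (linesEntries sevenData).all (entryTest 7) = true := by decide +kernel

lemma boundTest_five : boundTest 5 (linesEntries fiveData) = true := by decide +kernel

lemma boundTest_six : boundTest 6 (linesEntries sixData) = true := by decide +kernel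

lemma boundTest_seven : boundTest 7 (linesEntries sevenData) = true := by decide +kernel

lemma boundTest_eight : boundTest 8 (linesEntries eightData) = true := by decide +kernel

/-- The entry `(0, 1, [])` is the empty code with an orbit of one element; the first stage adds five
labels at once. The appended `[]` is the list of excluded codes. -/
lemma certsTest_five : certsTest 5 (tripleItems 0 5) ((linesEntries fiveData).map Prod.fst ++ [])
    [(0, 1, [])] fiveCerts = true := by decide +kernel

lemma certsTest_six : certsTest 6 (tripleItems 5 1) ((linesEntries sixData).map Prod.fst ++ [])
    (linesEntries fiveData) sixCerts = true := by decide +kernel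

lemma certsTest_seven : certsTest 7 (tripleItems 6 1)
    ((linesEntries sevenData).map Prod.fst ++ []) (linesEntries sixData) sevenCerts = true := by
  decide +kernel

lemma entryTest_eight : (linesEntries eightData).all (entryTest 8) = true := by decide +kernel

lemma entryTest_pair : pairEntries.all (entryTest 8) = true := by decide +kernel

lemma coordTest_eight :
    all₂ (fun x l => coordTest x.1 l) (linesEntries eightData) coordData = true := by decide +kernel

lemma fanoTest_fanoData : (fanoData.map linesCode).all fanoTest = true := by decide +kernel

lemma fst_lt_of_mem_pairData : (pairData.all fun x => Nat.ble (Nat.succ x.1) 67) = true := by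
  decide +kernel

lemma length_eightData : eightData.length = 67 := by decide +kernel

/-- The inequality that closes the double count: the claimed orbit sizes add up to no more than the
number of structures found. -/
lemma certsWeight_five : ((linesEntries fiveData).map fun x => x.2.1).sum ≤
    certsWeight (linesEntries fiveData).length [(0, 1, [])] fiveCerts := by
  decide +kernel

lemma certsWeight_six : ((linesEntries sixData).map fun x => x.2.1).sum ≤
    certsWeight (linesEntries sixData).length (linesEntries fiveData) sixCerts := by
  decide +kernel

lemma certsWeight_seven : ((linesEntries sevenData).map fun x => x.2.1).sum ≤
    certsWeight (linesEntries sevenData).length (linesEntries sixData) sevenCerts := by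
  decide +kernel

lemma certsWeight_eight : ((linesEntries eightData).map fun x => x.2.1).sum ≤
    certsWeight (linesEntries eightData).length (linesEntries sevenData) eightCerts := by
  decide +kernel

lemma certsWeight_pair : (pairEntries.map fun x => x.2.1).sum ≤
    certsWeight pairEntries.length (linesEntries eightData) pairCerts := by decide +kernel

/-- The only stage with excluded codes, namely the two extensions of the Fano plane. -/
lemma certsTest_eight : certsTest 8 (tripleItems 7 1)
    ((linesEntries eightData).map Prod.fst ++ fanoData.map linesCode) (linesEntries sevenData)
    eightCerts = true := by
  decide +kernel

lemma certsTest_pair : certsTest 8 pairItems (pairEntries.map Prod.fst ++ [])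
    (linesEntries eightData) pairCerts = true := by
  decide +kernel

end

/-! ### The census -/

/-- The pairs without sextuples that satisfy Bézout's weak criteria and `M`, and whose triples
consist of the first `n` labels. -/
def spaces (n : ℕ) (M : Pair → Prop) : Set Pair :=
  {Q | Q.OfTriplesAndSextuples ∧ Q.BezoutWeak ∧ Q.2 = ∅ ∧ (∀ S ∈ Q.1, ∀ i ∈ S, (i : ℕ) < n) ∧ M Q}

lemma BezoutWeak.restrict {Q : Pair} (h : Q.BezoutWeak) (n : ℕ) :
    (restrict n Q).BezoutWeak := by
  constructor
  · intro I _ J hJ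
    exact absurd hJ (Finset.notMem_empty J)
  · intro I₁ h₁ I₂ h₂ hlt I hI hc
    obtain ⟨h₁, h₁'⟩ := Finset.mem_filter.1 h₁
    obtain ⟨h₂, h₂'⟩ := Finset.mem_filter.1 h₂
    refine Finset.mem_filter.2 ⟨h.line_line I₁ h₁ I₂ h₂ hlt I hI hc, fun i hi => ?_⟩
    rcases Finset.mem_union.1 (hI hi) with hi | hi
    · exact h₁' i hi
    · exact h₂' i hi
  · intro I _ J hJ
    exact absurd hJ (Finset.notMem_empty J)

lemma restrict_mem_spaces {n : ℕ} {M : Pair → Prop} {Q : Pair} (h₁ : Q.OfTriplesAndSextuples)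
    (h₂ : Q.BezoutWeak) (hM : M (restrict n Q)) : restrict n Q ∈ spaces n M :=
  ⟨⟨fun I hI => h₁.1 I (Finset.mem_of_mem_filter I hI),
      fun J hJ => absurd hJ (Finset.notMem_empty J)⟩,
    BezoutWeak.restrict h₂ n, rfl, fun _ hS => (Finset.mem_filter.1 hS).2, hM⟩

lemma smul_mem_spaces {n : ℕ} {M : Pair → Prop} (hM : ∀ (σ : Equiv.Perm (Fin 8)) Q, M Q → M (σ • Q))
    {σ : Equiv.Perm (Fin 8)} (hσ : σ ∈ fixing n) {Q : Pair} (hQ : Q ∈ spaces n M) :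
    σ • Q ∈ spaces n M := by
  obtain ⟨h₁, h₂, h₃, h₄, h₅⟩ := hQ
  refine ⟨OfTriplesAndSextuples.smul h₁ σ, BezoutWeak.smul h₂ σ, ?_, fun S hS i hi => ?_, hM σ Q h₅⟩
  · refine Finset.eq_empty_of_forall_notMem fun J hJ => ?_
    rw [mem_smul_snd, h₃] at hJ
    exact Finset.notMem_empty _ hJ
  · have := lt_of_fixing hσ (h₄ _ (mem_smul_fst.1 hS) _ (Finset.smul_mem_smul_finset hi))
    simpa using this

lemma lawfulTest_of_entryTest {n : ℕ} {l : List Entry} (h : l.all (entryTest n) = true) {x : Entry}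
    (hx : x ∈ l) : lawfulTest x.1 = true :=
  (Bool.and_eq_true _ _ ▸ List.all_eq_true.1 h x hx).1

lemma bezoutWeak_decode {s : ℕ} (h : lawfulTest s = true) : (decode s).BezoutWeak :=
  bezoutWeak_of_lawful (decode_ofTriplesAndSextuples s) (isDigits_decode s)
    (lawful_of_lawfulTest h)

lemma decode_mem_spaces {n s : ℕ} {M : Pair → Prop} (hn : n ≤ 8) (hs : s < 2 ^ 2 ^ n)
    (h : lawfulTest s = true) (hM : M (decode s)) : decode s ∈ spaces n M := by
  refine ⟨decode_ofTriplesAndSextuples s, bezoutWeak_decode h, ?_, fun S hS => ?_, hM⟩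
  · refine Finset.eq_empty_of_forall_notMem fun J hJ => ?_
    have h₁ := (mem_decode_snd.1 hJ).2
    have h₂ : 2 ^ n ≤ 256 := Nat.pow_le_pow_right (n := 2) (by norm_num) hn
    rw [bit_eq_false hs (by omega)] at h₁
    exact Bool.noConfusion h₁
  · rw [← mask_lt_two_pow_iff]
    by_contra hlt
    have h₁ := (mem_decode_fst.1 hS).2
    rw [bit_eq_false hs (not_lt.1 hlt)] at h₁
    exact Bool.noConfusion h₁

lemma digits_eq_false_of_mem_spaces {n d p : ℕ} {M : Pair → Prop} {Q : Pair}
    (hQ : Q ∈ spaces (n + d) M) (hp : 2 ^ n ≤ p) (hp' : p ∉ (tripleItems n d).map Prod.fst) :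
    digits Q p = false := by
  obtain ⟨h₁, -, h₃, h₄, -⟩ := hQ
  rw [digits, decide_eq_false_iff_not]
  rintro (⟨S, hS, rfl⟩ | ⟨J, hJ, -⟩)
  · exact hp' (mask_mem_tripleItems (h₁.1 S hS) hp (mask_lt_two_pow_iff.2 (h₄ S hS)))
  · rw [h₃] at hJ
    exact Finset.notMem_empty _ hJ

lemma digits_eq_false_of_notMem_pairItems {Q : Pair} {p : ℕ} (hp : IsPosition p) (h : 2 ^ 8 ≤ p)
    (h' : p ∉ pairItems.map Prod.fst) : digits Q p = false := by
  rcases hp with ⟨S, -, rfl⟩ | ⟨E, hE, rfl⟩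
  · exact absurd (mask_lt S) (not_lt.2 h)
  · exact absurd (add_mask_mem_pairItems hE) h'

/-- A triple is nonempty, so without labels only the empty pair remains. -/
lemma census_zero : Census (fixing 0) (spaces 0 fun _ => True)
    (fun i : Fin [((0, 1, []) : Entry)].length => decode [((0, 1, []) : Entry)][i].1)
    fun i => [((0, 1, []) : Entry)][i].2.1 := by
  have h₀ : decode 0 = (∅, ∅) := by
    refine Prod.ext ?_ ?_ <;> refine Finset.eq_empty_of_forall_notMem fun S hS => ?_
    · simpa [bit_eq_testBit] using (mem_decode_fst.1 hS).2
    · simpa [bit_eq_testBit] using (mem_decode_snd.1 hS).2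
  have h₁ : ∀ Q ∈ spaces 0 fun _ => True, Q = (∅, ∅) := by
    rintro Q ⟨h₁, -, h₃, h₄, -⟩
    refine Prod.ext (Finset.eq_empty_of_forall_notMem fun S hS => ?_) h₃
    obtain ⟨i, hi⟩ := Finset.card_pos.1 (by rw [h₁.1 S hS]; norm_num)
    exact Nat.not_lt_zero _ (h₄ S hS i hi)
  have h₂ : ((∅, ∅) : Pair) ∈ spaces 0 fun _ => True := by
    refine ⟨⟨?_, ?_⟩, ⟨?_, ?_, ?_⟩, rfl, ?_, trivial⟩ <;> simp
  have h₃ : ∀ i : Fin [((0, 1, []) : Entry)].length,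
      decode [((0, 1, []) : Entry)][i].1 = (∅, ∅) := by
    intro i
    obtain rfl : i = 0 := Subsingleton.elim (α := Fin 1) _ _
    exact h₀
  have h₄ : MulAction.orbit (fixing 0) ((∅, ∅) : Pair) = {(∅, ∅)} := by
    ext Q
    rw [Set.mem_singleton_iff]
    constructor
    · rintro ⟨σ, rfl⟩
      exact h₁ _ (smul_mem_spaces (fun _ _ _ => trivial) σ.2 h₂)
    · rintro rfl
      exact MulAction.mem_orbit_self _
  refine ⟨fun i => ?_, fun Q hQ => ⟨(0 : Fin 1), ?_⟩,
    fun i j _ => Subsingleton.elim (α := Fin 1) _ _, fun i => ?_⟩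
  · rw [h₃, h₄, Set.singleton_subset_iff]
    exact h₂
  · rw [h₃, h₁ Q hQ]
    exact MulAction.mem_orbit_self _
  · rw [h₃, h₄, Set.ncard_singleton]
    obtain rfl : i = 0 := Subsingleton.elim (α := Fin 1) _ _
    rfl

/-- The step of the census that adds `d` points. -/
theorem census_spaces {n d : ℕ} (h : n + d ≤ 8) {M : Pair → Prop}
    (hM : ∀ (σ : Equiv.Perm (Fin 8)) Q, M Q → M (σ • Q))
    {prev next : List Entry} (hprev : ∀ r ∈ prev, r.1 < 2 ^ 2 ^ n)
    (hY : Census (fixing n) (spaces n fun _ => True)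
      (fun i : Fin prev.length => decode prev[i].1) fun i => prev[i].2.1)
    (hnext : boundTest (n + d) next = true) (hnextM : ∀ x ∈ next, M (decode x.1))
    (htest : next.all (entryTest (n + d)) = true) {bad : List ℕ} (hbad : ∀ c ∈ bad, ¬ M (decode c))
    {certs : List (List ℕ)}
    (hcerts : certsTest (n + d) (tripleItems n d) (next.map Prod.fst ++ bad) prev certs = true)
    (hsum : (next.map fun x => x.2.1).sum ≤ certsWeight next.length prev certs) :
    Census (fixing (n + d)) (spaces (n + d) M)
      (fun j : Fin next.length => decode next[j].1) fun j => next[j].2.1 :=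
  census_of_certs h (Nat.le_add_right n d) (scheme_tripleItems h) hprev hY
    (fun _ hQ => restrict_mem_spaces hQ.1 hQ.2.1 trivial)
    (fun _ hσ _ hQ => smul_mem_spaces hM hσ hQ)
    (fun _ hQ => ⟨hQ.1, hQ.2.1, fun _ _ hp hp' => digits_eq_false_of_mem_spaces hQ hp hp'⟩)
    (fun x hx => decode_mem_spaces h (lt_of_boundTest hnext x hx)
      (lawfulTest_of_entryTest htest hx) (hnextM x hx))
    htest (fun c hc hQ => hbad c hc hQ.2.2.2.2) hcerts hsum

lemma isMatroidal_of_mem_eight {x : Entry} (hx : x ∈ linesEntries eightData) :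
    (decode x.1).IsMatroidal := by
  obtain ⟨k, hk, rfl⟩ := List.mem_iff_getElem.1 hx
  have h := forall₂_of_all₂ coordTest_eight
  exact isMatroidal_of_coordTest ((List.forall₂_iff_get.1 h).2 k hk (h.length_eq ▸ hk))

/-- Up to seven points all linear spaces are kept, including the Fano plane, because restrictions
only have to land in the earlier census. Representability is imposed in the last step, where just
two classes must be rejected. -/
theorem census_eight : Census (fixing 8) (spaces 8 Pair.IsMatroidal)
    (fun j : Fin (linesEntries eightData).length => decode (linesEntries eightData)[j].1)
    fun j => (linesEntries eightData)[j].2.1 := by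
  have h₅ := census_spaces (n := 0) (d := 5) (M := fun _ => True) (prev := [(0, 1, [])])
    (next := linesEntries fiveData) (bad := []) (by norm_num) (fun _ _ _ => trivial)
    (fun r hr => by rw [List.mem_singleton.1 hr]; norm_num) census_zero boundTest_five
    (fun _ _ => trivial) entryTest_five (by simp) certsTest_five certsWeight_five
  have h₆ := census_spaces (n := 5) (d := 1) (M := fun _ => True) (prev := linesEntries fiveData)
    (next := linesEntries sixData) (bad := []) (by norm_num) (fun _ _ _ => trivial)
    (lt_of_boundTest boundTest_five) h₅ boundTest_six (fun _ _ => trivial) entryTest_six (by simp)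
    certsTest_six certsWeight_six
  have h₇ := census_spaces (n := 6) (d := 1) (M := fun _ => True) (prev := linesEntries sixData)
    (next := linesEntries sevenData) (bad := []) (by norm_num) (fun _ _ _ => trivial)
    (lt_of_boundTest boundTest_six) h₆ boundTest_seven (fun _ _ => trivial) entryTest_seven
    (by simp) certsTest_seven certsWeight_seven
  refine census_spaces (n := 7) (d := 1) (M := Pair.IsMatroidal) (prev := linesEntries sevenData)
    (next := linesEntries eightData) (bad := fanoData.map linesCode) (by norm_num)
    (fun σ Q hQ => IsMatroidal.smul hQ σ) (lt_of_boundTest boundTest_seven) h₇ boundTest_eight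
    (fun _ => isMatroidal_of_mem_eight) entryTest_eight (fun c hc => ?_) certsTest_eight
    certsWeight_eight
  exact not_isMatroidal_of_fanoTest (List.all_eq_true.1 fanoTest_fanoData c hc)

lemma isMatroidal_of_mem_pairEntries {x : Entry} (hx : x ∈ pairEntries) :
    (decode x.1).IsMatroidal := by
  obtain ⟨y, hy, rfl⟩ := List.mem_map.1 hx
  have h : y.1 < 67 := Nat.le_of_ble_eq_true (List.all_eq_true.1 fst_lt_of_mem_pairData y hy)
  have hl : y.1 < (linesEntries eightData).length := by
    rwa [linesEntries, List.length_map, length_eightData]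
  refine IsMatroidal.congr (isMatroidal_of_mem_eight (List.getElem_mem hl)) ?_
  rw [decode_pairCode_fst, List.getD_eq_getElem _ _ (by rwa [List.length_map]), List.getElem_map]

/-- Here no label is added: restriction to eight labels forgets the sextuples, and the fibre over a
linear space is the set of its admissible graphs. -/
theorem census_candidateQuatroids : Census (fixing 8) candidateQuatroids
    (fun j : Fin pairEntries.length => decode pairEntries[j].1) fun j => pairEntries[j].2.1 := by
  refine census_of_certs le_rfl le_rfl scheme_pairItems (lt_of_boundTest boundTest_eight)
    census_eight (fun Q hQ => restrict_mem_spaces hQ.1 hQ.2.2 (IsMatroidal.congr hQ.2.1 ?_))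
    (fun σ _ Q hQ => show σ • Q ∈ candidateQuatroids from
      ⟨OfTriplesAndSextuples.smul hQ.1 σ, IsMatroidal.smul hQ.2.1 σ, BezoutWeak.smul hQ.2.2 σ⟩)
    (fun Q hQ => ⟨hQ.1, hQ.2.2, fun p => digits_eq_false_of_notMem_pairItems⟩)
    (fun x hx => ⟨decode_ofTriplesAndSextuples _, isMatroidal_of_mem_pairEntries hx,
      bezoutWeak_decode (lawfulTest_of_entryTest entryTest_pair hx)⟩)
    entryTest_pair (bad := []) (by simp) certsTest_pair certsWeight_pair
  -- `restrict 8` keeps all triples, so it does not affect matroidality.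
  exact (Finset.filter_true_of_mem fun S _ i _ => i.isLt).symm

/-! ### The orbits -/

lemma orbit_fixing_eight (Q : Pair) :
    MulAction.orbit (fixing 8) Q = MulAction.orbit (Equiv.Perm (Fin 8)) Q := by
  ext Q'
  exact ⟨fun ⟨σ, h⟩ => ⟨σ, h⟩, fun ⟨σ, h⟩ => ⟨⟨σ, mem_fixing_eight σ⟩, h⟩⟩

/-- The orbit of the candidate quatroid with number `j`. -/
def orbitAt (j : Fin pairEntries.length) : Set Pair :=
  MulAction.orbit (Equiv.Perm (Fin 8)) (decode pairEntries[j].1)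

lemma orbitAt_injective : Function.Injective orbitAt := fun i j h => by
  refine census_candidateQuatroids.eq_of_mem i j ?_
  rw [orbit_fixing_eight]
  change _ ∈ orbitAt i
  rw [h]
  exact MulAction.mem_orbit_self _

lemma ncard_orbitAt (j : Fin pairEntries.length) : (orbitAt j).ncard = pairEntries[j].2.1 := by
  rw [← census_candidateQuatroids.ncard_orbit, orbit_fixing_eight, orbitAt]

lemma candidateOrbits_eq_range : candidateOrbits = Set.range orbitAt := by
  ext O
  constructor
  · rintro ⟨Q, hQ, rfl⟩
    obtain ⟨j, hj⟩ := census_candidateQuatroids.cover Q hQ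
    rw [orbit_fixing_eight] at hj
    exact ⟨j, (MulAction.orbit_eq_iff.2 hj).symm⟩
  · rintro ⟨j, rfl⟩
    exact ⟨_, census_candidateQuatroids.orbit_subset j (MulAction.mem_orbit_self _), rfl⟩

lemma length_pairEntries : pairEntries.length = 126 := by
  rw [pairEntries, List.length_map]
  decide +kernel

lemma ncard_setOf_getElem {α : Type*} (l : List α) (p : α → Prop) [DecidablePred p] :
    {j : Fin l.length | p l[j]}.ncard = l.countP p := by
  have h : {j : Fin l.length | p l[j]} =
      (((List.finRange l.length).filter fun j : Fin l.length => p l[j]).toFinset :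
        Set (Fin l.length)) := by
    ext j
    simp
  rw [h, Set.ncard_coe_finset, List.toFinset_card_of_nodup ((List.nodup_finRange _).filter _),
    ← List.countP_eq_length_filter]
  conv_rhs => rw [← List.map_getElem_finRange l, List.countP_map]
  rfl

lemma ncard_orbits_of_ncard (s : ℕ) : {O ∈ candidateOrbits | O.ncard = s}.ncard =
    (pairEntries.map fun x => x.2.1).count s := by
  have h : {O ∈ candidateOrbits | O.ncard = s} =
      orbitAt '' {j | pairEntries[j].2.1 = s} := by
    rw [candidateOrbits_eq_range]
    ext O
    constructor
    · rintro ⟨⟨j, rfl⟩, h⟩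
      exact ⟨j, by rwa [ncard_orbitAt] at h, rfl⟩
    · rintro ⟨j, hj, rfl⟩
      exact ⟨⟨j, rfl⟩, (ncard_orbitAt j).trans hj⟩
  rw [h, Set.ncard_image_of_injective _ orbitAt_injective,
    ncard_setOf_getElem _ fun x : Entry => x.2.1 = s, List.count_eq_countP, List.countP_map]
  exact List.countP_congr fun x _ => by simp

lemma sizes_pairEntries :
    (pairEntries.map fun x => x.2.1) = pairData.map fun x => x.2.2.1 := by
  rw [pairEntries, List.map_map]
  rfl

end Quatroid

/-! ### Reading off the total and the table of orbit sizes -/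

set_option maxRecDepth 10000 in
theorem mainTheorem4 :
    candidateQuatroids.ncard = 780617 ∧
    candidateOrbits.ncard = 126 ∧
    (∀ O ∈ candidateOrbits, O ⊆ candidateQuatroids) ∧
    ∀ s : ℕ, {O ∈ candidateOrbits | O.ncard = s}.ncard = orbitTally s := by
  refine ⟨?_, ?_, ?_, fun s => ?_⟩
  · have h : (Quatroid.pairData.map fun x => x.2.2.1).sum = 780617 := by decide +kernel
    rw [Quatroid.census_candidateQuatroids.ncard_eq, ← h, ← Quatroid.sizes_pairEntries,
      ← Fin.sum_univ_fun_getElem]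
    rfl
  · rw [Quatroid.candidateOrbits_eq_range, Set.ncard_range_of_injective Quatroid.orbitAt_injective,
      Nat.card_eq_fintype_card, Fintype.card_fin, Quatroid.length_pairEntries]
  · rw [Quatroid.candidateOrbits_eq_range]
    rintro _ ⟨j, rfl⟩
    rw [Quatroid.orbitAt, ← Quatroid.orbit_fixing_eight]
    exact Quatroid.census_candidateQuatroids.orbit_subset j
  · rw [Quatroid.ncard_orbits_of_ncard, Quatroid.sizes_pairEntries]
    -- Every size in the list occurs in the table; this covers the infinitely many `s` outside the
    -- table.
    have h : ∀ s ∈ Quatroid.pairData.map fun x => x.2.2.1, orbitTally s ≠ 0 := by decide +kernel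
    unfold orbitTally at h ⊢
    split
    -- The default row, after the twenty sizes of the table: its tally is 0, so by `h` such an `s`
    -- is not in the list.
    case h_21 =>
      refine List.count_eq_zero_of_not_mem fun hs => h _ hs ?_
      split <;> first | rfl | contradiction
    all_goals decide +kernel
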